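/- Let $k$ be a field and $s\ge 1$. For a word $w$ of length $|w|=n\geq 1$ over $\{1,\dots,s\}$ let $X_w(f)\in k$ be the coefficient of $z_w$ in a series $f=\sum_{|w|\ge1}X_w(f)z_w$ in non-commuting variables $z_1,\dots,z_s$, and for a partition $\pi$ of $\{1,\dots,n\}$ put $X_{w,\pi}(f)=\prod_{V\in\pi}X_{w|_V}(f)$. The boxed convolution is defined by $X_w(f\boxtimes g)=\sum_{\pi\in NC(n)}X_{w,\pi}(f)\,X_{w,K(\pi)}(g)$, with $NC(n)$ the non-crossing partitions and $K$ the Kreweras complement. Let $\mathfrak G^s(k)$ be the set of series with $X_{(i)}(f)\in k^\times$ for $i=1,\dots,s$, and $\mathfrak G^s_+(k)$ the set of series with $X_{(i)}(f)=1$ for $i=1,\dots,s$. Let $\mathbb B_\infty(k)=\varprojlim\mathbb B_N(k)$ be the projective limit of the groups $\mathbb B_N(k)$ of invertible upper-triangular $N\times N$ matrices, along the maps deleting the last row and column. Let $H$ be $\mathfrak G^s(k)$ or $\mathfrak G^s_+(k)$. For $g\in H$ let $R_g$ act on functions $h:H\to k$ by $(R_gh)(x)=h(x\boxtimes g)$.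 Let $V_n$ be the smallest linear subspace of the space of functions $H\to k$ that is stable under all $R_g$ and contains the coordinate functions $X_w$, $1\le|w|\le n$, and let $V=\bigcup_n V_n$. A minimal faithful representation of $H$ is a map $\rho_k:H\to\mathbb B_\infty(k)$ such that, for some basis $(b_j)_{j\ge0}$ of $V$ in which each $V_n$ is spanned by an initial segment, $\rho_k(g)$ is the matrix of $R_g$ for all $g\in H$. A non-commutative $k$-probability space $(\mathcal A,\phi)$ is a unital associative $k$-algebra $\mathcal A$ with a $k$-linear $\phi:\mathcal A\to k$, $\phi(1)=1$. Its free cumulants $\kappa_n$ are defined by $\phi(a_1\cdots a_n)=\sum_{\pi\in NC(n)}\prod_{V\in\pi}\kappa_{|V|}\big((a_i)_{i\in V}\big)$; subsets of $\mathcal A$ are combinatorially free if their mixed free cumulants vanish. For $\underline a=(a_1,\dots,a_s)\in\mathcal A^s$ let $\mathcal R_k(\underline a)=\sum_{|w|\ge1}\kappa_{|w|}(\underline a_w)z_w$; the law of $\underline a$ is the functional $z_w\mapsto\phi(\underline a_w)$ on $k\langle z_1,\dots,z_s\rangle$. Given a map $\rho_k:H\to\mathbb B_\infty(k)$, define the $s$-dimensional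 $\mathcal S$-transform $\mathcal S_k(\underline a)=\rho_k(\mathcal R_k(\underline a))$ for all $\underline a\in\mathcal A^s$ with $\mathcal R_k(\underline a)\in H$ (that is, $\phi(a_i)\neq0$ for all $i$ if $H=\mathfrak G^s(k)$, and $\phi(a_i)=1$ for all $i$ if $H=\mathfrak G^s_+(k)$). **Theorem (multiplicativity of the general $S$-transform).** 1. $(H,\boxtimes)$ is a group with neutral element $z_1+\cdots+z_s$. A minimal faithful representation $\rho_k:H\to\mathbb B_\infty(k)$ exists, and every such $\rho_k$ is an injective homomorphism. 2. Let $\rho_k$ be a minimal faithful representation of $H$, or more generally any injective homomorphism $H\to\mathbb B_\infty(k)$, and let $(\mathcal A,\phi)$ be a non-commutative $k$-probability space. If $\mathcal R_k(\underline a),\mathcal R_k(\underline a')\in H$, then $\mathcal S_k(\underline a)=\mathcal S_k(\underline a')$ if and only if $\underline a$ and $\underline a'$ have the same law. If $\mathcal R_k(\underline a),\mathcal R_k(\underline b)\in H$ and $\{a_1,\dots,a_s\}$, $\{b_1,\dots,b_s\}$ are combinatorially free, then for $\underline a\star\underline b=(a_1b_1,\dots,a_sb_s)$ one has $\mathcal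 R_k(\underline a\star\underline b)\in H$ and $$\mathcal S_k(\underline a\star\underline b)=\mathcal S_k(\underline a)\cdot\mathcal S_k(\underline b).$$ -/

import Mathlib

noncomputable section

open scoped Classical

/-! ### Non-crossing partitions -/

/-- A partition of `{0, …, n-1}` is non-crossing if there are no `i < j < p < q` such that
`i, p` lie in one block and `j, q` lie in a different block. -/
def IsNonCrossing {n : ℕ} (π : Finpartition (Finset.univ : Finset (Fin n))) : Prop :=
  ∀ V ∈ π.parts, ∀ W ∈ π.parts, ∀ i j p q : Fin n,
    i < j → j < p → p < q → i ∈ V → p ∈ V → j ∈ W → q ∈ W → V = W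

/-- The finite set `NC(n)` of non-crossing partitions of an `n`-element linearly ordered set. -/
def NC (n : ℕ) : Finset (Finpartition (Finset.univ : Finset (Fin n))) :=
  Finset.univ.filter IsNonCrossing

/-- `i̅` and `j̅` may be joined without crossing `π` in the order `1 < 1̅ < 2 < 2̅ < ⋯`:
the points between `i̅` and `j̅`, which form the interval `(i, j]`, are a union of blocks of
`π`. -/
def KrewerasRel {n : ℕ} (π : Finpartition (Finset.univ : Finset (Fin n))) (i j : Fin n) : Prop :=
  ∀ V ∈ π.parts, ∀ p ∈ V, ∀ q ∈ V, (p ∈ Set.uIoc i j ↔ q ∈ Set.uIoc i j)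

theorem krewerasRel_equivalence {n : ℕ} (π : Finpartition (Finset.univ : Finset (Fin n))) :
    Equivalence (KrewerasRel π) where
  refl i := by intro V _ p _ q _; simp
  symm := by
    intro i j h V hV p hp q hq
    rw [Set.uIoc_comm]
    exact h V hV p hp q hq
  trans := by
    intro i j l h1 h2 V hV p hp q hq
    have a := h1 V hV p hp q hq
    have b := h2 V hV p hp q hq
    simp only [Set.mem_uIoc] at a b ⊢
    grind

/-- The Kreweras complement `K(π)`: the largest partition `σ` of `{1̅, …, n̅}` such that
`π ∪ σ` is a non-crossing partition of `1 < 1̅ < 2 < 2̅ < ⋯ < n < n̅`. -/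
def kreweras {n : ℕ} (π : Finpartition (Finset.univ : Finset (Fin n))) :
    Finpartition (Finset.univ : Finset (Fin n)) :=
  Finpartition.ofSetoid ⟨KrewerasRel π, krewerasRel_equivalence π⟩

/-- The subword `w|_V` of `w` at the positions in `V`, in increasing order. -/
def subword {α : Type*} (w : List α) (V : Finset (Fin w.length)) : List α :=
  (V.sort (· ≤ ·)).map w.get

theorem subword_length_lt {α : Type*} (w : List α)
    (π : Finpartition (Finset.univ : Finset (Fin w.length))) (hπ : 1 < π.parts.card)
    (V : Finset (Fin w.length)) (hV : V ∈ π.parts) : (subword w V).length < w.length := by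
  obtain ⟨W, hW, hne⟩ := Finset.exists_mem_ne hπ V
  obtain ⟨x, hx⟩ := π.nonempty_of_mem_parts hW
  have hxV : x ∉ V := fun h =>
    Finset.disjoint_left.1 (π.disjoint hW hV hne) hx h
  have := Finset.card_lt_univ_of_notMem hxV
  simpa [subword] using this

/-! ### Non-commutative power series and boxed convolution -/

/-- Formal power series without constant term in `s` non-commuting variables over `R`: families
of coefficients indexed by words in `{1, …, s}` whose coefficient at the empty word is `0`. -/
def NCSeries (R : Type*) [CommRing R] (s : ℕ) : Type _ :=
  {f : List (Fin s) → R // f [] = 0}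

/-- The coefficient `X_w(f)`. -/
def NCSeries.coeff {R : Type*} [CommRing R] {s : ℕ} (w : List (Fin s)) (f : NCSeries R s) : R :=
  f.1 w

/-- `X_{w,π}(f)`, the product of `X_{w|_V}(f)` over the blocks `V` of `π`. -/
def NCSeries.coeffPart {R : Type*} [CommRing R] {s : ℕ} (w : List (Fin s))
    (π : Finpartition (Finset.univ : Finset (Fin w.length))) (f : NCSeries R s) : R :=
  ∏ V ∈ π.parts, f.coeff (subword w V)

/-- The boxed convolution `⊠`, written as multiplication of series. -/
instance NCSeries.instMul {R : Type*} [CommRing R] {s : ℕ} : Mul (NCSeries R s) where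
  mul f g := ⟨fun w => if w = [] then 0 else
    ∑ π ∈ NC w.length, f.coeffPart w π * g.coeffPart w (kreweras π), by simp⟩

/-- The series `z_1 + ⋯ + z_s`. -/
instance NCSeries.instOne {R : Type*} [CommRing R] {s : ℕ} : One (NCSeries R s) where
  one := ⟨fun w => if w.length = 1 then 1 else 0, by simp⟩

theorem NCSeries.coeff_mul {R : Type*} [CommRing R] {s : ℕ} (f g : NCSeries R s)
    {w : List (Fin s)} (hw : w ≠ []) : (f * g).coeff w =
      ∑ π ∈ NC w.length, f.coeffPart w π * g.coeffPart w (kreweras π) := by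
  change (if w = [] then 0 else _) = _
  rw [if_neg hw]

theorem finpartition_fin_one (π : Finpartition (Finset.univ : Finset (Fin 1))) :
    π.parts = {Finset.univ} := by
  have key : ∀ V ∈ π.parts, V = Finset.univ := by
    intro V hV
    obtain ⟨x, hx⟩ := π.nonempty_of_mem_parts hV
    ext y
    rw [Subsingleton.elim y x]
    exact ⟨fun _ => Finset.mem_univ _, fun _ => hx⟩
  obtain ⟨V, hV, _⟩ := π.exists_mem (Finset.mem_univ 0)
  exact Finset.eq_singleton_iff_nonempty_unique_mem.2 ⟨⟨V, hV⟩, key⟩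

theorem NCSeries.coeffPart_singleton {R : Type*} [CommRing R] {s : ℕ} (i : Fin s)
    (π : Finpartition (Finset.univ : Finset (Fin [i].length))) (f : NCSeries R s) :
    f.coeffPart [i] π = f.coeff [i] := by
  have hp : π.parts = {Finset.univ} := finpartition_fin_one π
  have hs : subword [i] Finset.univ = [i] := by
    have h1 : (Finset.univ : Finset (Fin [i].length)) = {(0 : Fin 1)} := rfl
    rw [subword, h1]
    change List.map [i].get (Finset.sort ({(0 : Fin 1)} : Finset (Fin 1))) = _
    rw [Finset.sort_singleton]
    rfl
  rw [NCSeries.coeffPart, hp, Finset.prod_singleton, hs]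

theorem card_NC_one : (NC 1).card = 1 := by
  rw [Finset.card_eq_one]
  refine ⟨⊥, Finset.eq_singleton_iff_unique_mem.2 ⟨?_, fun π _ => ?_⟩⟩
  · simp only [NC, Finset.mem_filter, Finset.mem_univ, true_and]
    intro V _ W _ a b p q hab
    exact absurd (Subsingleton.elim a b) hab.ne
  · exact Finpartition.ext ((finpartition_fin_one π).trans (finpartition_fin_one ⊥).symm)

theorem NCSeries.coeff_mul_singleton {R : Type*} [CommRing R] {s : ℕ} (f g : NCSeries R s)
    (i : Fin s) : (f * g).coeff [i] = f.coeff [i] * g.coeff [i] := by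
  have hNC : (NC [i].length).card = 1 := card_NC_one
  rw [NCSeries.coeff_mul f g (by simp)]
  simp only [NCSeries.coeffPart_singleton, Finset.sum_const, hNC, one_smul]

/-- `𝔊^s(R)`: the series whose coefficients at `z_1, …, z_s` are units. -/
def groupG (R : Type*) [CommRing R] (s : ℕ) : Subsemigroup (NCSeries R s) where
  carrier := {f | ∀ i, IsUnit (f.coeff [i])}
  mul_mem' := by
    intro f g hf hg i
    rw [NCSeries.coeff_mul_singleton]
    exact (hf i).mul (hg i)

/-- `𝔊^s_+(R)`: the series whose coefficients at `z_1, …, z_s` are `1`. -/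
def groupGPlus (R : Type*) [CommRing R] (s : ℕ) : Subsemigroup (NCSeries R s) where
  carrier := {f | ∀ i, f.coeff [i] = 1}
  mul_mem' := by
    intro f g hf hg i
    rw [NCSeries.coeff_mul_singleton, hf i, hg i, one_mul]

/-- The set `H` of series is a group under `⊠` with neutral element `z_1 + ⋯ + z_s`. -/
def IsBoxedGroup {R : Type*} [CommRing R] {s : ℕ} (H : Subsemigroup (NCSeries R s)) : Prop :=
  (∀ f g h : H, (f * g) * h = f * (g * h)) ∧
  ∃ e : H, (e : NCSeries R s) = 1 ∧ (∀ f : H, e * f = f ∧ f * e = f) ∧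
    ∀ f : H, ∃ g : H, f * g = e ∧ g * f = e

/-! ### The projective limit of the Borel groups -/

/-- The Borel group `𝔹_n(k)` of invertible upper-triangular matrices. -/
def borelGroup (k : Type*) [Field k] (n : ℕ) : Subgroup (GL (Fin n) k) where
  carrier := {M | ∀ i j : Fin n, j < i → M i j = 0}
  one_mem' := by
    intro i j hij
    simp [hij.ne']
  mul_mem' := by
    intro M N hM hN i j hij
    have h1 : Matrix.BlockTriangular (M : Matrix (Fin n) (Fin n) k) id := fun i j h => hM i j h
    have h2 : Matrix.BlockTriangular (N : Matrix (Fin n) (Fin n) k) id := fun i j h => hN i j h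
    exact h1.mul h2 hij
  inv_mem' := by
    intro M hM i j hij
    have h1 : Matrix.BlockTriangular (M : Matrix (Fin n) (Fin n) k) id := fun i j h => hM i j h
    have : Invertible (M : Matrix (Fin n) (Fin n) k) := M.invertible
    have h2 := Matrix.blockTriangular_inv_of_blockTriangular h1
    rw [← Matrix.coe_units_inv] at h2
    exact h2 hij

theorem borelGroup_corner_mul {k : Type*} [Field k] {n : ℕ} (M N : borelGroup k (n + 1))
    (i j : Fin n) : (M * N).1 i.castSucc j.castSucc =
      ∑ l : Fin n, M.1 i.castSucc l.castSucc * N.1 l.castSucc j.castSucc := by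
  have h : N.1 (Fin.last n) j.castSucc = 0 := N.2 _ _ (Fin.castSucc_lt_last j)
  change ((M.1 : Matrix (Fin (n + 1)) (Fin (n + 1)) k) * (N.1 : Matrix (Fin (n + 1)) (Fin (n + 1)) k))
    i.castSucc j.castSucc = _
  rw [Matrix.mul_apply, Fin.sum_univ_castSucc]
  rw [h, mul_zero, add_zero]

/-- The projective limit `𝔹_∞(k) = lim 𝔹_n(k)` along the homomorphisms
`𝔹_{n+1}(k) → 𝔹_n(k)` which delete the last row and the last column. -/
def borelLimit (k : Type*) [Field k] : Subgroup (∀ n : ℕ, borelGroup k n) where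
  carrier := {M | ∀ (n : ℕ) (i j : Fin n), (M (n + 1)).1 i.castSucc j.castSucc = (M n).1 i j}
  one_mem' := by
    intro n i j
    simp [Matrix.one_apply]
  mul_mem' := by
    intro M N hM hN n i j
    have h1 := borelGroup_corner_mul (M (n + 1)) (N (n + 1)) i j
    simp only [hM n, hN n] at h1
    rw [Pi.mul_apply, h1]
    change _ = (((M n).1 : Matrix (Fin n) (Fin n) k) * ((N n).1 : Matrix (Fin n) (Fin n) k)) i j
    rw [Matrix.mul_apply]
  inv_mem' := by
    intro M hM n i j
    let P : Matrix (Fin n) (Fin n) k := fun i j => ((M (n + 1))⁻¹).1 i.castSucc j.castSucc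
    have hP : P * ((M n).1 : Matrix (Fin n) (Fin n) k) = 1 := by
      ext a b
      have h1 := borelGroup_corner_mul ((M (n + 1))⁻¹) (M (n + 1)) a b
      simp only [hM n] at h1
      rw [Matrix.mul_apply]
      rw [inv_mul_cancel] at h1
      rw [← h1]
      simp [Matrix.one_apply]
    have hQ : P = (((M n)⁻¹).1 : Matrix (Fin n) (Fin n) k) := by
      have : (((M n).1 : Matrix (Fin n) (Fin n) k)) * ((((M n)⁻¹).1 : Matrix (Fin n) (Fin n) k)) = 1 := by
        have h3 : (M n).1 * ((M n)⁻¹).1 = 1 := by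
          rw [← Subgroup.coe_mul, mul_inv_cancel]; rfl
        rw [← Units.val_mul, h3]; rfl
      calc P = P * 1 := (mul_one P).symm
        _ = _ := by rw [← this, ← mul_assoc, hP, one_mul]
    exact congrFun (congrFun hQ i) j

/-! ### Representations of the groups of series -/

/-- Right translation of functions: `(R_g h)(x) = h(x ⊠ g)`. -/
def rightTranslate {k : Type*} [Field k] {s : ℕ} (H : Subsemigroup (NCSeries k s)) (g : H) :
    (H → k) →ₗ[k] (H → k) where
  toFun h := fun x => h (x * g)
  map_add' _ _ := rfl
  map_smul' _ _ := rfl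

/-- The smallest subrepresentation of the regular representation (on functions `H → k`, by
right translations) that contains the coordinate functions `X_w` of degree `1 ≤ |w| ≤ n`. -/
def coordinateRep {k : Type*} [Field k] {s : ℕ} (H : Subsemigroup (NCSeries k s)) (n : ℕ) :
    Submodule k (H → k) :=
  sInf {V | (∀ w : List (Fin s), 1 ≤ w.length → w.length ≤ n →
      (fun f : H => (f : NCSeries k s).coeff w) ∈ V) ∧
    ∀ g : H, ∀ h ∈ V, rightTranslate H g h ∈ V}

/-- `ρ` is the minimal representation in triangular form: there is a basis `b_0, b_1, …` of the
smallest subrepresentation of the regular representation containing all coordinate functions,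
adapted to its filtration by degree, such that for each `g` the matrix of right translation by
`g` in this basis is the upper-triangular matrix `ρ(g)`. -/
def IsMinimalRep {k : Type*} [Field k] {s : ℕ} (H : Subsemigroup (NCSeries k s))
    (ρ : H → borelLimit k) : Prop :=
  ∃ b : ℕ → (H → k), LinearIndependent k b ∧
    Submodule.span k (Set.range b) = ⨆ n, coordinateRep H n ∧
    (∀ n, ∃ N, Submodule.span k (b '' Set.Iio N) = coordinateRep H n) ∧
    ∀ (g : H) (N : ℕ) (j : Fin N),
      rightTranslate H g (b j) = ∑ i : Fin N, ((ρ g).1 N).1 i j • b i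

/-- `ρ` is a faithful representation: an injective homomorphism into `𝔹_∞(k)`. -/
def IsFaithfulRep {k : Type*} [Field k] {s : ℕ} (H : Subsemigroup (NCSeries k s))
    (ρ : H → borelLimit k) : Prop :=
  (∀ f g : H, ρ (f * g) = ρ f * ρ g) ∧ Function.Injective ρ

/-! ### Non-commutative probability spaces -/

/-- The free cumulant `κ_n(a_1, …, a_n)` of `(A, φ)`, defined recursively by the moment-cumulant
formula `φ(a_1 ⋯ a_n) = ∑_{π ∈ NC(n)} ∏_{V ∈ π} κ_{|V|}((a_i)_{i ∈ V})`, in which `κ_n` is the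
term of the one-block partition. -/
def freeCumulant {k A : Type*} [Field k] [Ring A] [Algebra k A] (φ : A →ₗ[k] k)
    (l : List A) : k :=
  φ l.prod - ∑ π : {π // π ∈ NC l.length ∧ 1 < π.parts.card},
    ∏ V : {V // V ∈ π.1.parts}, freeCumulant φ (subword l V.1)
termination_by l.length
decreasing_by exact subword_length_lt l π.1 π.2.2 V.1 V.2

/-- The subsets `M_i` of `A` are combinatorially free: their mixed free cumulants vanish. -/
def CombinatoriallyFree {k A ι : Type*} [Field k] [Ring A] [Algebra k A] (φ : A →ₗ[k] k)
    (M : ι → Set A) : Prop :=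
  ∀ l : List (ι × A), (∀ x ∈ l, x.2 ∈ M x.1) → (∃ x ∈ l, ∃ y ∈ l, x.1 ≠ y.1) →
    freeCumulant φ (l.map Prod.snd) = 0

/-- The distribution of the tuple `a`: the functional `z_w ↦ φ(a_w)` on `k⟨z_1, …, z_s⟩`. -/
def law {k A : Type*} [Field k] [Ring A] [Algebra k A] {s : ℕ} (φ : A →ₗ[k] k)
    (a : Fin s → A) : FreeAlgebra k (Fin s) →ₗ[k] k :=
  φ ∘ₗ (FreeAlgebra.lift k a).toLinearMap

/-- The `𝓡`-transform of a tuple: the series of its free cumulants. -/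
def rTransform {k A : Type*} [Field k] [Ring A] [Algebra k A] {s : ℕ} (φ : A →ₗ[k] k)
    (a : Fin s → A) : NCSeries k s :=
  ⟨fun w => if w = [] then 0 else freeCumulant φ (w.map a), by simp⟩

/-- The `𝓢`-transform of a tuple whose `𝓡`-transform lies in `H`. -/
def sTransform {k A : Type*} [Field k] [Ring A] [Algebra k A] {s : ℕ}
    {H : Subsemigroup (NCSeries k s)} (ρ : H → borelLimit k) (φ : A →ₗ[k] k)
    (a : Fin s → A) (ha : rTransform φ a ∈ H) : borelLimit k :=
  ρ ⟨rTransform φ a, ha⟩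

end

/-! The boxed convolution is turned into functional equations between non-commutative power series.
Let `dl i` and `dr i` strip a first or last letter `i`. The system `x_i = (dr i f)(y) z_i`, `y_i =
z_i (dl i g)(x)` has only one solution, because every right-hand side contains a factor `z_i` and is
therefore contracting in degree. The coefficients of `f ⊠ g` are those of `f(y) = g(x)`
(`exists_isBoxedSystem`). This is the generating-function form of two cuts of a non-crossing
partition: at the second element of the first block, or, if the first point is alone, at the last
element of the block that follows it. The Kreweras complement splits along both cuts
(`krE_insert_union_glue`, `krE_insert_union`).

Associativity follows from uniqueness: the composed solutions for `(f ⊠ g) ⊠ e` also solve the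
system for `f ⊠ (g ⊠ e)` (`IsBoxedSystem.assoc`). Inverses come from a recursion on the length of
words, whose leading factor is a product of linear coefficients.

For the convolution with the series all of whose coefficients are `1`, the system becomes the
moment-cumulant relation `M = 1 + κ(z_1 M, …, z_s M)` (`momentSeries_eq`), and here `M` determines
`κ`. For free families `a`, `b`, the joint moments read along `a_1 b_1 a_2 b_2 ⋯` satisfy the boxed
system evaluated at `z_i m`, where `m` is the moment series of the products. Hence `m = 1 + (f ⊠
g)(z_1 m, …, z_s m)`, so the cumulant series of the products is `f ⊠ g` (`rTransform_mul`).

For the representation, `R_g X_w` is a multiple of `X_w` plus products of at least two coordinate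
functions of the same total degree. Right translations are thus triangular on monomials, ordered by
their number of factors. The spaces `coordinateRep H n` therefore have finite dimension, and their
filtration refines to a full stable flag, which gives the triangular matrices
(`exists_triangular_basis`). Injectivity holds because evaluating `R_g X_w` at the neutral element
recovers `X_w(g)`. The statements on the `S`-transform then use only that the representation is an
injective homomorphism and that cumulants and moments determine each other. -/

/-- Formal power series in the non-commuting variables `z_a`, `a : α`, as functions of words. -/
def WordSeries (R α : Type*) := List α → R

/-! ### The Cauchy algebra of non-commutative power series and its degree filtration. -/

namespace WordSeries

@[ext] theorem ext {R α : Type*} {f g : WordSeries R α} (h : ∀ w, f w = g w) : f = g := funext h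

variable {R α : Type*} [CommRing R]

instance : AddCommGroup (WordSeries R α) := inferInstanceAs (AddCommGroup (List α → R))
instance : Module R (WordSeries R α) := inferInstanceAs (Module R (List α → R))

@[simp] theorem add_apply (f g : WordSeries R α) (w : List α) : (f + g) w = f w + g w := rfl
@[simp] theorem sub_apply (f g : WordSeries R α) (w : List α) : (f - g) w = f w - g w := rfl
@[simp] theorem zero_apply (w : List α) : (0 : WordSeries R α) w = 0 := rfl
@[simp] theorem smul_apply (r : R) (f : WordSeries R α) (w : List α) : (r • f) w = r * f w := rfl

theorem sum_apply {ι : Type*} (t : Finset ι) (f : ι → WordSeries R α) (w : List α) :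
    (∑ i ∈ t, f i) w = ∑ i ∈ t, f i w :=
  Finset.sum_apply w t f

/-- The left derivative, which strips the first letter `a`. -/
def dl (a : α) : WordSeries R α →ₗ[R] WordSeries R α where
  toFun f := fun w => f (a :: w)
  map_add' _ _ := rfl
  map_smul' _ _ := rfl

/-- The right derivative, which strips the last letter `a`. -/
def dr (a : α) : WordSeries R α →ₗ[R] WordSeries R α where
  toFun f := fun w => f (w ++ [a])
  map_add' _ _ := rfl
  map_smul' _ _ := rfl

@[simp] theorem dl_apply (a : α) (f : WordSeries R α) (w : List α) : dl a f w = f (a :: w) := rfl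
@[simp] theorem dr_apply (a : α) (f : WordSeries R α) (w : List α) : dr a f w = f (w ++ [a]) := rfl

theorem dl_dr (a b : α) (f : WordSeries R α) : dl a (dr b f) = dr b (dl a f) := rfl

/-- The Cauchy product, by recursion on the word. -/
def mulAux : List α → WordSeries R α → WordSeries R α → R
  | [], f, g => f [] * g []
  | a :: w, f, g => f [] * g (a :: w) + mulAux w (dl a f) g

instance : Mul (WordSeries R α) := ⟨fun f g w => mulAux w f g⟩
instance : One (WordSeries R α) := ⟨fun w => match w with | [] => 1 | _ :: _ => 0⟩

@[simp] theorem one_nil : (1 : WordSeries R α) [] = 1 := rfl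
@[simp] theorem one_cons (a : α) (w : List α) : (1 : WordSeries R α) (a :: w) = 0 := rfl
@[simp] theorem mul_nil (f g : WordSeries R α) : (f * g) [] = f [] * g [] := rfl
theorem mul_cons (f g : WordSeries R α) (a : α) (w : List α) :
    (f * g) (a :: w) = f [] * g (a :: w) + (dl a f * g) w := rfl

@[simp] theorem dl_one (a : α) : dl a (1 : WordSeries R α) = 0 := rfl
theorem dl_mul (a : α) (f g : WordSeries R α) : dl a (f * g) = f [] • dl a g + dl a f * g := rfl

theorem mul_apply (f g : WordSeries R α) (w : List α) :
    (f * g) w = ∑ p ∈ Finset.range (w.length + 1), f (w.take p) * g (w.drop p) := by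
  induction w generalizing f with
  | nil => simp
  | cons a w ih =>
    rw [mul_cons, ih, List.length_cons, Finset.sum_range_succ' _ (w.length + 1)]
    simp [add_comm]

theorem aux_add_mul (f f' g : WordSeries R α) : (f + f') * g = f * g + f' * g := by
  ext w
  simp [mul_apply, add_mul, Finset.sum_add_distrib]

theorem aux_mul_add (f g g' : WordSeries R α) : f * (g + g') = f * g + f * g' := by
  ext w
  simp [mul_apply, mul_add, Finset.sum_add_distrib]

theorem aux_smul_mul (r : R) (f g : WordSeries R α) : (r • f) * g = r • (f * g) := by
  ext w
  simp [mul_apply, Finset.mul_sum, mul_assoc]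

theorem aux_mul_smul (r : R) (f g : WordSeries R α) : f * (r • g) = r • (f * g) := by
  ext w
  simp [mul_apply, Finset.mul_sum, mul_left_comm]

theorem aux_zero_mul (f : WordSeries R α) : 0 * f = 0 := by
  ext w
  simp [mul_apply]

theorem aux_mul_assoc (f g h : WordSeries R α) : f * g * h = f * (g * h) := by
  ext w
  induction w generalizing f g with
  | nil => simp [mul_assoc]
  | cons a w ih =>
    rw [mul_cons, mul_cons, mul_cons, dl_mul, aux_add_mul, aux_smul_mul, add_apply, ih, smul_apply,
      mul_nil]
    ring

instance : Ring (WordSeries R α) :=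
  { (inferInstance : AddCommGroup (WordSeries R α)) with
    mul := (· * ·)
    one := 1
    mul_assoc := aux_mul_assoc
    left_distrib := aux_mul_add
    right_distrib := aux_add_mul
    zero_mul := aux_zero_mul
    mul_zero := fun f => by ext w; simp [mul_apply]
    one_mul := fun f => by
      ext w
      cases w with
      | nil => simp
      | cons a w => rw [mul_cons, dl_one, aux_zero_mul]; simp
    mul_one := fun f => by
      ext w
      induction w generalizing f with
      | nil => simp
      | cons a w ih => rw [mul_cons, ih]; simp }

instance : Algebra R (WordSeries R α) :=
  Algebra.ofModule aux_smul_mul fun r f g => aux_mul_smul r f g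

/-- The submodule of series without terms of degree less than `n`. -/
def ord (R α : Type*) [CommRing R] (n : ℕ) : Submodule R (WordSeries R α) where
  carrier := {f | ∀ w : List α, w.length < n → f w = 0}
  add_mem' hf hg w hw := by simp [hf w hw, hg w hw]
  zero_mem' _ _ := rfl
  smul_mem' r f hf w hw := by simp [hf w hw]

theorem mem_ord_zero (f : WordSeries R α) : f ∈ ord R α 0 := fun w hw => absurd hw (by simp)

theorem mem_ord_one {f : WordSeries R α} : f ∈ ord R α 1 ↔ f [] = 0 :=
  ⟨fun h => h [] (by simp), fun h w hw => by
    rw [List.length_eq_zero_iff.1 (Nat.lt_one_iff.1 hw), h]⟩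

theorem mul_mem_ord {n m : ℕ} {f g : WordSeries R α} (hf : f ∈ ord R α n) (hg : g ∈ ord R α m) :
    f * g ∈ ord R α (n + m) := by
  intro w hw
  rw [mul_apply]
  refine Finset.sum_eq_zero fun p hp => ?_
  have hp' : p ≤ w.length := Nat.lt_succ_iff.1 (Finset.mem_range.1 hp)
  by_cases h : p < n
  · rw [hf _ (by simp [hp', h]), zero_mul]
  · rw [hg _ (by simp; omega), mul_zero]

theorem ord_mono {n m : ℕ} (h : n ≤ m) {f : WordSeries R α} (hf : f ∈ ord R α m) :
    f ∈ ord R α n := fun w hw => hf w (hw.trans_le h)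

theorem mul_mem_ord_left {n : ℕ} {f : WordSeries R α} (hf : f ∈ ord R α n) (g : WordSeries R α) :
    f * g ∈ ord R α n := mul_mem_ord hf (mem_ord_zero g)

theorem mul_mem_ord_right {n : ℕ} (f : WordSeries R α) {g : WordSeries R α} (hg : g ∈ ord R α n) :
    f * g ∈ ord R α n := by simpa using mul_mem_ord (mem_ord_zero f) hg

theorem eq_of_sub_mem_ord {f g : WordSeries R α} (h : ∀ n, f - g ∈ ord R α n) : f = g := by
  ext w
  exact sub_eq_zero.1 (h (w.length + 1) w (Nat.lt_succ_self _))

/-- The difference `d = u - v` satisfies `d = (1 - g) d`, and `1 - g` has no constant term. So the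
order of `d` can be raised indefinitely. This contraction argument, through `eq_of_sub_mem_ord`,
recurs in all uniqueness proofs below. -/
theorem mul_left_cancel_of_nil {g u v : WordSeries R α} (hg : g [] = 1) (h : g * u = g * v) :
    u = v := by
  have h0 : (1 - g) [] = 0 := by simp [hg]
  refine eq_of_sub_mem_ord fun n => ?_
  induction n with
  | zero => exact mem_ord_zero _
  | succ n ih =>
    have : u - v = (1 - g) * (u - v) := by
      rw [sub_mul, one_mul, mul_sub g, h, sub_self, sub_zero]
    rw [this, add_comm n]
    exact mul_mem_ord (mem_ord_one.2 h0) ih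

theorem mul_right_cancel_of_nil {g u v : WordSeries R α} (hg : g [] = 1) (h : u * g = v * g) :
    u = v := by
  have h0 : (1 - g) [] = 0 := by simp [hg]
  refine eq_of_sub_mem_ord fun n => ?_
  induction n with
  | zero => exact mem_ord_zero _
  | succ n ih =>
    have : u - v = (u - v) * (1 - g) := by
      rw [mul_sub, mul_one, sub_mul u, h, sub_self, sub_zero]
    rw [this]
    exact mul_mem_ord ih (mem_ord_one.2 h0)

/-! ### Composition of power series. -/

section Substitution

variable [Fintype α]

/-- The substitution `z_i ↦ y_i`, truncated after `n` steps. -/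
def substAux (y : α → WordSeries R α) : ℕ → WordSeries R α → WordSeries R α
  | 0, f => f [] • 1
  | n + 1, f => f [] • 1 + ∑ i, y i * substAux y n (dl i f)

/-- The series `f(y_1, …, y_s)`, for series `y_i` without constant term. -/
def subst (y : α → WordSeries R α) (f : WordSeries R α) : WordSeries R α :=
  fun w => substAux y w.length f w

variable {y : α → WordSeries R α}

/-- Every recursion step contributes a factor `y i` of positive order, so step `n + 1` affects only
degrees above `n`. This is why truncating at the length of the word loses nothing. -/
theorem substAux_sub_mem_ord (hy : ∀ i, y i [] = 0) (n : ℕ) (f : WordSeries R α) :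
    substAux y (n + 1) f - substAux y n f ∈ ord R α (n + 1) := by
  induction n generalizing f with
  | zero =>
    simp only [substAux, add_sub_cancel_left]
    exact Submodule.sum_mem _ fun i _ => mul_mem_ord_left (mem_ord_one.2 (hy i)) _
  | succ n ih =>
    rw [substAux, substAux, add_sub_add_left_eq_sub, ← Finset.sum_sub_distrib]
    refine Submodule.sum_mem _ fun i _ => ?_
    rw [← mul_sub, add_comm (n + 1)]
    exact mul_mem_ord (mem_ord_one.2 (hy i)) (ih _)

theorem substAux_apply_eq (hy : ∀ i, y i [] = 0) {n : ℕ} (f : WordSeries R α) {w : List α}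
    (hw : w.length ≤ n) : substAux y n f w = subst y f w := by
  induction n, hw using Nat.le_induction with
  | base => rfl
  | succ n hn ih =>
    rw [← ih]
    exact sub_eq_zero.1 (substAux_sub_mem_ord hy n f w (Nat.lt_succ_of_le hn))

/-- The recursion that characterizes substitution. Identities between substitutions are proved by
expanding both sides with it: their difference then reproduces itself behind the factors `y i` and
vanishes by `eq_zero_of_forall_eq_sum_mul`. -/
theorem subst_eq (hy : ∀ i, y i [] = 0) (f : WordSeries R α) :
    subst y f = f [] • 1 + ∑ i, y i * subst y (dl i f) := by
  ext w
  rw [← substAux_apply_eq hy f (Nat.le_succ w.length), substAux, add_apply, add_apply, sum_apply,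
    sum_apply]
  congr 1
  refine Finset.sum_congr rfl fun i _ => ?_
  rw [mul_apply, mul_apply]
  refine Finset.sum_congr rfl fun p _ => ?_
  rw [substAux_apply_eq hy _ (by simp)]

theorem subst_nil (hy : ∀ i, y i [] = 0) (f : WordSeries R α) : subst y f [] = f [] := by
  rw [subst_eq hy]
  simp [sum_apply, hy]

/-- Series that reproduce themselves behind factors without constant term vanish. -/
theorem eq_zero_of_forall_eq_sum_mul {ι : Type*} (hy : ∀ i, y i [] = 0) (d : ι → WordSeries R α)
    (h : ∀ j, ∃ j' : α → ι, d j = ∑ i, y i * d (j' i)) (j : ι) : d j = 0 := by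
  have key : ∀ n j, d j ∈ ord R α n := by
    intro n
    induction n with
    | zero => exact fun j => mem_ord_zero _
    | succ n ih =>
      intro j
      obtain ⟨j', hj'⟩ := h j
      rw [hj', add_comm n]
      exact Submodule.sum_mem _ fun i _ => mul_mem_ord (mem_ord_one.2 (hy i)) (ih _)
  exact eq_of_sub_mem_ord fun n => by simpa using key n j

theorem subst_add (hy : ∀ i, y i [] = 0) (f g : WordSeries R α) :
    subst y (f + g) = subst y f + subst y g := by
  refine sub_eq_zero.1 (eq_zero_of_forall_eq_sum_mul (ι := WordSeries R α × WordSeries R α) hy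
    (fun p => subst y (p.1 + p.2) - (subst y p.1 + subst y p.2))
    (fun p => ⟨fun i => (dl i p.1, dl i p.2), ?_⟩) (f, g))
  simp only
  rw [subst_eq hy (p.1 + p.2), subst_eq hy p.1, subst_eq hy p.2]
  simp only [map_add, add_apply, add_smul, mul_sub, mul_add, Finset.sum_sub_distrib,
    Finset.sum_add_distrib]
  abel

theorem subst_smul (hy : ∀ i, y i [] = 0) (r : R) (f : WordSeries R α) :
    subst y (r • f) = r • subst y f := by
  refine sub_eq_zero.1 (eq_zero_of_forall_eq_sum_mul hy
    (fun f => subst y (r • f) - r • subst y f) (fun f => ⟨fun i => dl i f, ?_⟩) f)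
  simp only
  rw [subst_eq hy (r • f), subst_eq hy f]
  simp only [map_smul, smul_apply, mul_sub, Finset.sum_sub_distrib, smul_add, mul_smul,
    add_sub_add_left_eq_sub, Finset.smul_sum, mul_smul_comm]

/-- Substitution as a linear map. -/
def substLin (hy : ∀ i, y i [] = 0) : WordSeries R α →ₗ[R] WordSeries R α where
  toFun := subst y
  map_add' := subst_add hy
  map_smul' := subst_smul hy

theorem subst_sum (hy : ∀ i, y i [] = 0) {ι : Type*} (t : Finset ι) (f : ι → WordSeries R α) :
    subst y (∑ i ∈ t, f i) = ∑ i ∈ t, subst y (f i) :=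
  map_sum (substLin hy) f t

theorem subst_zero (hy : ∀ i, y i [] = 0) : subst y (0 : WordSeries R α) = 0 :=
  map_zero (substLin hy)

theorem subst_sub (hy : ∀ i, y i [] = 0) (f g : WordSeries R α) :
    subst y (f - g) = subst y f - subst y g :=
  map_sub (substLin hy) f g

theorem subst_one (hy : ∀ i, y i [] = 0) : subst y (1 : WordSeries R α) = 1 := by
  rw [subst_eq hy]
  simp [subst_zero hy]

theorem subst_mul (hy : ∀ i, y i [] = 0) (f g : WordSeries R α) :
    subst y (f * g) = subst y f * subst y g := by
  refine sub_eq_zero.1 (eq_zero_of_forall_eq_sum_mul hy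
    (fun f => subst y (f * g) - subst y f * subst y g) (fun f => ⟨fun i => dl i f, ?_⟩) f)
  simp only
  -- By the Leibniz rule `dl_mul`, the constant term of `f` multiplies the sum of the `y i * subst y
  -- (dl i g)`, which is `subst y g` without its constant term.
  have hg : ∑ i, y i * subst y (dl i g) = subst y g - g [] • 1 := by rw [subst_eq hy g]; abel
  rw [subst_eq hy (f * g), subst_eq hy f]
  simp only [dl_mul, subst_add hy, subst_smul hy, mul_add, Finset.sum_add_distrib, mul_sub,
    Finset.sum_sub_distrib, mul_smul_comm, ← Finset.smul_sum, hg, add_mul, Finset.sum_mul,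
    smul_mul_assoc, one_mul, mul_assoc, mul_nil, smul_sub, mul_smul]
  abel

theorem subst_subst {x : α → WordSeries R α} (hx : ∀ i, x i [] = 0) (hy : ∀ i, y i [] = 0)
    (f : WordSeries R α) : subst y (subst x f) = subst (fun i => subst y (x i)) f := by
  have hz : ∀ i, subst y (x i) [] = 0 := fun i => by rw [subst_nil hy, hx]
  refine sub_eq_zero.1 (eq_zero_of_forall_eq_sum_mul hz
    (fun f => subst y (subst x f) - subst (fun i => subst y (x i)) f)
    (fun f => ⟨fun i => dl i f, ?_⟩) f)
  simp only
  rw [subst_eq hx f, subst_eq hz f]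
  simp only [subst_add hy, subst_smul hy, subst_one hy, subst_sum hy, subst_mul hy, mul_sub,
    Finset.sum_sub_distrib, add_sub_add_left_eq_sub]

/-- On each word this is only a shift of brackets: `g (x_i g)(x_j g) ⋯ = (g x_i)(g x_j) ⋯ g`. -/
theorem mul_subst_mul {x : α → WordSeries R α} (hx : ∀ i, x i [] = 0) (g f : WordSeries R α) :
    g * subst (fun i => x i * g) f = subst (fun i => g * x i) f * g := by
  have h1 : ∀ i, (x i * g) [] = 0 := fun i => by simp [hx]
  have h2 : ∀ i, (g * x i) [] = 0 := fun i => by simp [hx]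
  refine sub_eq_zero.1 (eq_zero_of_forall_eq_sum_mul h2
    (fun f => g * subst (fun i => x i * g) f - subst (fun i => g * x i) f * g)
    (fun f => ⟨fun i => dl i f, ?_⟩) f)
  simp only
  rw [subst_eq h1 f, subst_eq h2 f]
  simp only [mul_add, add_mul, mul_sub, Finset.sum_sub_distrib, Finset.mul_sum, Finset.sum_mul,
    mul_assoc, mul_smul_comm, smul_mul_assoc, one_mul, mul_one, add_sub_add_left_eq_sub]

/-- Telescoping of a difference of products shows that substitution does not lower the order to
which the substituted series agree. A further factor without constant term then makes the boxed
system a contraction. -/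
theorem subst_sub_subst_mem_ord {x : α → WordSeries R α} (hx : ∀ i, x i [] = 0)
    (hy : ∀ i, y i [] = 0) {n : ℕ} (h : ∀ i, x i - y i ∈ ord R α n) (f : WordSeries R α) :
    subst x f - subst y f ∈ ord R α n := by
  have key : ∀ m ≤ n, ∀ f : WordSeries R α, subst x f - subst y f ∈ ord R α m := by
    intro m
    induction m with
    | zero => exact fun _ f => mem_ord_zero _
    | succ m ih =>
      intro hm f
      have : subst x f - subst y f = ∑ i, ((x i - y i) * subst x (dl i f) +
          y i * (subst x (dl i f) - subst y (dl i f))) := by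
        rw [subst_eq hx f, subst_eq hy f, add_sub_add_left_eq_sub, ← Finset.sum_sub_distrib]
        exact Finset.sum_congr rfl fun i _ => by rw [sub_mul, mul_sub]; abel
      rw [this]
      refine Submodule.sum_mem _ fun i _ => Submodule.add_mem _
        (mul_mem_ord_left (ord_mono hm (h i)) _) ?_
      rw [add_comm m]
      exact mul_mem_ord (mem_ord_one.2 (hy i)) (ih (by omega) _)
  exact key n le_rfl f

end Substitution

/-! ### The variables, expansion at the first or last letter, and injective substitutions. -/

section Variables

/-- The variable `z_a`. -/
noncomputable def var (a : α) : WordSeries R α := open Classical in fun w => if w = [a] then 1 else 0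

theorem var_nil (a : α) : (var a : WordSeries R α) [] = 0 := by simp [var]

theorem dl_var_self (a : α) : dl a (var a : WordSeries R α) = 1 := by
  ext w
  cases w <;> simp [var]

theorem dl_var_of_ne {a b : α} (h : b ≠ a) : dl b (var a : WordSeries R α) = 0 := by
  ext w
  simp [var, h]

theorem var_mul_cons_self (a : α) (f : WordSeries R α) (w : List α) :
    (var a * f : WordSeries R α) (a :: w) = f w := by
  rw [mul_cons, var_nil, zero_mul, zero_add, dl_var_self, one_mul]

theorem var_mul_cons_of_ne {a b : α} (h : b ≠ a) (f : WordSeries R α) (w : List α) :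
    (var a * f : WordSeries R α) (b :: w) = 0 := by
  rw [mul_cons, var_nil, zero_mul, zero_add, dl_var_of_ne h, zero_mul, zero_apply]

theorem dl_var_mul_self (a : α) (f : WordSeries R α) : dl a (var a * f) = f :=
  ext fun w => var_mul_cons_self a f w

theorem dl_var_mul_of_ne {a b : α} (h : b ≠ a) (f : WordSeries R α) : dl b (var a * f) = 0 :=
  ext fun w => var_mul_cons_of_ne h f w

theorem mul_concat (f g : WordSeries R α) (w : List α) (b : α) :
    (f * g) (w ++ [b]) = f (w ++ [b]) * g [] + (f * dr b g) w := by
  induction w generalizing f with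
  | nil => simp [mul_cons, add_comm]
  | cons a w ih =>
    rw [List.cons_append, mul_cons, ih, mul_cons]
    simp only [dl_apply, dr_apply, List.cons_append]
    ring

theorem mul_var_nil (a : α) (f : WordSeries R α) : (f * var a : WordSeries R α) [] = 0 := by
  rw [mul_nil, var_nil, mul_zero]

theorem dr_var_self (a : α) : dr a (var a : WordSeries R α) = 1 := by
  ext w
  cases w <;> simp [var]

theorem dr_var_of_ne {a b : α} (h : b ≠ a) : dr b (var a : WordSeries R α) = 0 := by
  ext w
  cases w <;> simp [var, h]

theorem dr_mul_var_self (a : α) (f : WordSeries R α) : dr a (f * var a) = f := by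
  ext w
  rw [dr_apply, mul_concat, var_nil, mul_zero, zero_add, dr_var_self, mul_one]

theorem dr_mul_var_of_ne {a b : α} (h : b ≠ a) (f : WordSeries R α) : dr b (f * var a) = 0 := by
  ext w
  rw [dr_apply, mul_concat, var_nil, mul_zero, zero_add, dr_var_of_ne h, mul_zero]

variable [Fintype α]

theorem dl_sum_var_mul (f : α → WordSeries R α) (a : α) : dl a (∑ i, var i * f i) = f a := by
  classical
  rw [map_sum, Finset.sum_eq_single a, dl_var_mul_self]
  · exact fun b _ h => dl_var_mul_of_ne (Ne.symm h) _
  · simp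

theorem dr_sum_mul_var (f : α → WordSeries R α) (a : α) : dr a (∑ i, f i * var i) = f a := by
  classical
  rw [map_sum, Finset.sum_eq_single a, dr_mul_var_self]
  · exact fun b _ h => dr_mul_var_of_ne (Ne.symm h) _
  · simp

theorem eq_add_sum_var_mul (f : WordSeries R α) : f = f [] • 1 + ∑ i, var i * dl i f := by
  ext w
  cases w with
  | nil => simp [sum_apply, var_nil]
  | cons a w =>
    have := congrArg (fun g : WordSeries R α => g w) (dl_sum_var_mul (fun i => dl i f) a)
    simp only [dl_apply] at this
    simp [this]

theorem eq_add_sum_mul_var (f : WordSeries R α) : f = f [] • 1 + ∑ i, dr i f * var i := by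
  ext w
  induction w using List.reverseRecOn with
  | nil =>
    simp [sum_apply, var_nil]
  | append_singleton w a =>
    have := congrArg (fun g : WordSeries R α => g w) (dr_sum_mul_var (fun i => dr i f) a)
    simp only [dr_apply] at this
    rw [add_apply, this]
    cases w <;> simp

theorem subst_var_eq_self (f : WordSeries R α) : subst var f = f := by
  refine sub_eq_zero.1 (eq_zero_of_forall_eq_sum_mul var_nil
    (fun f : WordSeries R α => subst var f - f) (fun f => ⟨fun i => dl i f, ?_⟩) f)
  simp only
  conv_lhs => rw [subst_eq var_nil f, eq_add_sum_var_mul f]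
  simp only [mul_sub, Finset.sum_sub_distrib, dl_sum_var_mul, add_apply, smul_apply, one_nil,
    sum_apply, mul_nil, var_nil, zero_mul, Finset.sum_const_zero, add_zero, mul_one, map_add,
    map_smul, dl_one, smul_zero, zero_add]
  abel

variable {y : α → WordSeries R α}

theorem subst_var (hy : ∀ i, y i [] = 0) (a : α) : subst y (var a) = y a := by
  classical
  rw [subst_eq hy, var_nil, zero_smul, zero_add, Finset.sum_eq_single a, dl_var_self,
    subst_one hy, mul_one]
  · exact fun b _ h => by rw [dl_var_of_ne h, subst_zero hy, mul_zero]
  · simp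

theorem subst_eq' (hy : ∀ i, y i [] = 0) (f : WordSeries R α) :
    subst y f = f [] • 1 + ∑ i, subst y (dr i f) * y i := by
  conv_lhs => rw [eq_add_sum_mul_var f]
  simp only [subst_add hy, subst_smul hy, subst_one hy, subst_sum hy, subst_mul hy, subst_var hy]

/-- Substitutions `z_i ↦ z_i g`, with `g` of constant term `1`, are injective. -/
theorem subst_var_mul_injective {g : WordSeries R α} (hg : g [] = 1) :
    Function.Injective (subst fun i => (var i : WordSeries R α) * g) := by
  have h0 : ∀ i : α, ((var i : WordSeries R α) * g) [] = 0 := fun i => by simp [var_nil]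
  have key : ∀ (w : List α) (d : WordSeries R α), subst (fun i => var i * g) d = 0 → d w = 0 := by
    intro w
    induction w with
    | nil => exact fun d hd => by rw [← subst_nil h0 d, hd, zero_apply]
    | cons a w ih =>
      intro d hd
      -- If `d(z_i g) = 0`, stripping the letter `a` leaves `g · (dl a d)(z_i g) = 0`. Since `g` can
      -- be cancelled, the derivative satisfies the same equation.
      refine ih (dl a d) (mul_left_cancel_of_nil hg ?_)
      have := congrArg (dl a) hd
      rw [subst_eq h0] at this
      simpa only [mul_assoc, map_add, dl_sum_var_mul, map_smul, dl_one, smul_zero, zero_add,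
        map_zero, mul_zero] using this
  intro f f' h
  refine sub_eq_zero.1 (ext fun w => key w _ ?_)
  rw [subst_sub h0]
  exact sub_eq_zero.2 h

end Variables

end WordSeries

/-! ### The functional equations behind the boxed convolution. -/

namespace WordSeries

variable {R α : Type*} [CommRing R] [Fintype α]

/-- The system of equations that determines the boxed convolution `f(y) = g(x)` of `f` and `g`,
evaluated at the series `t`. -/
structure IsBoxedSystem (f g : WordSeries R α) (t x y : α → WordSeries R α) : Prop where
  left : ∀ i, x i = subst y (dr i f) * t i
  right : ∀ i, y i = t i * subst x (dl i g)

namespace IsBoxedSystem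

variable {f g : WordSeries R α} {t x y : α → WordSeries R α}

theorem left_nil (h : IsBoxedSystem f g t x y) (ht : ∀ i, t i [] = 0) (i : α) : x i [] = 0 := by
  rw [h.left, mul_nil, ht, mul_zero]

theorem right_nil (h : IsBoxedSystem f g t x y) (ht : ∀ i, t i [] = 0) (i : α) : y i [] = 0 := by
  rw [h.right, mul_nil, ht, zero_mul]

/-- If two solutions agree up to order `n`, so do their images under substitution, and the factor `t
i` without constant term raises the agreement to order `n + 1`. -/
theorem unique {x' y' : α → WordSeries R α} (h : IsBoxedSystem f g t x y)
    (h' : IsBoxedSystem f g t x' y') (ht : ∀ i, t i [] = 0) : x = x' ∧ y = y' := by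
  have key : ∀ n, (∀ i, x i - x' i ∈ ord R α n) ∧ ∀ i, y i - y' i ∈ ord R α n := by
    intro n
    induction n with
    | zero => exact ⟨fun i => mem_ord_zero _, fun i => mem_ord_zero _⟩
    | succ n ih =>
      constructor
      · intro i
        rw [h.left, h'.left, ← sub_mul]
        exact mul_mem_ord (subst_sub_subst_mem_ord (h.right_nil ht) (h'.right_nil ht) ih.2 _)
          (mem_ord_one.2 (ht i))
      · intro i
        rw [h.right, h'.right, ← mul_sub, add_comm n]
        exact mul_mem_ord (mem_ord_one.2 (ht i))
          (subst_sub_subst_mem_ord (h.left_nil ht) (h'.left_nil ht) ih.1 _)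
  exact ⟨funext fun i => eq_of_sub_mem_ord fun n => (key n).1 i,
    funext fun i => eq_of_sub_mem_ord fun n => (key n).2 i⟩

/-- Substitution is multiplicative and compatible with composition, so the generic solution, with
`t` the variables, specializes to every `t`. Together with `unique` this computes all solutions from
the generic one. -/
theorem substitute (h : IsBoxedSystem f g var x y) (ht : ∀ i, t i [] = 0) :
    IsBoxedSystem f g t (fun i => subst t (x i)) fun i => subst t (y i) where
  left i := by
    rw [h.left i, subst_mul ht, subst_var ht, subst_subst (h.right_nil var_nil) ht]
  right i := by
    rw [h.right i, subst_mul ht, subst_var ht, subst_subst (h.left_nil var_nil) ht]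

/-- Expanding `f(y)` at the last factor and `g(x)` at the first turns both into the sum of `(dr i
f)(y) · t i · (dl i g)(x)`. -/
theorem subst_eq_subst (h : IsBoxedSystem f g t x y) (ht : ∀ i, t i [] = 0) (hf : f [] = 0)
    (hg : g [] = 0) : subst y f = subst x g := by
  rw [subst_eq' (h.right_nil ht), subst_eq (h.left_nil ht), hf, hg]
  congr 1
  refine Finset.sum_congr rfl fun i _ => ?_
  conv_lhs => rw [h.right i, ← mul_assoc, ← h.left i]

/-- The right derivative is read off from the form `g(x)`, whose last factor `x i` ends in the
variable. The left derivative below uses `f(y)`, whose first factor begins with it. These are the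
derivatives of `f ⊠ g` that enter the systems for threefold products. -/
theorem dr_subst (h : IsBoxedSystem f g var x y) (hf : f [] = 0) (hg : g [] = 0) (i : α) :
    dr i (subst y f) = subst x (dr i g) * subst y (dr i f) := by
  rw [h.subst_eq_subst var_nil hf hg, subst_eq' (h.left_nil var_nil), hg, zero_smul, zero_add]
  have : ∀ j, subst x (dr j g) * x j = (subst x (dr j g) * subst y (dr j f)) * var j := by
    intro j
    conv_lhs => rw [h.left j, ← mul_assoc]
  simp only [this, dr_sum_mul_var]

theorem dl_subst (h : IsBoxedSystem f g var x y) (hf : f [] = 0) (i : α) :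
    dl i (subst y f) = subst x (dl i g) * subst y (dl i f) := by
  rw [subst_eq (h.right_nil var_nil), hf, zero_smul, zero_add]
  have : ∀ j, y j * subst y (dl j f) = var j * (subst x (dl j g) * subst y (dl j f)) := by
    intro j
    conv_lhs => rw [h.right j, mul_assoc]
  simp only [this, dl_sum_var_mul]

/-- Associativity of the boxed convolution, in terms of the defining systems. -/
theorem assoc {e : WordSeries R α} {X Y u v : α → WordSeries R α} (hf : f [] = 0) (hg : g [] = 0)
    (h : IsBoxedSystem f g var x y) (h1 : IsBoxedSystem (subst y f) e var X Y)
    (h2 : IsBoxedSystem g e var u v) :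
    IsBoxedSystem f (subst v g) var (fun i => subst (fun j => subst Y (y j)) (dr i f) * var i)
      fun i => subst Y (y i) := by
  have hY := h1.right_nil var_nil
  have hx := h.left_nil var_nil
  have hy := h.right_nil var_nil
  set X' : α → WordSeries R α := fun i => subst (fun j => subst Y (y j)) (dr i f) * var i
  have hX : ∀ i, X' i [] = 0 := fun i => mul_var_nil i _
  -- Regrouping the systems of `(f, g)` and `(f ⊠ g, e)` exhibits a system for `(g, e)` evaluated at
  -- `X'`. By uniqueness its solution is the generic solution `(u, v)` at `X'`.
  have h3 : IsBoxedSystem g e X' X fun i => subst Y (x i) := by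
    constructor
    · intro i
      rw [h1.left i, h.dr_subst hf hg, subst_mul hY, subst_subst hx hY, subst_subst hy hY, mul_assoc]
    · intro i
      rw [h.left i, subst_mul hY, subst_var hY, subst_subst hy hY, h1.right i, ← mul_assoc]
  obtain ⟨h4, h5⟩ := h3.unique (h2.substitute hX) hX
  refine ⟨fun i => rfl, fun i => ?_⟩
  rw [h2.dl_subst hg, subst_mul hX, subst_subst (h2.left_nil var_nil) hX,
    subst_subst (h2.right_nil var_nil) hX, ← h4, ← h5]
  conv_lhs => rw [h.right i, subst_mul hY, subst_var hY, subst_subst hx hY, h1.right i, mul_assoc]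

end IsBoxedSystem

variable {f g m : WordSeries R α}

/-- The series `m` commutes with `m - 1 = f(z_i m)`, while carrying `m` through the substitution
changes `z_i m` into `m z_i`. Cancelling `m` on the right gives the mirrored equation. -/
theorem eq_one_add_subst_mul_var (h : m = 1 + subst (fun i => var i * m) f) (hf : f [] = 0) :
    m = 1 + subst (fun i => m * var i) f := by
  have h0 : ∀ i, (var i * m : WordSeries R α) [] = 0 := fun i => by simp [var_nil]
  have hm : m [] = 1 := by rw [h, add_apply, subst_nil h0, hf, one_nil, add_zero]
  refine mul_right_cancel_of_nil hm ?_
  rw [add_mul, one_mul, ← mul_subst_mul var_nil, ← sub_eq_iff_eq_add']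
  conv_lhs => rhs; rw [← mul_one m]
  rw [← mul_sub]
  congr 1
  exact sub_eq_iff_eq_add'.2 h

/-- The moments of products of free families, in terms of the boxed convolution. -/
theorem eq_one_add_subst_boxed {x y A B : α → WordSeries R α}
    (h : IsBoxedSystem f g var x y) (hm : m = 1 + subst B f)
    (hB : ∀ i, B i = var i * (subst A (dl i g) * m)) (hA : ∀ i, A i = m * subst B (dr i f) * var i) :
    m = 1 + subst (fun i => var i * m) (subst y f) := by
  have h0 : ∀ i, ((fun i => var i * m : α → WordSeries R α) i) [] = 0 := fun i => by simp [var_nil]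
  -- Here `A i` has a left factor `m`. Shifting brackets turns `(dl i g)(A) · m` into `m` times a
  -- substitution of series ending in `m`, so `B` solves the right half of the system at `t i = z_i
  -- m`.
  have h1 : IsBoxedSystem f g (fun i => var i * m) (fun i => subst B (dr i f) * var i * m) B := by
    constructor
    · intro i
      rw [mul_assoc]
    · intro i
      have hA' : A = fun i => m * (subst B (dr i f) * var i) := funext fun i => by
        rw [hA i, mul_assoc]
      conv_lhs => rw [hB i, hA', ← mul_subst_mul (fun i => mul_var_nil i _), ← mul_assoc]
  obtain ⟨-, h2⟩ := h1.unique (h.substitute h0) h0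
  rw [subst_subst (h.right_nil var_nil) h0, ← h2]
  exact hm

end WordSeries

/-! ### Non-crossing partitions as equivalence relations -/

section Relations

variable {α : Type*} [LinearOrder α]

/-- The finite set of pairs `E` is an equivalence relation on `S`. -/
structure IsEqv (S : Finset α) (E : Finset (α × α)) : Prop where
  mem : ∀ {x y}, (x, y) ∈ E → x ∈ S ∧ y ∈ S
  refl : ∀ {x}, x ∈ S → (x, x) ∈ E
  symm : ∀ {x y}, (x, y) ∈ E → (y, x) ∈ E
  trans : ∀ {x y z}, (x, y) ∈ E → (y, z) ∈ E → (x, z) ∈ E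

/-- The finite set of pairs `E` is an equivalence relation on `S` with non-crossing classes. -/
structure IsNCE (S : Finset α) (E : Finset (α × α)) : Prop extends IsEqv S E where
  nc : ∀ {i j p q}, i < j → j < p → p < q → (i, p) ∈ E → (j, q) ∈ E → (i, j) ∈ E

open Classical in
/-- The non-crossing equivalence relations on `S`. -/
noncomputable def NCE (S : Finset α) : Finset (Finset (α × α)) :=
  (S ×ˢ S).powerset.filter (IsNCE S)

theorem mem_NCE {S : Finset α} {E : Finset (α × α)} : E ∈ NCE S ↔ IsNCE S E := by
  simp only [NCE, Finset.mem_filter, Finset.mem_powerset, and_iff_right_iff_imp]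
  intro h p hp
  exact Finset.mem_product.2 (h.mem hp)

/-- The Kreweras complement of the relation `E` on `S`. -/
noncomputable def krE (S : Finset α) (E : Finset (α × α)) : Finset (α × α) :=
  open Classical in
  (S ×ˢ S).filter fun p => ∀ q ∈ E, (q.1 ∈ Set.uIoc p.1 p.2 ↔ q.2 ∈ Set.uIoc p.1 p.2)

theorem mem_krE {S : Finset α} {E : Finset (α × α)} {x y : α} : (x, y) ∈ krE S E ↔
    x ∈ S ∧ y ∈ S ∧ ∀ p q, (p, q) ∈ E → (p ∈ Set.uIoc x y ↔ q ∈ Set.uIoc x y) := by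
  simp [krE, and_assoc]

theorem isEqv_krE (S : Finset α) (E : Finset (α × α)) : IsEqv S (krE S E) where
  mem h := ⟨(mem_krE.1 h).1, (mem_krE.1 h).2.1⟩
  refl h := mem_krE.2 ⟨h, h, by simp⟩
  symm h := by
    rw [mem_krE] at h ⊢
    rw [Set.uIoc_comm]
    exact ⟨h.2.1, h.1, h.2.2⟩
  trans {x y z} h1 h2 := by
    rw [mem_krE] at h1 h2 ⊢
    refine ⟨h1.1, h2.2.1, fun p q hpq => ?_⟩
    have a := h1.2.2 p q hpq
    have b := h2.2.2 p q hpq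
    simp only [Set.mem_uIoc] at a b ⊢
    grind

/-- Adjoin the point `m` to the class of `v`. -/
def glue (m v : α) (E : Finset (α × α)) : Finset (α × α) :=
  insert (m, m) (E ∪ (E.filter (·.1 = v)).image (fun p => (m, p.2)) ∪
    (E.filter (·.2 = v)).image (fun p => (p.1, m)))

theorem mem_glue {m v x y : α} {E : Finset (α × α)} : (x, y) ∈ glue m v E ↔
    (x = m ∧ y = m) ∨ (x, y) ∈ E ∨ (x = m ∧ (v, y) ∈ E) ∨ (y = m ∧ (x, v) ∈ E) := by
  simp only [glue, Finset.mem_insert, Prod.mk.injEq, Finset.mem_union, Finset.mem_image,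
    Finset.mem_filter, Prod.exists]
  grind

/-- The restriction of a relation. -/
def restrictRel (E : Finset (α × α)) (T : Finset α) : Finset (α × α) :=
  E.filter fun p => p.1 ∈ T ∧ p.2 ∈ T

theorem mem_restrictRel {E : Finset (α × α)} {T : Finset α} {x y : α} :
    (x, y) ∈ restrictRel E T ↔ (x, y) ∈ E ∧ x ∈ T ∧ y ∈ T := by
  simp [restrictRel]

theorem IsNCE.restrict {S T : Finset α} {E : Finset (α × α)} (h : IsNCE S E) (hT : T ⊆ S) :
    IsNCE T (restrictRel E T) where
  mem h1 := (mem_restrictRel.1 h1).2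
  refl h1 := mem_restrictRel.2 ⟨h.refl (hT h1), h1, h1⟩
  symm h1 := by
    rw [mem_restrictRel] at h1 ⊢
    exact ⟨h.symm h1.1, h1.2.2, h1.2.1⟩
  trans h1 h2 := by
    rw [mem_restrictRel] at h1 h2 ⊢
    exact ⟨h.trans h1.1 h2.1, h1.2.1, h2.2.2⟩
  nc h1 h2 h3 h4 h5 := by
    rw [mem_restrictRel] at h4 h5 ⊢
    exact ⟨h.nc h1 h2 h3 h4.1 h5.1, h4.2.1, h5.2.1⟩

variable {S : Finset α} {m v b : α} {E Q Q' : Finset (α × α)}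

theorem IsEqv.union {S T : Finset α} {Q Q' : Finset (α × α)} (h : IsEqv S Q) (h' : IsEqv T Q')
    (hd : Disjoint S T) : IsEqv (S ∪ T) (Q ∪ Q') := by
  rw [Finset.disjoint_left] at hd
  constructor
  · intro x y
    simp only [Finset.mem_union]
    rintro (h1 | h1)
    · exact ⟨Or.inl (h.mem h1).1, Or.inl (h.mem h1).2⟩
    · exact ⟨Or.inr (h'.mem h1).1, Or.inr (h'.mem h1).2⟩
  · intro x
    simp only [Finset.mem_union]
    exact Or.imp h.refl h'.refl
  · intro x y
    simp only [Finset.mem_union]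
    exact Or.imp h.symm h'.symm
  · intro x y z
    simp only [Finset.mem_union]
    rintro (h1 | h1) (h2 | h2)
    · exact Or.inl (h.trans h1 h2)
    · exact absurd (h'.mem h2).1 (hd (h.mem h1).2)
    · exact absurd (h'.mem h1).2 (hd (h.mem h2).1)
    · exact Or.inr (h'.trans h1 h2)

omit [LinearOrder α] in
theorem isEqv_singleton (m : α) : IsEqv {m} {(m, m)} := by
  constructor <;> simp +contextual

theorem isEqv_insert {S : Finset α} (h : IsEqv S Q) (hm : m ∉ S) :
    IsEqv (insert m S) (insert (m, m) Q) := by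
  have := (isEqv_singleton m).union h (by simpa using hm)
  rwa [← Finset.insert_eq, ← Finset.insert_eq] at this

theorem isEqv_glue {S : Finset α} (h : IsEqv S Q) (hm : m ∉ S) (hv : v ∈ S) :
    IsEqv (insert m S) (glue m v Q) := by
  have h1 := @h.mem
  have h2 := @h.refl
  have h3 := @h.symm
  have h4 := @h.trans
  constructor
  · intro x y
    simp only [mem_glue, Finset.mem_insert]
    grind
  · intro x
    simp only [mem_glue, Finset.mem_insert]
    grind
  · intro x y
    simp only [mem_glue]
    grind
  · intro x y z
    simp only [mem_glue]
    grind

theorem IsEqv.erase (h : IsEqv S E) (hb : ∀ {x}, (x, b) ∈ E → x = b) :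
    IsEqv (S.erase b) (E.erase (b, b)) := by
  have h1 := @h.mem
  have h2 := @h.refl
  have h3 := @h.symm
  have h4 := @h.trans
  constructor
  · intro x y
    simp only [Finset.mem_erase, ne_eq, Prod.mk.injEq]
    grind
  · intro x
    simp only [Finset.mem_erase, ne_eq, Prod.mk.injEq]
    grind
  · intro x y
    simp only [Finset.mem_erase, ne_eq, Prod.mk.injEq]
    grind
  · intro x y z
    simp only [Finset.mem_erase, ne_eq, Prod.mk.injEq]
    grind

/-- By symmetry only ordered pairs need comparison, and for these the interval `Set.uIoc` in the
complement is an `Ioc`. -/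
theorem IsEqv.eq_of_le (h : IsEqv S E) (h' : IsEqv S Q)
    (hle : ∀ x y, x ≤ y → ((x, y) ∈ E ↔ (x, y) ∈ Q)) : E = Q := by
  ext ⟨x, y⟩
  rcases le_total x y with hxy | hxy
  · exact hle x y hxy
  · exact ⟨fun h1 => h'.symm ((hle y x hxy).1 (h.symm h1)),
      fun h1 => h.symm ((hle y x hxy).2 (h'.symm h1))⟩

theorem isNCE_insert (hm : ∀ x ∈ S, m < x) :
    IsNCE S Q → IsNCE (insert m S) (insert (m, m) Q) := by
  intro h
  have hmS : m ∉ S := fun h => lt_irrefl _ (hm m h)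
  refine { isEqv_insert h.toIsEqv hmS with nc := ?_ }
  intro i j p q h1 h2 h3
  simp only [Finset.mem_insert, Prod.mk.injEq]
  rintro (⟨rfl, rfl⟩ | h4) (⟨rfl, rfl⟩ | h5)
  · simp
  · exact absurd (h1.trans h2) (lt_irrefl _)
  · exact absurd (h2.trans h3) (lt_irrefl _)
  · exact Or.inr (h.nc h1 h2 h3 h4 h5)

/-- The point `v` is the next element after `m` in the class of `m`. -/
def IsNext (E : Finset (α × α)) (m v : α) : Prop :=
  m < v ∧ (m, v) ∈ E ∧ ∀ x, (m, x) ∈ E → x ≤ m ∨ v ≤ x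

theorem isNCE_union_glue (hm : m ∈ S) (hmin : ∀ x ∈ S, m ≤ x) (hv : v ∈ S.erase m)
    (hQ : IsNCE ((S.filter (· < v)).erase m) Q) (hQ' : IsNCE (S.filter (v ≤ ·)) Q') :
    IsNCE S (Q ∪ glue m v Q') := by
  have hv' := Finset.mem_erase.1 hv
  have hmv : m < v := lt_of_le_of_ne (hmin v hv'.2) hv'.1.symm
  have h1 := isEqv_glue hQ'.toIsEqv (m := m) (v := v) (by simp [hmv]) (by simp [hv'.2])
  have h2 := hQ.toIsEqv.union h1 (by
    rw [Finset.disjoint_left]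
    intro x
    simp only [Finset.mem_erase, Finset.mem_filter, Finset.mem_insert, not_or, not_and, not_le]
    tauto)
  have hS : (S.filter (· < v)).erase m ∪ insert m (S.filter (v ≤ ·)) = S := by
    ext x
    simp only [Finset.mem_union, Finset.mem_erase, Finset.mem_filter, Finset.mem_insert]
    have := le_or_gt v x
    by_cases h : x = m
    · simp [h, hm]
    · tauto
  rw [hS] at h2
  refine { h2 with nc := ?_ }
  intro i j p q hij hjp hpq
  simp only [Finset.mem_union, mem_glue]
  have e1 : ∀ {x y}, (x, y) ∈ Q → m < x ∧ x < v ∧ m < y ∧ y < v := by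
    intro x y hxy
    have := hQ.mem hxy
    simp only [Finset.mem_erase, Finset.mem_filter] at this
    exact ⟨lt_of_le_of_ne (hmin x this.1.2.1) this.1.1.symm, this.1.2.2,
      lt_of_le_of_ne (hmin y this.2.2.1) this.2.1.symm, this.2.2.2⟩
  have e2 : ∀ {x y}, (x, y) ∈ Q' → v ≤ x ∧ v ≤ y := by
    intro x y hxy
    have := hQ'.mem hxy
    simp only [Finset.mem_filter] at this
    exact ⟨this.1.2, this.2.2⟩
  have n1 := @hQ.nc i j p q hij hjp hpq
  have n2 := @hQ'.nc i j p q hij hjp hpq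
  have n3 := @hQ'.nc v j p q
  have n4 := @hQ'.trans v j q
  have n5 := @hQ'.symm
  rintro (h3 | ⟨rfl, rfl⟩ | h3 | ⟨rfl, h3⟩ | ⟨rfl, h3⟩) (h4 | ⟨rfl, rfl⟩ | h4 | ⟨rfl, h4⟩ | ⟨rfl, h4⟩)
  all_goals first
    | exact Or.inl (n1 h3 h4)
    | exact Or.inr (Or.inr (Or.inl (n2 h3 h4)))
    | skip
  all_goals first
    | (have a1 := e1 h3; have a2 := e2 h4; order)
    | (have a1 := e2 h3; have a2 := e1 h4; order)
    | (have a1 := e1 h3; order)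
    | (have a1 := e1 h4; order)
    | (have a1 := e2 h3; order)
    | (have a1 := e2 h4; order)
    | order
    | skip
  -- The only case left has `i = m`, with `p` in the class of `v` and `(j, q)` in `Q'`. Either `j =
  -- v`, or `v < j < p < q` and non-crossing of `Q'` applies.
  have a1 := e2 h4
  rcases a1.1.eq_or_lt with rfl | hvj
  · exact Or.inr (Or.inr (Or.inr (Or.inl ⟨rfl, hQ'.refl (hQ'.mem h4).1⟩)))
  · exact Or.inr (Or.inr (Or.inr (Or.inl ⟨rfl, n3 hvj hjp hpq h3 h4⟩)))

theorem IsNCE.eq_insert (hm : m ∈ S) (h : IsNCE S E) (h1 : ∀ x, (m, x) ∈ E → x = m) :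
    insert (m, m) (restrictRel E (S.erase m)) = E := by
  have h2 := @h.mem
  have h3 := @h.refl
  have h4 := @h.symm
  ext ⟨x, y⟩
  simp only [Finset.mem_insert, mem_restrictRel, Finset.mem_erase, Prod.mk.injEq]
  grind

theorem IsNCE.eq_union_glue (hm : m ∈ S) (hmin : ∀ x ∈ S, m ≤ x) (h : IsNCE S E)
    (h1 : IsNext E m v) : restrictRel E ((S.filter (· < v)).erase m) ∪
      glue m v (restrictRel E (S.filter (v ≤ ·))) = E := by
  obtain ⟨hmv, hE, hnext⟩ := h1
  have h3 := @h.refl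
  have h4 := @h.symm
  have h5 := @h.trans
  -- No class reaches across `v` from the open gap between `m` and `v`: it would contain `v` or
  -- cross the pair `m, v`. It would then be the class of `m`, which has no point in the gap.
  have key : ∀ {x y}, (x, y) ∈ E → x ≠ m → x < v → v ≤ y → False := by
    intro x y hxy hxm hxv hvy
    have hmx : m < x := lt_of_le_of_ne (hmin x (h.mem hxy).1) hxm.symm
    have : (m, x) ∈ E := by
      rcases hvy.eq_or_lt with rfl | hvy
      · exact h5 hE (h4 hxy)
      · exact h.nc hmx hxv hvy hE hxy
    rcases hnext x this with h6 | h6 <;> order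
  ext ⟨x, y⟩
  have hx := hmin x
  have hy := hmin y
  have h2 := @h.mem x y
  have k1 := @key x y
  have k2 := @key y x
  have n1 := hnext x
  have n2 := hnext y
  have v1 := (h.mem hE).2
  simp only [Finset.mem_union, mem_glue, mem_restrictRel, Finset.mem_erase, Finset.mem_filter]
  grind

/-! ### Cutting non-crossing partitions into independent pieces. -/

section Sums

variable {M : Type*} [AddCommMonoid M]

theorem exists_isNext (h : IsNCE S E) (hmin : ∀ x ∈ S, m ≤ x)
    (h1 : ¬ ∀ x, (m, x) ∈ E → x = m) : ∃ v ∈ S.erase m, IsNext E m v := by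
  push Not at h1
  obtain ⟨x, hx, hxm⟩ := h1
  have hne : ((S.filter fun y => (m, y) ∈ E).erase m).Nonempty :=
    ⟨x, by simp [hxm, hx, (h.mem hx).2]⟩
  have hmem := Finset.min'_mem _ hne
  refine ⟨Finset.min' _ hne, ?_, ?_, ?_, fun y hy => ?_⟩
  · exact Finset.erase_subset_erase _ (Finset.filter_subset _ _) hmem
  · have h2 := Finset.mem_erase.1 hmem
    exact lt_of_le_of_ne (hmin _ (Finset.mem_filter.1 h2.2).1) h2.1.symm
  · exact (Finset.mem_filter.1 (Finset.mem_of_mem_erase hmem)).2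
  · by_cases hym : y = m
    · exact Or.inl hym.le
    · exact Or.inr (Finset.min'_le _ _ (by simp [hym, hy, (h.mem hy).2]))

theorem IsNext.unique {v' : α} (h : IsNext E m v) (h' : IsNext E m v') : v = v' := by
  rcases h.2.2 _ h'.2.1 with h1 | h1
  · exact absurd h'.1 (not_lt_of_ge h1)
  · rcases h'.2.2 _ h.2.1 with h2 | h2
    · exact absurd h.1 (not_lt_of_ge h2)
    · exact le_antisymm h1 h2

/-- Decomposition of non-crossing partitions at the first two elements of the first block. -/
theorem sum_NCE_min (hm : m ∈ S) (hmin : ∀ x ∈ S, m ≤ x) (Φ : Finset (α × α) → M) :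
    ∑ E ∈ NCE S, Φ E = ∑ Q ∈ NCE (S.erase m), Φ (insert (m, m) Q) +
      ∑ v ∈ S.erase m, ∑ p ∈ NCE ((S.filter (· < v)).erase m) ×ˢ NCE (S.filter (v ≤ ·)),
        Φ (p.1 ∪ glue m v p.2) := by
  classical
  have key : ∀ E ∈ NCE S, Φ E = (if ∀ x, (m, x) ∈ E → x = m then Φ E else 0) +
      ∑ v ∈ S.erase m, if IsNext E m v then Φ E else 0 := by
    intro E hE
    rw [mem_NCE] at hE
    by_cases h : ∀ x, (m, x) ∈ E → x = m
    · rw [if_pos h, Finset.sum_eq_zero, add_zero]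
      intro v hv
      exact if_neg fun h1 => h1.1.ne' (h v h1.2.1)
    · rw [if_neg h, zero_add]
      obtain ⟨v, hv, hnext⟩ := exists_isNext hE hmin h
      rw [Finset.sum_eq_single_of_mem v hv, if_pos hnext]
      exact fun v' _ hne => if_neg fun h' => hne (h'.unique hnext)
  rw [Finset.sum_congr rfl key, Finset.sum_add_distrib, Finset.sum_comm]
  simp only [← Finset.sum_filter]
  congr 1
  · refine Finset.sum_nbij' (fun E => restrictRel E (S.erase m)) (insert (m, m)) ?_ ?_ ?_ ?_ ?_
    · intro E hE
      exact mem_NCE.2 ((mem_NCE.1 (Finset.mem_filter.1 hE).1).restrict (Finset.erase_subset _ _))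
    · intro Q hQ
      rw [mem_NCE] at hQ
      refine Finset.mem_filter.2 ⟨mem_NCE.2 ?_, fun x hx => ?_⟩
      · have := isNCE_insert (m := m) (fun x hx => lt_of_le_of_ne
          (hmin x (Finset.mem_of_mem_erase hx)) (Finset.ne_of_mem_erase hx).symm) hQ
        rwa [Finset.insert_erase hm] at this
      · rcases Finset.mem_insert.1 hx with h | h
        · exact (Prod.mk.inj h).2
        · exact absurd (hQ.mem h).1 (Finset.notMem_erase _ _)
    · intro E hE
      exact (mem_NCE.1 (Finset.mem_filter.1 hE).1).eq_insert hm (Finset.mem_filter.1 hE).2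
    · intro Q hQ
      have h1 := @(mem_NCE.1 hQ).mem
      ext ⟨x, y⟩
      simp only [mem_restrictRel, Finset.mem_insert, Prod.mk.injEq, Finset.mem_erase] at h1 ⊢
      grind
    · intro E hE
      rw [(mem_NCE.1 (Finset.mem_filter.1 hE).1).eq_insert hm (Finset.mem_filter.1 hE).2]
  · refine Finset.sum_congr rfl fun v hv => ?_
    have hv' := Finset.mem_erase.1 hv
    have hmv : m < v := lt_of_le_of_ne (hmin v hv'.2) hv'.1.symm
    refine Finset.sum_nbij' (fun E => (restrictRel E ((S.filter (· < v)).erase m),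
      restrictRel E (S.filter (v ≤ ·)))) (fun p => p.1 ∪ glue m v p.2) ?_ ?_ ?_ ?_ ?_
    · intro E hE
      have h := mem_NCE.1 (Finset.mem_filter.1 hE).1
      exact Finset.mem_product.2 ⟨mem_NCE.2 (h.restrict
        ((Finset.erase_subset _ _).trans (Finset.filter_subset _ _))),
        mem_NCE.2 (h.restrict (Finset.filter_subset _ _))⟩
    · rintro ⟨Q, Q'⟩ hQ
      rw [Finset.mem_product, mem_NCE, mem_NCE] at hQ
      refine Finset.mem_filter.2 ⟨mem_NCE.2 (isNCE_union_glue hm hmin hv hQ.1 hQ.2), hmv, ?_, ?_⟩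
      · simp [mem_glue, hQ.2.refl (Finset.mem_filter.2 ⟨hv'.2, le_rfl⟩)]
      · intro x
        have h1 := @(hQ.1).mem m x
        have h2 := @(hQ.2).mem m x
        have h3 := @(hQ.2).mem v x
        simp only [Finset.mem_union, mem_glue, Finset.mem_erase, Finset.mem_filter] at h1 h2 h3 ⊢
        grind
    · intro E hE
      exact (mem_NCE.1 (Finset.mem_filter.1 hE).1).eq_union_glue hm hmin (Finset.mem_filter.1 hE).2
    · rintro ⟨Q, Q'⟩ hQ
      rw [Finset.mem_product, mem_NCE, mem_NCE] at hQ
      have h1 := @(hQ.1).mem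
      have h2 := @(hQ.2).mem
      simp only [Finset.mem_erase, Finset.mem_filter] at h1 h2
      refine Prod.ext ?_ ?_
      · ext ⟨x, y⟩
        have h1' := @h1 x y
        have h2' := @h2 x y
        simp only [mem_restrictRel, Finset.mem_union, mem_glue, Finset.mem_erase,
          Finset.mem_filter]
        grind
      · ext ⟨x, y⟩
        have h1' := @h1 x y
        have h2' := @h2 x y
        simp only [mem_restrictRel, Finset.mem_union, mem_glue, Finset.mem_filter]
        grind
    · intro E hE
      rw [(mem_NCE.1 (Finset.mem_filter.1 hE).1).eq_union_glue hm hmin (Finset.mem_filter.1 hE).2]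

/-- Decomposition of non-crossing partitions at the last element of the first block. -/
theorem sum_NCE_component (hm : m ∈ S) (hmin : ∀ x ∈ S, m ≤ x) (Φ : Finset (α × α) → M) :
    ∑ E ∈ NCE S, Φ E = ∑ b ∈ S, ∑ p ∈ ((NCE (S.filter (· ≤ b))).filter ((m, b) ∈ ·)) ×ˢ
      NCE ((S.filter (b ≤ ·)).erase b), Φ (p.1 ∪ p.2) := by
  classical
  have key : ∀ E ∈ NCE S, Φ E =
      ∑ b ∈ S, if (m, b) ∈ E ∧ ∀ x, (m, x) ∈ E → x ≤ b then Φ E else 0 := by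
    intro E hE
    rw [mem_NCE] at hE
    have hne : (S.filter fun y => (m, y) ∈ E).Nonempty := ⟨m, by simp [hm, hE.refl hm]⟩
    have hmem := Finset.mem_filter.1 (Finset.max'_mem _ hne)
    have hmax : ∀ x, (m, x) ∈ E → x ≤ (S.filter fun y => (m, y) ∈ E).max' hne := fun x hx =>
      Finset.le_max' _ _ (Finset.mem_filter.2 ⟨(hE.mem hx).2, hx⟩)
    rw [Finset.sum_eq_single_of_mem _ hmem.1, if_pos ⟨hmem.2, hmax⟩]
    exact fun v' _ hne => if_neg fun h' => hne (le_antisymm (hmax _ h'.1) (h'.2 _ hmem.2))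
  rw [Finset.sum_congr rfl key, Finset.sum_comm]
  simp only [← Finset.sum_filter]
  refine Finset.sum_congr rfl fun b hb => ?_
  have hmb := hmin b hb
  have inv : ∀ E ∈ (NCE S).filter (fun E => (m, b) ∈ E ∧ ∀ x, (m, x) ∈ E → x ≤ b),
      restrictRel E (S.filter (· ≤ b)) ∪ restrictRel E ((S.filter (b ≤ ·)).erase b) = E := by
    intro E hE
    rw [Finset.mem_filter, mem_NCE] at hE
    obtain ⟨h, h1, h2⟩ := hE
    -- A pair straddling `b` would cross the pair `m, b` or share an end with it. Either way its
    -- right end would be a point of the class of `m` beyond `b`.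
    have key : ∀ {x y}, (x, y) ∈ E → x ≤ b → b < y → False := by
      intro x y hxy hxb hby
      have hmx := hmin x (h.mem hxy).1
      refine hby.not_ge (h2 y ?_)
      rcases hmx.eq_or_lt with rfl | hmx
      · exact hxy
      rcases hxb.eq_or_lt with rfl | hxb
      · exact h.trans h1 hxy
      · exact h.trans (h.nc hmx hxb hby h1 hxy) hxy
    ext ⟨x, y⟩
    have k1 := @key x y
    have k2 := @key y x
    have k3 := @h.symm x y
    have k4 := @h.mem x y
    simp only [mem_restrictRel, Finset.mem_union, Finset.mem_erase, Finset.mem_filter]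
    grind
  refine Finset.sum_nbij' (fun E => (restrictRel E (S.filter (· ≤ b)),
    restrictRel E ((S.filter (b ≤ ·)).erase b))) (fun p => p.1 ∪ p.2) ?_ ?_ inv ?_ ?_
  · intro E hE
    obtain ⟨h, h1, h2⟩ := Finset.mem_filter.1 hE
    rw [mem_NCE] at h
    refine Finset.mem_product.2 ⟨Finset.mem_filter.2 ⟨mem_NCE.2 (h.restrict
      (Finset.filter_subset _ _)), ?_⟩, mem_NCE.2 (h.restrict
        ((Finset.erase_subset _ _).trans (Finset.filter_subset _ _)))⟩
    simp [mem_restrictRel, h1, hm, hb, hmb]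
  · rintro ⟨Q, Q'⟩ hQ
    rw [Finset.mem_product, Finset.mem_filter, mem_NCE, mem_NCE] at hQ
    obtain ⟨⟨h1, h2⟩, h3⟩ := hQ
    have h4 := h1.toIsEqv.union h3.toIsEqv (by
      rw [Finset.disjoint_left]
      intro x
      simp only [Finset.mem_erase, Finset.mem_filter]
      grind)
    have hS : S.filter (· ≤ b) ∪ (S.filter (b ≤ ·)).erase b = S := by
      ext x
      simp only [Finset.mem_union, Finset.mem_erase, Finset.mem_filter]
      have := le_total x b
      grind
    rw [hS] at h4
    have m1 := @h1.mem
    have m3 := @h3.mem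
    simp only [Finset.mem_erase, Finset.mem_filter] at m1 m3
    refine Finset.mem_filter.2 ⟨mem_NCE.2 { h4 with nc := ?_ }, Finset.mem_union_left _ h2, ?_⟩
    · intro i j p q hij hjp hpq
      simp only [Finset.mem_union]
      rintro (h5 | h5) (h6 | h6)
      · exact Or.inl (h1.nc hij hjp hpq h5 h6)
      · have a1 := m1 h5; have a2 := m3 h6; order
      · have a1 := m3 h5; have a2 := m1 h6; order
      · exact Or.inr (h3.nc hij hjp hpq h5 h6)
    · intro x hx
      rcases Finset.mem_union.1 hx with h | h
      · exact (m1 h).2.2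
      · have := m3 h; order
  · rintro ⟨Q, Q'⟩ hQ
    rw [Finset.mem_product, Finset.mem_filter, mem_NCE, mem_NCE] at hQ
    have h1 := @(hQ.1.1).mem
    have h2 := @(hQ.2).mem
    simp only [Finset.mem_erase, Finset.mem_filter] at h1 h2
    refine Prod.ext ?_ ?_
    · ext ⟨x, y⟩
      have h1' := @h1 x y
      have h2' := @h2 x y
      simp only [mem_restrictRel, Finset.mem_union, Finset.mem_filter]
      grind
    · ext ⟨x, y⟩
      have h1' := @h1 x y
      have h2' := @h2 x y
      simp only [mem_restrictRel, Finset.mem_union, Finset.mem_erase, Finset.mem_filter]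
      grind
  · intro E hE
    rw [inv E hE]

end Sums

/-! ### How the Kreweras complement splits along these cuts. -/

section Kreweras

/-- The points `m` and `v` lie in one block. An interval `(x, y]` with `x < v ≤ y` contains `v` but
not the least point `m`, so no class of the complement reaches across `v`. On the left, `m` keeps
its place as a singleton, because its complementary position remains there. -/
theorem krE_insert_union_glue (hm : m ∈ S) (hmin : ∀ x ∈ S, m ≤ x) (hv : v ∈ S.erase m)
    (hQ : IsNCE ((S.filter (· < v)).erase m) Q) (hQ' : IsNCE (S.filter (v ≤ ·)) Q') :
    krE S (Q ∪ glue m v Q') =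
      krE (S.filter (· < v)) (insert (m, m) Q) ∪ krE (S.filter (v ≤ ·)) Q' := by
  have hv' := Finset.mem_erase.1 hv
  have hmv : m < v := lt_of_le_of_ne (hmin v hv'.2) hv'.1.symm
  have h1 : IsEqv S (krE (S.filter (· < v)) (insert (m, m) Q) ∪ krE (S.filter (v ≤ ·)) Q') := by
    have := (isEqv_krE (S.filter (· < v)) (insert (m, m) Q)).union
      (isEqv_krE (S.filter (v ≤ ·)) Q') (by
        rw [Finset.disjoint_left]
        intro x
        simp only [Finset.mem_filter]
        grind)
    rwa [show S.filter (· < v) ∪ S.filter (v ≤ ·) = S by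
      ext x
      have := lt_or_ge x v
      simp only [Finset.mem_union, Finset.mem_filter]
      tauto] at this
  refine (isEqv_krE _ _).eq_of_le h1 fun x y hxy => ?_
  have e1 : ∀ {x y}, (x, y) ∈ Q → x < v ∧ y < v := by
    intro x y hxy
    have := hQ.mem hxy
    simp only [Finset.mem_erase, Finset.mem_filter] at this
    exact ⟨this.1.2.2, this.2.2.2⟩
  have e2 : ∀ {x y}, (x, y) ∈ Q' → v ≤ x ∧ v ≤ y := by
    intro x y hxy
    have := hQ'.mem hxy
    simp only [Finset.mem_filter] at this
    exact ⟨this.1.2, this.2.2⟩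
  simp only [Finset.mem_union, mem_krE, mem_glue, Finset.mem_insert, Finset.mem_filter,
    Set.uIoc_of_le hxy, Set.mem_Ioc, Prod.mk.injEq]
  constructor
  · rintro ⟨hx, hy, h⟩
    by_cases hyv : y < v
    · exact Or.inl ⟨⟨hx, hxy.trans_lt hyv⟩, ⟨hy, hyv⟩, fun p q hpq => h p q (by tauto)⟩
    by_cases hvx : v ≤ x
    · exact Or.inr ⟨⟨hx, hvx⟩, ⟨hy, hvx.trans hxy⟩, fun p q hpq => h p q (by tauto)⟩
    · have h3 := h m v (Or.inr (Or.inr (Or.inr (Or.inl ⟨rfl, hQ'.refl (by simp [hv'.2])⟩))))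
      have := (h3.2 ⟨not_le.1 hvx, not_lt.1 hyv⟩).1
      exact absurd this (hmin x hx).not_gt
  · rintro (⟨hx, hy, h⟩ | ⟨hx, hy, h⟩)
    · refine ⟨hx.1, hy.1, fun p q hpq => ?_⟩
      have := hmin x hx.1
      rcases hpq with h4 | ⟨rfl, rfl⟩ | h4 | ⟨rfl, h4⟩ | ⟨rfl, h4⟩
      · exact h p q (Or.inr h4)
      · rfl
      all_goals have := e2 h4; grind
    · refine ⟨hx.1, hy.1, fun p q hpq => ?_⟩
      have := hmin x hx.1
      rcases hpq with h4 | ⟨rfl, rfl⟩ | h4 | ⟨rfl, h4⟩ | ⟨rfl, h4⟩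
      · have := e1 h4; grind
      · rfl
      · exact h p q h4
      · have := h _ _ h4; grind
      · have := h _ _ h4; grind

/-- The point `m` is alone and `b` closes the block of the next point `m'`, so `(m, b]` is a union
of blocks and the positions `m` and `b` are joined in the complement. Within the left piece the
position `b` is isolated, hence erased. It is counted in the right piece, where `b` stands as a
singleton. -/
theorem krE_insert_union (hm : m ∈ S) (hmin : ∀ x ∈ S, m ≤ x) {m' : α}
    (hmin' : ∀ x ∈ S.erase m, m' ≤ x) (hb : b ∈ S.erase m)
    (hQ : IsNCE ((S.erase m).filter (· ≤ b)) Q) (hQb : (m', b) ∈ Q)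
    (hQ' : IsNCE (((S.erase m).filter (b ≤ ·)).erase b) Q') :
    krE S (insert (m, m) (Q ∪ Q')) = (krE ((S.erase m).filter (· ≤ b)) Q).erase (b, b) ∪
      glue m b (krE ((S.erase m).filter (b ≤ ·)) (insert (b, b) Q')) := by
  have hm' : m' ∈ S.erase m := (Finset.mem_filter.1 (hQ.mem hQb).1).1
  have hm'' := Finset.mem_erase.1 hm'
  have hmm : m < m' := lt_of_le_of_ne (hmin m' hm''.2) hm''.1.symm
  have hmb : m' ≤ b := hmin' b hb
  have hb' := (Finset.mem_erase.1 hb).2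
  have e1 : ∀ {x y}, (x, y) ∈ Q → m < x ∧ x ≤ b ∧ m < y ∧ y ≤ b := by
    intro x y hxy
    have := hQ.mem hxy
    simp only [Finset.mem_filter] at this
    exact ⟨hmm.trans_le (hmin' x this.1.1), this.1.2, hmm.trans_le (hmin' y this.2.1), this.2.2⟩
  have e2 : ∀ {x y}, (x, y) ∈ Q' → b < x ∧ b < y := by
    intro x y hxy
    have := hQ'.mem hxy
    simp only [Finset.mem_erase, Finset.mem_filter] at this
    exact ⟨lt_of_le_of_ne this.1.2.2 this.1.1.symm, lt_of_le_of_ne this.2.2.2 this.2.1.symm⟩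
  -- For `x < b` the interval `(x, b]` contains `b` but not `m'`, although both lie in one block.
  have k1 : ∀ {x}, (x, b) ∈ krE ((S.erase m).filter (· ≤ b)) Q → x = b := by
    intro x hx
    rw [mem_krE] at hx
    have hxb := (Finset.mem_filter.1 hx.1).2
    have := hx.2.2 _ _ hQb
    rw [Set.uIoc_of_le hxb, Set.mem_Ioc, Set.mem_Ioc] at this
    by_contra hne
    exact ((this.2 ⟨lt_of_le_of_ne hxb hne, le_rfl⟩).1).not_ge (hmin' x (Finset.mem_filter.1 hx.1).1)
  have h1 : IsEqv S ((krE ((S.erase m).filter (· ≤ b)) Q).erase (b, b) ∪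
      glue m b (krE ((S.erase m).filter (b ≤ ·)) (insert (b, b) Q'))) := by
    have h2 : IsEqv (((S.erase m).filter (· ≤ b)).erase b)
        ((krE ((S.erase m).filter (· ≤ b)) Q).erase (b, b)) :=
      (isEqv_krE _ _).erase fun h => k1 h
    have h3 := isEqv_glue (isEqv_krE ((S.erase m).filter (b ≤ ·)) (insert (b, b) Q')) (m := m) (v := b)
      (by simp) (by simpa using hb)
    have h4 := h2.union h3 (by
      rw [Finset.disjoint_left]
      intro x
      simp only [Finset.mem_filter, Finset.mem_erase, Finset.mem_insert]
      grind)
    convert h4 using 1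
    ext x
    have := le_total x b
    simp only [Finset.mem_filter, Finset.mem_erase, Finset.mem_insert, Finset.mem_union]
    grind
  refine (isEqv_krE _ _).eq_of_le h1 fun x y hxy => ?_
  simp only [Finset.mem_union, mem_glue, Finset.mem_erase, mem_krE, Finset.mem_insert,
    Finset.mem_filter, Set.uIoc_of_le hxy, Prod.mk.injEq, ne_eq]
  constructor
  · rintro ⟨hx, hy, h⟩
    have hQh : ∀ p q, (p, q) ∈ Q → (p ∈ Set.Ioc x y ↔ q ∈ Set.Ioc x y) :=
      fun p q hpq => h p q (Or.inr (Or.inl hpq))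
    have hQh' : ∀ p q, p = b ∧ q = b ∨ (p, q) ∈ Q' → (p ∈ Set.Ioc x y ↔ q ∈ Set.Ioc x y) := by
      rintro p q (⟨rfl, rfl⟩ | hpq)
      · rfl
      · exact h p q (Or.inr (Or.inr hpq))
    have hmx := hmin x hx
    rcases hmx.eq_or_lt with rfl | hmx
    · rcases hxy.eq_or_lt with rfl | hxy
      · exact Or.inr (Or.inl ⟨rfl, rfl⟩)
      have hyb : b ≤ y := by
        have h3 := hQh _ _ hQb
        have := hmin' y (by simp [hxy.ne', hy])
        exact (h3.1 ⟨hmm, this⟩).2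
      refine Or.inr (Or.inr (Or.inr (Or.inl ⟨rfl, ⟨Finset.mem_erase.1 hb, le_rfl⟩,
        ⟨⟨hxy.ne', hy⟩, hyb⟩, fun p q hpq => ?_⟩)))
      have h3 := hQh' p q hpq
      rw [Set.uIoc_of_le hyb]
      simp only [Set.mem_Ioc] at h3 ⊢
      rcases hpq with ⟨rfl, rfl⟩ | hpq
      · rfl
      · have := e2 hpq
        grind
    · have hxm' := hmin' x (by simp [hmx.ne', hx])
      by_cases hyb : y < b
      · exact Or.inl ⟨fun h => hyb.ne h.2, ⟨⟨hmx.ne', hx⟩, hxy.trans hyb.le⟩,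
          ⟨⟨(hmx.trans_le hxy).ne', hy⟩, hyb.le⟩, hQh⟩
      · rw [not_lt] at hyb
        have hbx : b ≤ x := by
          by_contra hxb
          exact hxm'.not_gt ((hQh _ _ hQb).2 ⟨not_le.1 hxb, hyb⟩).1
        exact Or.inr (Or.inr (Or.inl ⟨⟨⟨hmx.ne', hx⟩, hbx⟩,
          ⟨⟨(hmx.trans_le hxy).ne', hy⟩, hyb⟩, hQh'⟩))
  · rintro (⟨-, hx, hy, h⟩ | ⟨rfl, rfl⟩ | ⟨hx, hy, h⟩ | ⟨rfl, -, hy, h⟩ | ⟨rfl, hx, -, -⟩)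
    · refine ⟨hx.1.2, hy.1.2, ?_⟩
      rintro p q (⟨rfl, rfl⟩ | hpq | hpq)
      · rfl
      · exact h p q hpq
      · have := e2 hpq
        simp only [Set.mem_Ioc]
        grind
    · exact ⟨hm, hm, by simp⟩
    · refine ⟨hx.1.2, hy.1.2, ?_⟩
      rintro p q (⟨rfl, rfl⟩ | hpq | hpq)
      · rfl
      · have := e1 hpq
        simp only [Set.mem_Ioc]
        grind
      · exact h p q (Or.inr hpq)
    · refine ⟨hm, hy.1.2, ?_⟩
      rintro p q (⟨rfl, rfl⟩ | hpq | hpq)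
      · rfl
      · have := e1 hpq
        simp only [Set.mem_Ioc]
        grind
      · have h3 := h p q (Or.inr hpq)
        have := e2 hpq
        rw [Set.uIoc_of_le hy.2] at h3
        simp only [Set.mem_Ioc] at h3 ⊢
        grind
    · exact absurd (le_antisymm hxy (hmin x hx.1.2)) hx.1.1

end Kreweras

end Relations

/-! ### Weighted sums over partitions and complements, and their recursions. -/

section Weights

variable {α : Type*} [LinearOrder α]

/-- The class of `x`. -/
def cl (E : Finset (α × α)) (x : α) : Finset α := (E.filter (·.1 = x)).image Prod.snd

theorem mem_cl {E : Finset (α × α)} {x y : α} : y ∈ cl E x ↔ (x, y) ∈ E := by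
  simp [cl]

/-- The classes of the relation `E`. -/
def blocks (E : Finset (α × α)) : Finset (Finset α) := E.image fun p => cl E p.1

variable {S T V : Finset α} {m v b x y : α} {E Q Q' : Finset (α × α)}

theorem IsEqv.mem_blocks (h : IsEqv S E) : V ∈ blocks E ↔ ∃ x ∈ S, cl E x = V := by
  simp only [blocks, Finset.mem_image, Prod.exists]
  exact ⟨fun ⟨x, y, h1, h2⟩ => ⟨x, (h.mem h1).1, h2⟩, fun ⟨x, h1, h2⟩ => ⟨x, x, h.refl h1, h2⟩⟩

theorem IsEqv.cl_eq_iff (h : IsEqv S E) (hx : x ∈ S) : cl E x = cl E y ↔ (x, y) ∈ E := by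
  constructor
  · intro h1
    have : x ∈ cl E y := h1 ▸ mem_cl.2 (h.refl hx)
    exact h.symm (mem_cl.1 this)
  · intro h1
    ext z
    rw [mem_cl, mem_cl]
    exact ⟨fun h2 => h.trans (h.symm h1) h2, fun h2 => h.trans h1 h2⟩

theorem IsEqv.subset_of_mem_blocks (h : IsEqv S E) (hV : V ∈ blocks E) : V ⊆ S := by
  obtain ⟨x, -, rfl⟩ := h.mem_blocks.1 hV
  exact fun y hy => (h.mem (mem_cl.1 hy)).2

theorem IsEqv.cl_subset (h : IsEqv S E) : cl E x ⊆ S := fun _ hy => (h.mem (mem_cl.1 hy)).2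

theorem IsEqv.cl_union_left (h : IsEqv T Q') (hd : Disjoint S T) (hx : x ∈ S) :
    cl (Q ∪ Q') x = cl Q x := by
  ext y
  rw [mem_cl, mem_cl, Finset.mem_union, or_iff_left]
  exact fun h1 => Finset.disjoint_left.1 hd hx (h.mem h1).1

theorem IsEqv.blocks_union (h : IsEqv S Q) (h' : IsEqv T Q') (hd : Disjoint S T) :
    blocks (Q ∪ Q') = blocks Q ∪ blocks Q' := by
  rw [blocks, Finset.image_union]
  congr 1
  · refine Finset.image_congr fun p hp => ?_
    exact h'.cl_union_left hd (h.mem (Finset.mem_coe.1 hp)).1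
  · refine Finset.image_congr fun p hp => ?_
    rw [Finset.union_comm, h.cl_union_left hd.symm (h'.mem (Finset.mem_coe.1 hp)).1]

theorem IsEqv.disjoint_blocks (h : IsEqv S Q) (h' : IsEqv T Q') (hd : Disjoint S T) :
    Disjoint (blocks Q) (blocks Q') := by
  rw [Finset.disjoint_left]
  intro V hV hV'
  obtain ⟨x, hx, rfl⟩ := h.mem_blocks.1 hV
  exact Finset.disjoint_left.1 hd hx
    (h'.subset_of_mem_blocks hV' (mem_cl.2 (h.refl hx)))

variable {R : Type*} [CommRing R] {F F' F1 F1' G G' G1 G1' : Finset α → R}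

/-- The product of the weights of the classes. -/
def pw (F : Finset α → R) (E : Finset (α × α)) : R := ∏ V ∈ blocks E, F V

/-- The product of the weights of the classes, where the class of `m` has a weight of its own. -/
def pwm (F F1 : Finset α → R) (m : α) (E : Finset (α × α)) : R :=
  F1 (cl E m) * ∏ V ∈ (blocks E).erase (cl E m), F V

theorem IsEqv.pwm_self (h : IsEqv S E) (hm : m ∈ S) : pwm F F m E = pw F E :=
  Finset.mul_prod_erase _ F (h.mem_blocks.2 ⟨m, hm, rfl⟩)

theorem IsEqv.pw_union (h : IsEqv S Q) (h' : IsEqv T Q') (hd : Disjoint S T) :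
    pw F (Q ∪ Q') = pw F Q * pw F Q' := by
  rw [pw, h.blocks_union h' hd, Finset.prod_union (h.disjoint_blocks h' hd), pw, pw]

theorem IsEqv.pwm_union (h : IsEqv S Q) (h' : IsEqv T Q') (hd : Disjoint S T) (hm : m ∈ T) :
    pwm F F1 m (Q ∪ Q') = pw F Q * pwm F F1 m Q' := by
  have h1 : cl Q' m ∉ blocks Q := fun h2 => Finset.disjoint_left.1 (h.disjoint_blocks h' hd) h2
    (h'.mem_blocks.2 ⟨m, hm, rfl⟩)
  rw [pwm, Finset.union_comm, h.cl_union_left hd.symm hm, h'.blocks_union h hd.symm,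
    Finset.erase_union_distrib, Finset.erase_eq_of_notMem h1, Finset.prod_union, pwm, pw]
  · ring
  · exact Finset.disjoint_of_subset_left (Finset.erase_subset _ _) (h.disjoint_blocks h' hd).symm

theorem cl_singleton (m : α) : cl {(m, m)} m = {m} := by
  ext
  simp [mem_cl]

theorem pwm_singleton (m : α) : pwm F F1 m {(m, m)} = F1 {m} := by
  simp [pwm, blocks, cl_singleton]

theorem IsEqv.pwm_insert (h : IsEqv S Q) (hm : m ∉ S) :
    pwm F F1 m (insert (m, m) Q) = F1 {m} * pw F Q := by
  rw [Finset.insert_eq, Finset.union_comm, h.pwm_union (isEqv_singleton m) (by simpa using hm)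
    (by simp), pwm_singleton, mul_comm]

/-- This is the reason for a separate weight on the class of the first point: gluing `m` onto the
class of `v` only replaces `F1` by `F1 ∘ insert m`, so the recursions close up. -/
theorem IsEqv.pwm_glue (h : IsEqv S Q) (hm : m ∉ S) (hv : v ∈ S) :
    pwm F F1 m (glue m v Q) = pwm F (F1 ∘ insert m) v Q := by
  have h0 := isEqv_glue h hm hv
  have h1 : cl (glue m v Q) m = insert m (cl Q v) := by
    ext y
    have := @h.mem m y
    simp only [mem_cl, mem_glue, Finset.mem_insert]
    grind
  have h2 : (blocks (glue m v Q)).erase (cl (glue m v Q) m) = (blocks Q).erase (cl Q v) := by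
    have key : ∀ x ∈ S, (x, v) ∉ Q → cl (glue m v Q) x = cl Q x := by
      intro x hx hxv
      ext y
      simp only [mem_cl, mem_glue]
      grind
    ext V
    rw [Finset.mem_erase, Finset.mem_erase, h0.mem_blocks, h.mem_blocks]
    constructor
    · rintro ⟨hne, x, hx, rfl⟩
      have hxm : x ≠ m := fun h => hne (by rw [h])
      have hx := Finset.mem_of_mem_insert_of_ne hx hxm
      have hxv : (x, v) ∉ Q := fun h2 => hne ((h0.cl_eq_iff (Finset.mem_insert_of_mem hx)).2
        (mem_glue.2 (Or.inr (Or.inr (Or.inr ⟨rfl, h2⟩)))))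
      rw [key x hx hxv]
      exact ⟨fun h3 => hxv ((h.cl_eq_iff hx).1 h3), x, hx, rfl⟩
    · rintro ⟨hne, x, hx, rfl⟩
      have hxv : (x, v) ∉ Q := fun h3 => hne ((h.cl_eq_iff hx).2 h3)
      refine ⟨fun h3 => ?_, x, Finset.mem_insert_of_mem hx, key x hx hxv⟩
      rw [← key x hx hxv, h0.cl_eq_iff (Finset.mem_insert_of_mem hx), mem_glue] at h3
      have := @h.mem x m
      grind
  rw [pwm, h2, h1, pwm]
  rfl

theorem IsEqv.pw_congr (h : IsEqv S E) (hF : ∀ V ⊆ S, F V = F' V) : pw F E = pw F' E :=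
  Finset.prod_congr rfl fun V hV => hF V (h.subset_of_mem_blocks hV)

theorem IsEqv.pwm_congr (h : IsEqv S E) (hF : ∀ V ⊆ S, F V = F' V)
    (hF1 : ∀ V ⊆ S, F1 V = F1' V) : pwm F F1 m E = pwm F' F1' m E := by
  rw [pwm, pwm, hF1 _ h.cl_subset]
  congr 1
  exact Finset.prod_congr rfl fun V hV =>
    hF V (h.subset_of_mem_blocks (Finset.mem_of_mem_erase hV))

/-- The weighted sum over all non-crossing partitions and their Kreweras complements. -/
noncomputable def ncSum (F F1 G : Finset α → R) (S : Finset α) (m : α) : R :=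
  ∑ E ∈ NCE S, pwm F F1 m E * pw G (krE S E)

/-- The part of `ncSum` in which the first point is a singleton, without its factor. -/
noncomputable def ncSumFirst (F G G1 : Finset α → R) (S : Finset α) (m : α) : R :=
  ∑ Q ∈ NCE (S.erase m), pw F Q * pwm G G1 m (krE S (insert (m, m) Q))

open Classical in
/-- The part of `ncSum` in which the first and last points are in one block, without the factor
of the last point of the complement. -/
noncomputable def ncSumIrred (F F1 G : Finset α → R) (S : Finset α) (m b : α) : R :=
  ∑ E ∈ (NCE S).filter ((m, b) ∈ ·), pwm F F1 m E * pw G ((krE S E).erase (b, b))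

theorem disjoint_filter_lt_le (S : Finset α) (v : α) :
    Disjoint (S.filter (· < v)) (S.filter (v ≤ ·)) := by
  rw [Finset.disjoint_left]
  intro x
  simp only [Finset.mem_filter]
  grind

theorem pwm_union_glue (hmin : ∀ x ∈ S, m ≤ x) (hv : v ∈ S.erase m)
    (hQ : IsNCE ((S.filter (· < v)).erase m) Q) (hQ' : IsNCE (S.filter (v ≤ ·)) Q') :
    pwm F F1 m (Q ∪ glue m v Q') = pw F Q * pwm F (F1 ∘ insert m) v Q' := by
  have hv' := Finset.mem_erase.1 hv
  have hmv : m < v := lt_of_le_of_ne (hmin v hv'.2) hv'.1.symm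
  have hm' : m ∉ S.filter (v ≤ ·) := by simp [hmv]
  have hv'' : v ∈ S.filter (v ≤ ·) := by simp [hv'.2]
  have h1 := isEqv_glue hQ'.toIsEqv hm' hv''
  rw [hQ.toIsEqv.pwm_union h1 _ (by simp), hQ'.toIsEqv.pwm_glue hm' hv'']
  rw [Finset.disjoint_insert_right]
  exact ⟨by simp, Finset.disjoint_of_subset_left (Finset.erase_subset _ _)
    (disjoint_filter_lt_le S v)⟩

/-- Both the partition and its complement split at the second element `v` of the first block, so the
weights multiply. The points before `v`, with `m` alone among them, contribute `ncSumFirst`. The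
first term belongs to the partitions in which `m` is a singleton. -/
theorem ncSum_eq (hm : m ∈ S) (hmin : ∀ x ∈ S, m ≤ x) :
    ncSum F F1 G S m = F1 {m} * ncSumFirst F G G S m + ∑ v ∈ S.erase m,
      ncSumFirst F G G (S.filter (· < v)) m * ncSum F (F1 ∘ insert m) G (S.filter (v ≤ ·)) v := by
  rw [ncSum, sum_NCE_min hm hmin]
  congr 1
  · rw [ncSumFirst, Finset.mul_sum]
    refine Finset.sum_congr rfl fun Q hQ => ?_
    rw [(mem_NCE.1 hQ).pwm_insert (Finset.notMem_erase _ _), (isEqv_krE _ _).pwm_self hm, mul_assoc]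
  · refine Finset.sum_congr rfl fun v hv => ?_
    have hv' := Finset.mem_erase.1 hv
    have hmv : m < v := lt_of_le_of_ne (hmin v hv'.2) hv'.1.symm
    rw [ncSumFirst, ncSum, Finset.sum_mul_sum, ← Finset.sum_product']
    refine Finset.sum_congr rfl fun p hp => ?_
    rw [Finset.mem_product, mem_NCE, mem_NCE] at hp
    rw [krE_insert_union_glue hm hmin hv hp.1 hp.2, pwm_union_glue hmin hv hp.1 hp.2,
      (isEqv_krE _ _).pw_union (isEqv_krE _ _) (disjoint_filter_lt_le S v),
      (isEqv_krE _ _).pwm_self (by simp [hm, hmv])]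
    ring

theorem ncSumIrred_singleton (m : α) : ncSumIrred F F1 G {m} m m = F1 {m} := by
  have h1 : (NCE {m}).filter ((m, m) ∈ ·) = {{(m, m)}} := by
    ext E
    rw [Finset.mem_filter, mem_NCE, Finset.mem_singleton]
    constructor
    · rintro ⟨h, -⟩
      ext ⟨x, y⟩
      rw [Finset.mem_singleton, Prod.mk.injEq]
      constructor
      · intro h1
        simpa using h.mem h1
      · rintro ⟨rfl, rfl⟩
        exact h.refl (by simp)
    · rintro rfl
      refine ⟨{ isEqv_singleton m with nc := ?_ }, by simp⟩
      intro i j p q h1 h2 h3 h4 h5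
      simp only [Finset.mem_singleton, Prod.mk.injEq] at h4 h5
      order
  have h2 : (krE {m} {(m, m)}).erase (m, m) = ∅ := by
    ext ⟨x, y⟩
    simp only [Finset.mem_erase, mem_krE, Finset.mem_singleton]
    grind
  rw [ncSumIrred, h1, Finset.sum_singleton, pwm_singleton, h2]
  simp [pw, blocks]

/-- If the least and the largest point share a block, the last point of the complement is isolated:
a non-trivial interval ending at `b` contains `b` but not `m`. Its factor can therefore be split
off, as in `ncSumIrred`. -/
theorem erase_krE (hmb : (m, b) ∈ E) (hmin : ∀ x ∈ S, m ≤ x)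
    (hmax : ∀ x ∈ S, x ≤ b) : IsEqv (S.erase b) ((krE S E).erase (b, b)) := by
  refine (isEqv_krE S E).erase fun {x} hx => ?_
  rw [mem_krE] at hx
  have hxb := hmax x hx.1
  have := hx.2.2 _ _ hmb
  rw [Set.uIoc_of_le hxb, Set.mem_Ioc, Set.mem_Ioc] at this
  by_contra hne
  exact ((this.2 ⟨lt_of_le_of_ne hxb hne, le_rfl⟩).1).not_ge (hmin x hx.1)

theorem ncSumIrred_eq (hm : m ∈ S) (hmin : ∀ x ∈ S, m ≤ x) (hmax : ∀ x ∈ S, x ≤ b)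
    (hne : m ≠ b) : ncSumIrred F F1 G S m b = ∑ v ∈ S.erase m,
      ncSumFirst F G G (S.filter (· < v)) m *
        ncSumIrred F (F1 ∘ insert m) G (S.filter (v ≤ ·)) v b := by
  classical
  rw [ncSumIrred, Finset.sum_filter, sum_NCE_min hm hmin, Finset.sum_eq_zero, zero_add]
  · refine Finset.sum_congr rfl fun v hv => ?_
    have hv' := Finset.mem_erase.1 hv
    have hmv : m < v := lt_of_le_of_ne (hmin v hv'.2) hv'.1.symm
    rw [ncSumFirst, ncSumIrred, Finset.sum_filter, Finset.sum_mul_sum, ← Finset.sum_product']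
    refine Finset.sum_congr rfl fun p hp => ?_
    rw [Finset.mem_product, mem_NCE, mem_NCE] at hp
    have h1 : (m, b) ∈ p.1 ∪ glue m v p.2 ↔ (v, b) ∈ p.2 := by
      have h1 := @(hp.1).mem m b
      have h2 := @(hp.2).mem m b
      simp only [Finset.mem_union, mem_glue, Finset.mem_erase, Finset.mem_filter] at h1 h2 ⊢
      grind
    simp only [h1, mul_ite, mul_zero]
    split_ifs with h2
    · have h3 : (b, b) ∉ krE (S.filter (· < v)) (insert (m, m) p.1) := fun h3 => by
        have := (Finset.mem_filter.1 (mem_krE.1 h3).1).2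
        exact this.not_ge (hmax v hv'.2)
      rw [krE_insert_union_glue hm hmin hv hp.1 hp.2, pwm_union_glue hmin hv hp.1 hp.2,
        Finset.erase_union_distrib, Finset.erase_eq_of_notMem h3,
        (isEqv_krE _ _).pw_union (erase_krE h2
          (fun x hx => (Finset.mem_filter.1 hx).2) fun x hx => hmax x (Finset.mem_filter.1 hx).1)
          (Finset.disjoint_of_subset_right (Finset.erase_subset _ _) (disjoint_filter_lt_le S v)),
        (isEqv_krE _ _).pwm_self (by simp [hm, hmv])]
      ring
    · rfl
  · intro Q hQ
    refine if_neg fun h => ?_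
    rcases Finset.mem_insert.1 h with h | h
    · exact hne (Prod.mk.inj h).2.symm
    · exact absurd ((mem_NCE.1 hQ).mem h).1 (Finset.notMem_erase _ _)

theorem NCE_empty : NCE (∅ : Finset α) = {∅} := by
  ext E
  rw [mem_NCE, Finset.mem_singleton]
  constructor
  · intro h
    refine Finset.eq_empty_of_forall_notMem fun p hp => ?_
    simpa using (h.mem (x := p.1) (y := p.2) hp).1
  · rintro rfl
    constructor
    · constructor <;> simp
    · simp

theorem ncSumFirst_singleton (m : α) : ncSumFirst F G G1 {m} m = G1 {m} := by
  have h2 : krE {m} {(m, m)} = {(m, m)} := by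
    ext ⟨x, y⟩
    simp only [mem_krE, Finset.mem_singleton]
    grind
  rw [ncSumFirst, Finset.erase_singleton, NCE_empty, Finset.sum_singleton, insert_empty_eq, h2,
    pwm_singleton]
  simp [pw, blocks]

/-- The remaining points are cut at the last element `b` of the block of `m'`. The part up to `b` is
irreducible, and in the complement the class of `m` is that of `b` enlarged by `m`, which explains
`G1 ∘ insert m`. -/
theorem ncSumFirst_eq (hm : m ∈ S) (hmin : ∀ x ∈ S, m ≤ x) {m' : α} (hm' : m' ∈ S.erase m)
    (hmin' : ∀ x ∈ S.erase m, m' ≤ x) : ncSumFirst F G G1 S m = ∑ b ∈ S.erase m,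
      ncSumIrred F F G ((S.erase m).filter (· ≤ b)) m' b *
        ncSumFirst F G (G1 ∘ insert m) ((S.erase m).filter (b ≤ ·)) b := by
  rw [ncSumFirst, sum_NCE_component hm' hmin']
  refine Finset.sum_congr rfl fun b hb => ?_
  have hmb := hmin' b hb
  have hb' := Finset.mem_erase.1 hb
  rw [ncSumFirst, ncSumIrred, Finset.sum_mul_sum, ← Finset.sum_product']
  refine Finset.sum_congr rfl fun p hp => ?_
  rw [Finset.mem_product, Finset.mem_filter, mem_NCE, mem_NCE] at hp
  obtain ⟨⟨h1, h2⟩, h3⟩ := hp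
  have hd : Disjoint ((S.erase m).filter (· ≤ b)) (((S.erase m).filter (b ≤ ·)).erase b) := by
    rw [Finset.disjoint_left]
    intro x
    simp only [Finset.mem_filter, Finset.mem_erase]
    grind
  have hd' : Disjoint (((S.erase m).filter (· ≤ b)).erase b)
      (insert m ((S.erase m).filter (b ≤ ·))) := by
    rw [Finset.disjoint_left]
    intro x
    simp only [Finset.mem_filter, Finset.mem_erase, Finset.mem_insert]
    grind
  have hm1 : m ∉ (S.erase m).filter (b ≤ ·) := by simp
  have hb1 : b ∈ (S.erase m).filter (b ≤ ·) := by simp [hb'.1, hb'.2]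
  rw [h1.toIsEqv.pw_union h3.toIsEqv hd, krE_insert_union hm hmin hmin' hb h1 h2 h3,
    (erase_krE h2 (fun x hx => hmin' x (Finset.mem_filter.1 hx).1)
      fun x hx => (Finset.mem_filter.1 hx).2).pwm_union (isEqv_glue (isEqv_krE _ _) hm1 hb1) hd'
      (by simp), (isEqv_krE _ _).pwm_glue hm1 hb1, h1.pwm_self (by simp [Finset.mem_erase.1 hm', hmb])]
  ring

/-- Agreement of the weights is asked only on subsets of `S`, so that the weights of a word can be
exchanged for those of a prefix. -/
theorem ncSumFirst_congr (hF : ∀ V ⊆ S, F V = F' V) (hG : ∀ V ⊆ S, G V = G' V)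
    (hG1 : ∀ V ⊆ S, G1 V = G1' V) : ncSumFirst F G G1 S m = ncSumFirst F' G' G1' S m := by
  refine Finset.sum_congr rfl fun E hE => ?_
  rw [(mem_NCE.1 hE).pw_congr fun V hV => hF V (hV.trans (Finset.erase_subset _ _)),
    (isEqv_krE _ _).pwm_congr hG hG1]

theorem ncSumIrred_congr (hmin : ∀ x ∈ S, m ≤ x) (hmax : ∀ x ∈ S, x ≤ b)
    (hF : ∀ V ⊆ S, F V = F' V) (hF1 : ∀ V ⊆ S, F1 V = F1' V)
    (hG : ∀ V ⊆ S, G V = G' V) : ncSumIrred F F1 G S m b = ncSumIrred F' F1' G' S m b := by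
  refine Finset.sum_congr rfl fun E hE => ?_
  rw [Finset.mem_filter, mem_NCE] at hE
  rw [hE.1.pwm_congr hF hF1, (erase_krE hE.2 hmin hmax).pw_congr
    fun V hV => hG V (hV.trans (Finset.erase_subset _ _))]

end Weights

/-! ### Invariance of the sums under order embeddings. -/

section Transport

variable {α β : Type*} [LinearOrder α] [LinearOrder β]

/-- The image of a relation under an order embedding. -/
def mapRel (e : α ↪o β) (E : Finset (α × α)) : Finset (β × β) :=
  E.map (e.toEmbedding.prodMap e.toEmbedding)

theorem mem_mapRel {e : α ↪o β} {E : Finset (α × α)} {x y : β} :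
    (x, y) ∈ mapRel e E ↔ ∃ a b, (a, b) ∈ E ∧ e a = x ∧ e b = y := by
  simp [mapRel]

theorem map_mem_mapRel {e : α ↪o β} {E : Finset (α × α)} {a b : α} :
    (e a, e b) ∈ mapRel e E ↔ (a, b) ∈ E := by
  simp [mem_mapRel]

variable (e : α ↪o β) {S : Finset α} {E : Finset (α × α)} {m b : α}

theorem IsNCE.mapRel (h : IsNCE S E) : IsNCE (S.map e.toEmbedding) (mapRel e E) where
  mem := by
    intro x y hxy
    obtain ⟨a, b, h1, rfl, rfl⟩ := mem_mapRel.1 hxy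
    simpa using h.mem h1
  refl := by
    intro x hx
    obtain ⟨a, h1, rfl⟩ := Finset.mem_map.1 hx
    exact map_mem_mapRel.2 (h.refl h1)
  symm := by
    intro x y hxy
    obtain ⟨a, b, h1, rfl, rfl⟩ := mem_mapRel.1 hxy
    exact map_mem_mapRel.2 (h.symm h1)
  trans := by
    intro x y z hxy hyz
    obtain ⟨a, b, h1, rfl, rfl⟩ := mem_mapRel.1 hxy
    obtain ⟨b', c, h2, h3, rfl⟩ := mem_mapRel.1 hyz
    rw [e.injective h3] at h2
    exact map_mem_mapRel.2 (h.trans h1 h2)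
  nc := by
    intro i j p q h1 h2 h3 h4 h5
    obtain ⟨i, p, h6, rfl, rfl⟩ := mem_mapRel.1 h4
    obtain ⟨j, q, h7, rfl, rfl⟩ := mem_mapRel.1 h5
    exact map_mem_mapRel.2 (h.nc (e.lt_iff_lt.1 h1) (e.lt_iff_lt.1 h2) (e.lt_iff_lt.1 h3) h6 h7)

theorem sum_NCE_map {M : Type*} [AddCommMonoid M] (Φ : Finset (β × β) → M) :
    ∑ E ∈ NCE (S.map e.toEmbedding), Φ E = ∑ E ∈ NCE S, Φ (mapRel e E) := by
  classical
  have inv : ∀ E ∈ NCE (S.map e.toEmbedding),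
      mapRel e ((S ×ˢ S).filter fun p => (e p.1, e p.2) ∈ E) = E := by
    intro E hE
    ext ⟨x, y⟩
    simp only [mem_mapRel, Finset.mem_filter, Finset.mem_product]
    constructor
    · rintro ⟨a, b, h, rfl, rfl⟩
      exact h.2
    · intro h
      have := (mem_NCE.1 hE).mem h
      simp only [Finset.mem_map] at this
      obtain ⟨⟨a, ha, rfl⟩, ⟨b, hb, rfl⟩⟩ := this
      exact ⟨a, b, ⟨⟨ha, hb⟩, h⟩, rfl, rfl⟩
  refine Finset.sum_nbij' (fun E => (S ×ˢ S).filter fun p => (e p.1, e p.2) ∈ E) (mapRel e)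
    ?_ ?_ inv ?_ ?_
  · intro E hE
    rw [mem_NCE] at hE ⊢
    constructor
    · constructor
      · intro x y h
        simpa using (Finset.mem_filter.1 h).1
      · intro x h
        simpa [h] using hE.refl (Finset.mem_map_of_mem _ h)
      · intro x y
        simp only [Finset.mem_filter, Finset.mem_product]
        exact fun h => ⟨h.1.symm, hE.symm h.2⟩
      · intro x y z
        simp only [Finset.mem_filter, Finset.mem_product]
        exact fun h h' => ⟨⟨h.1.1, h'.1.2⟩, hE.trans h.2 h'.2⟩
    · intro i j p q h1 h2 h3
      simp only [Finset.mem_filter, Finset.mem_product]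
      exact fun h h' => ⟨⟨h.1.1, h'.1.1⟩, hE.nc (e.lt_iff_lt.2 h1) (e.lt_iff_lt.2 h2)
        (e.lt_iff_lt.2 h3) h.2 h'.2⟩
  · intro E hE
    exact mem_NCE.2 ((mem_NCE.1 hE).mapRel e)
  · intro E hE
    ext ⟨x, y⟩
    simp only [Finset.mem_filter, map_mem_mapRel, Finset.mem_product, and_iff_right_iff_imp]
    exact (mem_NCE.1 hE).mem
  · intro E hE
    rw [inv E hE]

theorem krE_map (E : Finset (α × α)) :
    krE (S.map e.toEmbedding) (mapRel e E) = mapRel e (krE S E) := by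
  have key : ∀ a b c : α, e c ∈ Set.uIoc (e a) (e b) ↔ c ∈ Set.uIoc a b := by
    intro a b c
    simp [Set.mem_uIoc]
  ext ⟨x, y⟩
  rw [mem_krE, mem_mapRel]
  constructor
  · rintro ⟨hx, hy, h⟩
    obtain ⟨a, ha, rfl⟩ := Finset.mem_map.1 hx
    obtain ⟨b, hb, rfl⟩ := Finset.mem_map.1 hy
    refine ⟨a, b, mem_krE.2 ⟨ha, hb, fun p q hpq => ?_⟩, rfl, rfl⟩
    rw [← key, ← key]
    exact h _ _ (map_mem_mapRel.2 hpq)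
  · rintro ⟨a, b, h, rfl, rfl⟩
    rw [mem_krE] at h
    refine ⟨Finset.mem_map_of_mem _ h.1, Finset.mem_map_of_mem _ h.2.1, fun p q hpq => ?_⟩
    obtain ⟨p, q, hpq', rfl, rfl⟩ := mem_mapRel.1 hpq
    rw [key, key]
    exact h.2.2 p q hpq'

theorem cl_map (E : Finset (α × α)) (x : α) :
    cl (mapRel e E) (e x) = (cl E x).map e.toEmbedding := by
  ext y
  simp [mem_cl, mem_mapRel]

theorem blocks_map (E : Finset (α × α)) : blocks (mapRel e E) =
    (blocks E).map ⟨Finset.map e.toEmbedding, Finset.map_injective _⟩ := by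
  ext V
  simp only [blocks, mapRel, Finset.mem_image, Finset.mem_map, Prod.exists]
  constructor
  · rintro ⟨_, _, ⟨a, b, h, h'⟩, rfl⟩
    obtain ⟨rfl, rfl⟩ := Prod.mk.inj h'
    exact ⟨_, ⟨a, b, h, rfl⟩, (cl_map e E a).symm⟩
  · rintro ⟨_, ⟨a, b, h, rfl⟩, rfl⟩
    exact ⟨e a, e b, ⟨a, b, h, rfl⟩, cl_map e E a⟩

variable {R : Type*} [CommRing R] (F F1 G G1 : Finset β → R)

theorem pw_map (E : Finset (α × α)) : pw F (mapRel e E) = pw (F ∘ Finset.map e.toEmbedding) E := by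
  rw [pw, blocks_map, Finset.prod_map]
  rfl

theorem pwm_map (E : Finset (α × α)) (m : α) : pwm F F1 (e m) (mapRel e E) =
    pwm (F ∘ Finset.map e.toEmbedding) (F1 ∘ Finset.map e.toEmbedding) m E := by
  rw [pwm, blocks_map, cl_map]
  have : (((blocks E).map ⟨Finset.map e.toEmbedding, Finset.map_injective _⟩).erase
      ((cl E m).map e.toEmbedding)) = ((blocks E).erase (cl E m)).map
        ⟨Finset.map e.toEmbedding, Finset.map_injective _⟩ :=
    (Finset.map_erase ⟨Finset.map e.toEmbedding, Finset.map_injective _⟩ _ _).symm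
  rw [this, Finset.prod_map]
  rfl

theorem ncSum_map : ncSum F F1 G (S.map e.toEmbedding) (e m) =
    ncSum (F ∘ Finset.map e.toEmbedding) (F1 ∘ Finset.map e.toEmbedding)
      (G ∘ Finset.map e.toEmbedding) S m := by
  simp only [ncSum, sum_NCE_map, krE_map, pw_map, pwm_map]

theorem ncSumFirst_map : ncSumFirst F G G1 (S.map e.toEmbedding) (e m) =
    ncSumFirst (F ∘ Finset.map e.toEmbedding) (G ∘ Finset.map e.toEmbedding)
      (G1 ∘ Finset.map e.toEmbedding) S m := by
  have h1 : (S.map e.toEmbedding).erase (e m) = (S.erase m).map e.toEmbedding :=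
    (Finset.map_erase e.toEmbedding S m).symm
  have h2 : ∀ Q : Finset (α × α), insert (e m, e m) (mapRel e Q) = mapRel e (insert (m, m) Q) :=
    fun Q => (Finset.map_insert (e.toEmbedding.prodMap e.toEmbedding) (m, m) Q).symm
  simp only [ncSumFirst, h1, sum_NCE_map, h2, krE_map, pw_map, pwm_map]

theorem ncSumIrred_map : ncSumIrred F F1 G (S.map e.toEmbedding) (e m) (e b) =
    ncSumIrred (F ∘ Finset.map e.toEmbedding) (F1 ∘ Finset.map e.toEmbedding)
      (G ∘ Finset.map e.toEmbedding) S m b := by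
  have h2 : ∀ Q : Finset (α × α), (mapRel e Q).erase (e b, e b) = mapRel e (Q.erase (b, b)) :=
    fun Q => (Finset.map_erase (e.toEmbedding.prodMap e.toEmbedding) Q (b, b)).symm
  simp only [ncSumIrred, Finset.sum_filter, sum_NCE_map, krE_map, h2, pw_map, pwm_map,
    map_mem_mapRel]

end Transport

/-! ### Partitions of `Fin n` as equivalence relations. -/

section Finpartition

variable {n : ℕ}

/-- The equivalence relation of a partition. -/
def relOf (π : Finpartition (Finset.univ : Finset (Fin n))) : Finset (Fin n × Fin n) :=
  Finset.univ.filter fun p => p.2 ∈ π.part p.1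

theorem mem_relOf {π : Finpartition (Finset.univ : Finset (Fin n))} {x y : Fin n} :
    (x, y) ∈ relOf π ↔ y ∈ π.part x := by
  simp [relOf]

theorem isEqv_relOf (π : Finpartition (Finset.univ : Finset (Fin n))) :
    IsEqv Finset.univ (relOf π) where
  mem _ := ⟨Finset.mem_univ _, Finset.mem_univ _⟩
  refl _ := mem_relOf.2 (π.mem_part (Finset.mem_univ _))
  symm h := by
    simp only [mem_relOf, π.mem_part_iff_part_eq_part (Finset.mem_univ _) (Finset.mem_univ _)] at h ⊢
    exact h.symm
  trans h h' := by
    simp only [mem_relOf, π.mem_part_iff_part_eq_part (Finset.mem_univ _) (Finset.mem_univ _)]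
      at h h' ⊢
    exact h'.trans h

theorem blocks_relOf (π : Finpartition (Finset.univ : Finset (Fin n))) :
    blocks (relOf π) = π.parts := by
  have h : ∀ x, cl (relOf π) x = π.part x := fun x => by ext y; rw [mem_cl, mem_relOf]
  ext V
  rw [(isEqv_relOf π).mem_blocks]
  constructor
  · rintro ⟨x, -, rfl⟩
    rw [h]
    exact π.part_mem.2 (Finset.mem_univ x)
  · intro hV
    obtain ⟨x, hx⟩ := π.nonempty_of_mem_parts hV
    exact ⟨x, Finset.mem_univ x, (h x).trans (π.part_eq_of_mem hV hx)⟩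

theorem isNCE_relOf_iff (π : Finpartition (Finset.univ : Finset (Fin n))) :
    IsNCE Finset.univ (relOf π) ↔ IsNonCrossing π := by
  constructor
  · intro h V hV W hW i j p q hij hjp hpq hi hp hj hq
    have := h.nc hij hjp hpq (mem_relOf.2 (by rwa [π.part_eq_of_mem hV hi]))
      (mem_relOf.2 (by rwa [π.part_eq_of_mem hW hj]))
    rw [mem_relOf, π.part_eq_of_mem hV hi] at this
    exact π.eq_of_mem_parts hV hW this hj
  · intro h
    refine { isEqv_relOf π with nc := ?_ }
    intro i j p q hij hjp hpq h1 h2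
    rw [mem_relOf] at h1 h2 ⊢
    have := h _ (π.part_mem.2 (Finset.mem_univ i)) _ (π.part_mem.2 (Finset.mem_univ j)) i j p q
      hij hjp hpq (π.mem_part (Finset.mem_univ i)) h1 (π.mem_part (Finset.mem_univ j)) h2
    rw [this]
    exact π.mem_part (Finset.mem_univ j)

theorem mem_NC {π : Finpartition (Finset.univ : Finset (Fin n))} :
    π ∈ NC n ↔ IsNonCrossing π := by
  simp [NC]

open Classical in
theorem krE_relOf (π : Finpartition (Finset.univ : Finset (Fin n))) :
    krE Finset.univ (relOf π) = relOf (kreweras π) := by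
  ext ⟨x, y⟩
  rw [mem_krE, mem_relOf, kreweras, Finpartition.mem_part_ofSetoid_iff_rel]
  simp only [Finset.mem_univ, true_and]
  constructor
  · intro h V hV p hp q hq
    exact h p q (mem_relOf.2 (by rwa [π.part_eq_of_mem hV hp]))
  · intro h p q hpq
    exact h _ (π.part_mem.2 (Finset.mem_univ p)) p (π.mem_part (Finset.mem_univ p)) q
      (mem_relOf.1 hpq)

theorem relOf_injective : Function.Injective (relOf (n := n)) := fun π σ h =>
  Finpartition.ext (by rw [← blocks_relOf, h, blocks_relOf])

theorem exists_relOf_eq {E : Finset (Fin n × Fin n)} (h : IsEqv Finset.univ E) :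
    ∃ π, relOf π = E := by
  classical
  refine ⟨Finpartition.ofSetoid ⟨fun x y => (x, y) ∈ E, ⟨fun x => h.refl (Finset.mem_univ x),
    h.symm, h.trans⟩⟩, ?_⟩
  ext ⟨x, y⟩
  rw [mem_relOf, Finpartition.mem_part_ofSetoid_iff_rel]
  rfl

theorem sum_NC {M : Type*} [AddCommMonoid M] (Φ : Finset (Fin n × Fin n) → M) :
    ∑ π ∈ NC n, Φ (relOf π) = ∑ E ∈ NCE (Finset.univ : Finset (Fin n)), Φ E := by
  refine Finset.sum_bij (fun π _ => relOf π) ?_ ?_ ?_ ?_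
  · intro π hπ
    rw [mem_NCE, isNCE_relOf_iff]
    exact mem_NC.1 hπ
  · exact fun π _ σ _ h => relOf_injective h
  · intro E hE
    rw [mem_NCE] at hE
    obtain ⟨π, rfl⟩ := exists_relOf_eq hE.toIsEqv
    exact ⟨π, mem_NC.2 ((isNCE_relOf_iff π).1 hE), rfl⟩
  · exact fun _ _ => rfl

end Finpartition

/-! ### Subwords at sets of natural numbers, where prefixes and suffixes need no change of index
type. -/

section Words

variable {α : Type*}

/-- The subword of `l` at the positions in `V`. -/
def pick (l : List α) (V : Finset ℕ) : List α := V.sort.filterMap fun i => l[i]?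

theorem subword_eq_pick (l : List α) (V : Finset (Fin l.length)) :
    subword l V = pick l (V.map (Fin.valOrderEmb l.length).toEmbedding) := by
  rw [subword, pick, ← Finset.map_sort (Fin.valOrderEmb l.length).toEmbedding V (· ≤ ·) (· ≤ ·)
    (fun _ _ _ _ => Iff.rfl), List.filterMap_map, ← List.filterMap_eq_map]
  refine List.filterMap_congr fun i _ => ?_
  simp

/-- Translation of `ℕ`. -/
def addEmb (k : ℕ) : ℕ ↪o ℕ := OrderEmbedding.ofStrictMono (· + k) fun _ _ h => by simpa using h

@[simp] theorem addEmb_apply (k i : ℕ) : addEmb k i = i + k := rfl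

theorem pick_map_addEmb (l : List α) (k : ℕ) (V : Finset ℕ) :
    pick l (V.map (addEmb k).toEmbedding) = pick (l.drop k) V := by
  rw [pick, ← Finset.map_sort (addEmb k).toEmbedding V (· ≤ ·) (· ≤ ·)
    (fun a _ b _ => by simp), List.filterMap_map, pick]
  refine List.filterMap_congr fun i _ => ?_
  simp [add_comm]

theorem pick_take (l : List α) {k : ℕ} {V : Finset ℕ} (hV : V ⊆ Finset.range k) :
    pick (l.take k) V = pick l V := by
  refine List.filterMap_congr fun i hi => ?_
  rw [Finset.mem_sort] at hi
  rw [List.getElem?_take, if_pos (Finset.mem_range.1 (hV hi))]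

theorem pick_insert_zero (i : α) (w : List α) {V : Finset ℕ} (hV : 0 ∉ V) :
    pick (i :: w) (insert 0 V) = i :: pick (i :: w) V := by
  rw [pick, Finset.sort_insert _ (fun b _ => Nat.zero_le b) hV]
  simp [pick]

theorem pick_singleton_zero (i : α) (w : List α) : pick (i :: w) {0} = [i] := by
  simp [pick]

end Words

/-! ### The recursions on words, and their solution by power series. -/

section WordSums

variable {R α : Type*} [CommRing R]

theorem range_erase_zero (n : ℕ) : (Finset.range (n + 1)).erase 0 =
    (Finset.range n).map (addEmb 1).toEmbedding := by
  ext x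
  simp only [Finset.mem_erase, Finset.mem_range, Finset.mem_map, RelEmbedding.coe_toEmbedding,
    addEmb_apply]
  exact ⟨fun h => ⟨x - 1, by omega, by omega⟩, by rintro ⟨a, h, rfl⟩; omega⟩

theorem range_filter_le (n v : ℕ) : (Finset.range (n + 1)).filter (v + 1 ≤ ·) =
    (Finset.range (n - v)).map (addEmb (v + 1)).toEmbedding := by
  ext x
  simp only [Finset.mem_filter, Finset.mem_range, Finset.mem_map, RelEmbedding.coe_toEmbedding,
    addEmb_apply]
  exact ⟨fun h => ⟨x - (v + 1), by omega, by omega⟩, by rintro ⟨a, h, rfl⟩; omega⟩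

theorem range_filter_lt {n v : ℕ} (hv : v < n) : (Finset.range (n + 1)).filter (· < v + 1) =
    Finset.range (v + 1) := by
  ext x
  simp only [Finset.mem_filter, Finset.mem_range]
  omega

namespace WordSeries

/-- The sum `ncSum` for the positions of a word. -/
noncomputable def wordSum (f f1 g : WordSeries R α) (l : List α) : R :=
  ncSum (fun V => f (pick l V)) (fun V => f1 (pick l V)) (fun V => g (pick l V))
    (Finset.range l.length) 0

/-- The sum `ncSumFirst` for the positions of a word. -/
noncomputable def wordSumFirst (f g g1 : WordSeries R α) (l : List α) : R :=
  ncSumFirst (fun V => f (pick l V)) (fun V => g (pick l V)) (fun V => g1 (pick l V))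
    (Finset.range l.length) 0

/-- The sum `ncSumIrred` for the positions of a word. -/
noncomputable def wordSumIrred (f f1 g : WordSeries R α) (l : List α) : R :=
  ncSumIrred (fun V => f (pick l V)) (fun V => f1 (pick l V)) (fun V => g (pick l V))
    (Finset.range l.length) 0 (l.length - 1)

variable (f f1 g g1 : WordSeries R α)

/-- In terms of words, gluing the first position to a class amounts to taking the left derivative of
the weight. -/
theorem apply_pick_insert_map (i : α) (w : List α) (v : ℕ) (V : Finset ℕ) :
    f (pick (i :: w) (insert 0 (V.map (addEmb (v + 1)).toEmbedding))) =
      dl i f (pick (w.drop v) V) := by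
  rw [pick_insert_zero, pick_map_addEmb]
  · rfl
  · simp

theorem ncSumFirst_prefix (i : α) (w : List α) {v : ℕ} (hv : v < w.length) :
    ncSumFirst (fun V => f (pick (i :: w) V)) (fun V => g (pick (i :: w) V))
      (fun V => g1 (pick (i :: w) V)) ((Finset.range (i :: w).length).filter (· < v + 1)) 0 =
      wordSumFirst f g g1 (i :: w.take v) := by
  have h : ∀ V ⊆ Finset.range (v + 1), pick (i :: w) V = pick (i :: w.take v) V := fun V hV => by
    rw [← pick_take _ hV, List.take_succ_cons]
  rw [List.length_cons, range_filter_lt hv, wordSumFirst]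
  have h1 : (i :: w.take v).length = v + 1 := by simp [hv.le]
  rw [h1]
  exact ncSumFirst_congr (fun V hV => by rw [h V hV]) (fun V hV => by rw [h V hV])
    fun V hV => by rw [h V hV]

theorem length_drop_eq (w : List α) (v : ℕ) : (w.drop v).length = w.length - v := by simp

/-- The index `v` is a position in `w`, so the next element of the first block sits at position `v +
1` of `i :: w`. The left piece is then `i` followed by the first `v` letters of `w`. -/
theorem wordSum_cons (i : α) (w : List α) : wordSum f f1 g (i :: w) =
    f1 [i] * wordSumFirst f g g (i :: w) + ∑ v ∈ Finset.range w.length,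
      wordSumFirst f g g (i :: w.take v) * wordSum f (dl i f1) g (w.drop v) := by
  rw [wordSum, ncSum_eq (by simp) (by simp), pick_singleton_zero]
  congr 1
  rw [List.length_cons, range_erase_zero, Finset.sum_map]
  refine Finset.sum_congr rfl fun v hv => ?_
  rw [RelEmbedding.coe_toEmbedding, addEmb_apply, ← List.length_cons (a := i),
    ncSumFirst_prefix _ _ _ _ _ (Finset.mem_range.1 hv), List.length_cons, range_filter_le]
  congr 1
  have := ncSum_map (addEmb (v + 1)) (S := Finset.range (w.length - v)) (m := 0)
    (fun V => f (pick (i :: w) V)) ((fun V => f1 (pick (i :: w) V)) ∘ insert 0)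
    (fun V => g (pick (i :: w) V))
  rw [addEmb_apply, zero_add] at this
  rw [this, wordSum, length_drop_eq]
  congr 1 <;> funext V <;>
    simp only [Function.comp_apply, pick_map_addEmb, List.drop_succ_cons, apply_pick_insert_map]

theorem wordSumFirst_singleton (i : α) : wordSumFirst f g g1 [i] = g1 [i] := by
  rw [wordSumFirst]
  have : Finset.range [i].length = {0} := rfl
  rw [this, ncSumFirst_singleton, pick_singleton_zero]

theorem wordSumIrred_singleton (i : α) : wordSumIrred f f1 g [i] = f1 [i] := by
  rw [wordSumIrred]
  have : Finset.range [i].length = {0} := rfl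
  rw [this, List.length_singleton, Nat.sub_self, ncSumIrred_singleton, pick_singleton_zero]

theorem wordSumIrred_cons (i : α) {w : List α} (hw : w ≠ []) : wordSumIrred f f1 g (i :: w) =
    ∑ v ∈ Finset.range w.length,
      wordSumFirst f g g (i :: w.take v) * wordSumIrred f (dl i f1) g (w.drop v) := by
  have hl := List.length_pos_of_ne_nil hw
  rw [wordSumIrred, ncSumIrred_eq (by simp) (by simp) (by simp) (by simpa using hl.ne)]
  rw [List.length_cons, range_erase_zero, Finset.sum_map]
  refine Finset.sum_congr rfl fun v hv => ?_
  have hv' := Finset.mem_range.1 hv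
  rw [RelEmbedding.coe_toEmbedding, addEmb_apply, ← List.length_cons (a := i),
    ncSumFirst_prefix _ _ _ _ _ (Finset.mem_range.1 hv), List.length_cons, range_filter_le]
  congr 1
  have := ncSumIrred_map (addEmb (v + 1)) (S := Finset.range (w.length - v)) (m := 0)
    (b := w.length - v - 1) (fun V => f (pick (i :: w) V))
    ((fun V => f1 (pick (i :: w) V)) ∘ insert 0) (fun V => g (pick (i :: w) V))
  rw [addEmb_apply, zero_add, addEmb_apply,
    show w.length - v - 1 + (v + 1) = w.length + 1 - 1 by omega] at this
  rw [this, wordSumIrred, length_drop_eq]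
  congr 1 <;> funext V <;>
    simp only [Function.comp_apply, pick_map_addEmb, List.drop_succ_cons, apply_pick_insert_map]

theorem wordSumFirst_cons (i : α) {w : List α} (hw : w ≠ []) : wordSumFirst f g g1 (i :: w) =
    ∑ p ∈ Finset.range w.length,
      wordSumIrred f f g (w.take (p + 1)) * wordSumFirst f g (dl i g1) (w.drop p) := by
  have hl := List.length_pos_of_ne_nil hw
  rw [wordSumFirst, ncSumFirst_eq (m' := 1) (by simp) (by simp) (by simp [hl])
    (by simp; omega)]
  rw [List.length_cons, range_erase_zero, Finset.sum_map]
  refine Finset.sum_congr rfl fun p hp => ?_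
  have hp' := Finset.mem_range.1 hp
  rw [RelEmbedding.coe_toEmbedding, addEmb_apply]
  have h1 : ((Finset.range w.length).map (addEmb 1).toEmbedding).filter (· ≤ p + 1) =
      (Finset.range (p + 1)).map (addEmb 1).toEmbedding := by
    ext x
    simp only [Finset.mem_filter, Finset.mem_range, Finset.mem_map, RelEmbedding.coe_toEmbedding,
      addEmb_apply]
    exact ⟨by rintro ⟨⟨a, h, rfl⟩, h'⟩; exact ⟨a, by omega, rfl⟩,
      by rintro ⟨a, h, rfl⟩; exact ⟨⟨a, by omega, rfl⟩, by omega⟩⟩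
  have h2 : ((Finset.range w.length).map (addEmb 1).toEmbedding).filter (p + 1 ≤ ·) =
      (Finset.range (w.length - p)).map (addEmb (p + 1)).toEmbedding := by
    rw [← range_erase_zero, ← range_filter_le]
    ext x
    simp only [Finset.mem_filter, Finset.mem_erase]
    constructor
    · exact fun h => ⟨h.1.2, h.2⟩
    · exact fun h => ⟨⟨by omega, h.1⟩, h.2⟩
  rw [h1, h2]
  congr 1
  · have := ncSumIrred_map (addEmb 1) (S := Finset.range (p + 1)) (m := 0)
      (b := p) (fun V => f (pick (i :: w) V)) (fun V => f (pick (i :: w) V))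
      (fun V => g (pick (i :: w) V))
    rw [addEmb_apply, zero_add, addEmb_apply] at this
    have h3 : (w.take (p + 1)).length = p + 1 := by simp; omega
    rw [this, wordSumIrred, h3, Nat.add_sub_cancel]
    have h : ∀ V ⊆ Finset.range (p + 1), pick (i :: w) (V.map (addEmb 1).toEmbedding) =
        pick (w.take (p + 1)) V := fun V hV => by
      rw [pick_map_addEmb, pick_take _ hV]
      rfl
    exact ncSumIrred_congr (by simp) (fun x hx => Nat.lt_succ_iff.1 (Finset.mem_range.1 hx))
      (fun V hV => by simp [h V hV])
      (fun V hV => by simp [h V hV]) (fun V hV => by simp [h V hV])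
  · have := ncSumFirst_map (addEmb (p + 1)) (S := Finset.range (w.length - p)) (m := 0)
      (fun V => f (pick (i :: w) V)) (fun V => g (pick (i :: w) V))
      ((fun V => g1 (pick (i :: w) V)) ∘ insert 0)
    rw [addEmb_apply, zero_add] at this
    rw [this, wordSumFirst, length_drop_eq]
    congr 1 <;> funext V <;>
      simp only [Function.comp_apply, pick_map_addEmb, List.drop_succ_cons, apply_pick_insert_map]

variable [Fintype α]

/-- A product with a variable in the middle sums over the marked letters of `w`. In
`wordSumFirst_cons` the prefix of length `p + 1` and the suffix from `p` share exactly one letter,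
and this letter becomes the marked one. -/
theorem sum_mul_var_mul_apply (A U : α → WordSeries R α) (w : List α) (Φ : ℕ → R)
    (h : ∀ u j v, w = u ++ j :: v → Φ u.length = A j u * U j v) :
    (∑ j, A j * var j * U j : WordSeries R α) w = ∑ p ∈ Finset.range w.length, Φ p := by
  classical
  rw [sum_apply]
  simp only [mul_assoc, mul_apply (A _) _]
  rw [Finset.sum_comm, Finset.sum_range_succ]
  rw [show ∑ j, A j (w.take w.length) * (var j * U j : WordSeries R α) (w.drop w.length) = 0 from
    Finset.sum_eq_zero fun j _ => by rw [List.drop_length, mul_nil, var_nil]; ring, add_zero]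
  refine Finset.sum_congr rfl fun p hp => ?_
  have hp' := Finset.mem_range.1 hp
  have h1 : w.drop p = w[p] :: w.drop (p + 1) := List.drop_eq_getElem_cons hp'
  have h2 : w = w.take p ++ w[p] :: w.drop (p + 1) := by rw [← h1, List.take_append_drop]
  have h3 := h _ _ _ h2
  rw [List.length_take, min_eq_left hp'.le] at h3
  rw [h3, Finset.sum_eq_single w[p], h1, var_mul_cons_self]
  · intro j _ hj
    rw [h1, var_mul_cons_of_ne hj.symm, mul_zero]
  · simp

/-- The boxed convolution is given by the solution of its system of equations. -/
theorem exists_isBoxedSystem : ∃ x y, IsBoxedSystem f g var x y ∧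
    ∀ l ≠ [], wordSum f f g l = subst y f l := by
  -- The candidates are the two partial sums with one letter removed: the first letter for sums
  -- whose first point is alone, the last letter for irreducible sums.
  set Y : α → WordSeries R α := fun i w => wordSumFirst f g g (i :: w) with hY
  set X : α → WordSeries R α := fun j u => wordSumIrred f f g (u ++ [j]) with hX
  set y : α → WordSeries R α := fun i => var i * Y i with hy'
  set x : α → WordSeries R α := fun j => X j * var j with hx'
  have hx : ∀ j, x j [] = 0 := fun j => mul_var_nil j _
  have hy : ∀ i, y i [] = 0 := fun i => by
    change (var i * Y i : WordSeries R α) [] = 0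
    rw [mul_nil, var_nil, zero_mul]
  have hyc : ∀ (i : α) (w : List α) (h : WordSeries R α),
      subst y h (i :: w) = (Y i * subst y (dl i h)) w := by
    intro i w h
    have : dl i (subst y h) = Y i * subst y (dl i h) := by
      rw [subst_eq hy, map_add, map_smul, dl_one, smul_zero, zero_add]
      simp only [hy', mul_assoc, dl_sum_var_mul]
    rw [← this, dl_apply]
  -- Here `X`, and in `irred` below `Y`, enters only through its defining sums, so the two
  -- inductions are independent. The weight of the distinguished class stays arbitrary because each
  -- recursion replaces it by its left derivative.
  have first : ∀ (n : ℕ) (w : List α), w.length ≤ n → ∀ (i : α) (g1 : WordSeries R α),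
      wordSumFirst f g g1 (i :: w) = subst x (dl i g1) w := by
    intro n
    induction n with
    | zero =>
      intro w hw i g1
      rw [List.length_eq_zero_iff.1 (Nat.le_zero.1 hw), wordSumFirst_singleton, subst_nil hx]
      rfl
    | succ n ih =>
      intro w hw i g1
      rcases eq_or_ne w [] with rfl | hw0
      · rw [wordSumFirst_singleton, subst_nil hx]
        rfl
      rw [wordSumFirst_cons _ _ _ _ hw0, subst_eq hx, add_apply, smul_apply]
      rw [show (1 : WordSeries R α) w = 0 by cases w; exact absurd rfl hw0; rfl, mul_zero, zero_add]
      rw [sum_mul_var_mul_apply]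
      rintro u j v rfl
      have : v.length ≤ n := by simp at hw; omega
      rw [← ih v this]
      simp only [hX]
      congr 2
      · simp [List.take_append]
      · simp
  have irred : ∀ (n : ℕ) (u : List α), u.length ≤ n → ∀ (j : α) (f1 : WordSeries R α),
      wordSumIrred f f1 g (u ++ [j]) = subst y (dr j f1) u := by
    intro n
    induction n with
    | zero =>
      intro u hu j f1
      rw [List.length_eq_zero_iff.1 (Nat.le_zero.1 hu), List.nil_append, wordSumIrred_singleton,
        subst_nil hy]
      rfl
    | succ n ih =>
      intro u hu j f1
      cases u with
      | nil =>
        rw [List.nil_append, wordSumIrred_singleton, subst_nil hy]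
        rfl
      | cons i u =>
        have hu' : u.length ≤ n := by simpa using hu
        rw [List.cons_append, wordSumIrred_cons _ _ _ _ (by simp), hyc, mul_apply,
          List.length_append, List.length_singleton]
        refine Finset.sum_congr rfl fun v hv => ?_
        have hv' : v ≤ u.length := Nat.lt_succ_iff.1 (Finset.mem_range.1 hv)
        rw [List.take_append_of_le_length hv', List.drop_append_of_le_length hv',
          ih _ (by simp; omega), dl_dr]
  have full : ∀ (n : ℕ) (w : List α), w.length ≤ n → ∀ (i : α) (f1 : WordSeries R α),
      wordSum f f1 g (i :: w) = subst y f1 (i :: w) := by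
    intro n
    induction n with
    | zero =>
      intro w hw i f1
      rw [List.length_eq_zero_iff.1 (Nat.le_zero.1 hw), wordSum_cons, hyc, mul_nil, subst_nil hy]
      simp [hY, mul_comm]
    | succ n ih =>
      intro w hw i f1
      -- The last term of the Cauchy product, with empty suffix, matches the partitions in which the
      -- first point is alone.
      rw [wordSum_cons, hyc, mul_apply, Finset.sum_range_succ, add_comm, List.take_length,
        List.drop_length, subst_nil hy, mul_comm (f1 [i])]
      congr 1
      refine Finset.sum_congr rfl fun v hv => ?_
      have hv' := Finset.mem_range.1 hv
      have h1 : w.drop v = w[v] :: w.drop (v + 1) := List.drop_eq_getElem_cons hv'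
      rw [h1, ih _ (by simp; omega)]
  refine ⟨x, y, ⟨fun j => ?_, fun i => ?_⟩, ?_⟩
  · have : X j = subst y (dr j f) := WordSeries.ext fun u => irred _ u le_rfl j f
    rw [← this]
  · have : Y i = subst x (dl i g) := WordSeries.ext fun w => first _ w le_rfl i g
    rw [← this]
  · intro l hl
    cases l with
    | nil => exact absurd rfl hl
    | cons i w => exact full _ w le_rfl i f

end WordSeries

end WordSums

/-! ### From sums over `Finpartition` to sums over words, and the one-block partition. -/

section Bridge

variable {R α : Type*} [CommRing R]

open WordSeries

theorem range_eq_map_univ (n : ℕ) :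
    Finset.range n = (Finset.univ : Finset (Fin n)).map (Fin.valOrderEmb n).toEmbedding := by
  ext x
  simp only [Finset.mem_range, Finset.mem_map, Finset.mem_univ, true_and,
    RelEmbedding.coe_toEmbedding, Fin.valOrderEmb_apply]
  exact ⟨fun h => ⟨⟨x, h⟩, rfl⟩, by rintro ⟨a, rfl⟩; exact a.2⟩

theorem sum_NC_subword (f g : WordSeries R α) {l : List α} (hl : l ≠ []) :
    ∑ π ∈ NC l.length, (∏ V ∈ π.parts, f (subword l V)) *
      ∏ V ∈ (kreweras π).parts, g (subword l V) = wordSum f f g l := by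
  have h0 : 0 ∈ Finset.range l.length := by simpa using List.length_pos_of_ne_nil hl
  have h1 : wordSum f f g l = ∑ E ∈ NCE (Finset.range l.length),
      pw (fun V => f (pick l V)) E * pw (fun V => g (pick l V)) (krE (Finset.range l.length) E) :=
    Finset.sum_congr rfl fun E hE => by rw [(mem_NCE.1 hE).toIsEqv.pwm_self h0]
  rw [h1, range_eq_map_univ, sum_NCE_map, ← sum_NC]
  refine Finset.sum_congr rfl fun π _ => ?_
  rw [krE_map, pw_map, pw_map, krE_relOf, pw, pw, blocks_relOf, blocks_relOf]
  simp only [Function.comp_apply, ← subword_eq_pick]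

theorem subword_univ (w : List α) : subword w Finset.univ = w := by
  rw [subword, show (Finset.univ : Finset (Fin w.length)).sort (· ≤ ·) = List.finRange w.length by
    simpa using Fin.sort_univ w.length]
  exact List.map_get_finRange w

/-- The one-block partition is the only partition with at most one block. -/
theorem exists_oneBlock {n : ℕ} (hn : n ≠ 0) :
    ∃ π₀ : Finpartition (Finset.univ : Finset (Fin n)), π₀.parts = {Finset.univ} ∧ π₀ ∈ NC n ∧
      ∀ π, ¬ 1 < π.parts.card → π = π₀ := by
  have hne : (Finset.univ : Finset (Fin n)) ≠ ⊥ := by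
    have : NeZero n := ⟨hn⟩
    exact Finset.univ_nonempty.ne_empty
  refine ⟨Finpartition.indiscrete hne, rfl, mem_NC.2 ?_, fun π hπ => ?_⟩
  · intro V hV W hW _ _ _ _ _ _ _ _ _ _ _
    rw [Finset.mem_singleton.1 hV, Finset.mem_singleton.1 hW]
  · refine Finpartition.ext ?_
    have h1 : π.parts.card ≤ 1 := not_lt.1 hπ
    have h2 := π.parts_nonempty hne
    obtain ⟨V, hV⟩ := h2
    have h3 : π.parts = {V} := Finset.eq_singleton_iff_unique_mem.2
      ⟨hV, fun W hW => Finset.card_le_one.1 h1 W hW V hV⟩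
    have h4 := π.sup_parts
    rw [h3, Finset.sup_singleton, id] at h4
    rw [h3, h4]
    rfl

theorem sum_NC_eq_add {M : Type*} [AddCommMonoid M] {n : ℕ}
    {π₀ : Finpartition (Finset.univ : Finset (Fin n))} (h₀ : π₀.parts = {Finset.univ})
    (h₁ : π₀ ∈ NC n) (h₂ : ∀ π, ¬ 1 < π.parts.card → π = π₀)
    (Φ : Finpartition (Finset.univ : Finset (Fin n)) → M) :
    ∑ π ∈ NC n, Φ π = Φ π₀ + ∑ π ∈ (NC n).filter (1 < ·.parts.card), Φ π := by
  rw [← Finset.sum_filter_not_add_sum_filter _ (1 < ·.parts.card)]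
  congr 1
  rw [Finset.sum_eq_single_of_mem π₀]
  · simp [h₀, h₁]
  · exact fun π hπ hne => absurd (h₂ π (Finset.mem_filter.1 hπ).2) hne

/-- For `x ≠ y` the half-open interval between them contains exactly one of `x` and `y`, so it is
not a union of blocks when there is only one block. -/
theorem kreweras_eq_bot {n : ℕ} {π₀ : Finpartition (Finset.univ : Finset (Fin n))}
    (h₀ : π₀.parts = {Finset.univ}) : kreweras π₀ = ⊥ := by
  apply relOf_injective
  rw [← krE_relOf]
  ext ⟨x, y⟩
  have h1 : ∀ x, π₀.part x = Finset.univ := fun x => by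
    simpa [h₀] using π₀.part_mem.2 (Finset.mem_univ x)
  have h2 : ∀ x : Fin n, (⊥ : Finpartition (Finset.univ : Finset (Fin n))).part x = {x} :=
    fun x => Finpartition.part_eq_of_mem _ (by simp) (by simp)
  rw [mem_krE, mem_relOf, h2, Finset.mem_singleton]
  simp only [Finset.mem_univ, true_and, mem_relOf, h1, forall_const]
  constructor
  · intro h
    by_contra hne
    have h3 := h x y
    simp only [Set.mem_uIoc] at h3
    grind
  · rintro rfl
    simp

end Bridge

/-! ### The group structure of the boxed convolution. -/

namespace NCSeries

open WordSeries

section Ring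

variable {R : Type*} [CommRing R] {s : ℕ}

/-- The underlying word series. -/
def toWordSeries (f : NCSeries R s) : WordSeries R (Fin s) := f.1

theorem toWordSeries_nil (f : NCSeries R s) : f.toWordSeries [] = 0 := f.2

theorem toWordSeries_injective :
    Function.Injective (toWordSeries : NCSeries R s → WordSeries R (Fin s)) :=
  Subtype.val_injective

theorem coeff_eq (f : NCSeries R s) (w : List (Fin s)) : f.coeff w = f.toWordSeries w := rfl

theorem exists_isBoxedSystem_mul (f g : NCSeries R s) : ∃ x y,
    IsBoxedSystem f.toWordSeries g.toWordSeries var x y ∧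
      (f * g).toWordSeries = subst y f.toWordSeries := by
  obtain ⟨x, y, h, h'⟩ := exists_isBoxedSystem f.toWordSeries g.toWordSeries
  refine ⟨x, y, h, WordSeries.ext fun w => ?_⟩
  rcases eq_or_ne w [] with rfl | hw
  · rw [subst_nil (h.right_nil var_nil), toWordSeries_nil, toWordSeries_nil]
  · rw [← h' w hw, ← coeff_eq, coeff_mul f g hw]
    exact sum_NC_subword f.1 g.1 hw

theorem mul_eq_subst {f g : NCSeries R s} {x y : Fin s → WordSeries R (Fin s)}
    (h : IsBoxedSystem f.toWordSeries g.toWordSeries var x y) :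
    (f * g).toWordSeries = subst y f.toWordSeries := by
  obtain ⟨x', y', h1, h2⟩ := exists_isBoxedSystem_mul f g
  rw [(h.unique h1 var_nil).2, h2]

/-- By `IsBoxedSystem.assoc` the system of `f` and `g * e` is solved by the composite of `y` with
`Y`. Both bracketings are therefore `f` evaluated at this composite. -/
theorem boxed_assoc (f g e : NCSeries R s) : f * g * e = f * (g * e) := by
  obtain ⟨x, y, h1, h2⟩ := exists_isBoxedSystem_mul f g
  obtain ⟨X, Y, h3, h4⟩ := exists_isBoxedSystem_mul (f * g) e
  obtain ⟨u, v, h5, h6⟩ := exists_isBoxedSystem_mul g e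
  apply toWordSeries_injective
  rw [h2] at h3
  have h7 := h1.assoc (toWordSeries_nil f) (toWordSeries_nil g) h3 h5
  rw [← h6] at h7
  rw [mul_eq_subst h7, h4, h2, subst_subst (h1.right_nil var_nil) (h3.right_nil var_nil)]

theorem dl_one_toWordSeries (i : Fin s) : dl i (1 : NCSeries R s).toWordSeries = 1 := by
  ext w
  change (if (i :: w).length = 1 then (1 : R) else 0) = _
  cases w <;> simp

theorem dr_one_toWordSeries (i : Fin s) : dr i (1 : NCSeries R s).toWordSeries = 1 := by
  ext w
  change (if (w ++ [i]).length = 1 then (1 : R) else 0) = _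
  cases w <;> simp

theorem boxed_mul_one (f : NCSeries R s) : f * 1 = f := by
  obtain ⟨x, y, h1, h2⟩ := exists_isBoxedSystem_mul f 1
  apply toWordSeries_injective
  have : y = var := funext fun i => by
    rw [h1.right i, dl_one_toWordSeries, subst_one (h1.left_nil var_nil), mul_one]
  rw [h2, this, subst_var_eq_self]

theorem boxed_one_mul (f : NCSeries R s) : 1 * f = f := by
  obtain ⟨x, y, h1, h2⟩ := exists_isBoxedSystem_mul 1 f
  apply toWordSeries_injective
  have : x = var := funext fun i => by
    rw [h1.left i, dr_one_toWordSeries, subst_one (h1.right_nil var_nil), one_mul]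
  rw [h2, h1.subst_eq_subst var_nil (toWordSeries_nil 1) (toWordSeries_nil f), this,
    subst_var_eq_self]

theorem coeffPart_bot (w : List (Fin s)) (f : NCSeries R s) :
    f.coeffPart w ⊥ = (w.map fun i => f.coeff [i]).prod := by
  rw [coeffPart, Finpartition.parts_bot, Finset.prod_map]
  have : ∀ i : Fin w.length, subword w {i} = [w.get i] := fun i => by simp [subword]
  change ∏ i : Fin w.length, f.coeff (subword w {i}) = _
  simp only [this]
  rw [← List.prod_ofFn]
  congr 1
  conv_rhs => rw [← List.ofFn_get w, List.map_ofFn]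
  rfl

/-- The one-block partition, whose complement is discrete, is singled out as leading term. In the
other terms `f` occurs only at shorter words. This gives the recursion for inverses and the
triangularity of right translations. -/
theorem coeff_mul_eq_add (f g : NCSeries R s) {w : List (Fin s)} (hw : w ≠ []) :
    (f * g).coeff w = f.coeff w * (w.map fun i => g.coeff [i]).prod +
      ∑ π ∈ (NC w.length).filter (1 < ·.parts.card), f.coeffPart w π * g.coeffPart w (kreweras π) := by
  obtain ⟨π₀, h₀, h₁, h₂⟩ := exists_oneBlock (List.length_pos_of_ne_nil hw).ne'
  rw [coeff_mul f g hw, sum_NC_eq_add h₀ h₁ h₂, kreweras_eq_bot h₀, coeffPart_bot, coeffPart, h₀,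
    Finset.prod_singleton, subword_univ]

end Ring

section Field

variable {k : Type*} [Field k] {s : ℕ}

/-- The left inverse of a series for the boxed convolution. -/
noncomputable def leftInv (g : NCSeries k s) (w : List (Fin s)) : k :=
  if w = [] then 0 else
    ((w.map fun i => g.coeff [i]).prod)⁻¹ * ((1 : NCSeries k s).coeff w -
      ∑ π : {π // π ∈ NC w.length ∧ 1 < π.parts.card},
        (∏ V : {V // V ∈ π.1.parts}, leftInv g (subword w V.1)) * g.coeffPart w (kreweras π.1))
termination_by w.length
decreasing_by exact subword_length_lt w π.1 π.2.2 V.1 V.2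

theorem exists_mul_eq_one (g : NCSeries k s) (hg : ∀ i, IsUnit (g.coeff [i])) :
    ∃ f : NCSeries k s, f * g = 1 := by
  let f : NCSeries k s := ⟨leftInv g, by rw [leftInv, if_pos rfl]⟩
  refine ⟨f, ?_⟩
  apply toWordSeries_injective
  ext w
  rcases eq_or_ne w [] with rfl | hw
  · rw [toWordSeries_nil, toWordSeries_nil]
  have hc : (w.map fun i => g.coeff [i]).prod ≠ 0 := by
    refine List.prod_ne_zero fun h => ?_
    obtain ⟨i, -, hi⟩ := List.mem_map.1 h
    exact (hg i).ne_zero hi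
  rw [← coeff_eq, ← coeff_eq, coeff_mul_eq_add f g hw]
  have h1 : f.coeff w = leftInv g w := rfl
  have h2 : ∑ π ∈ (NC w.length).filter (1 < ·.parts.card),
      f.coeffPart w π * g.coeffPart w (kreweras π) =
      ∑ π : {π // π ∈ NC w.length ∧ 1 < π.parts.card},
        (∏ V : {V // V ∈ π.1.parts}, leftInv g (subword w V.1)) * g.coeffPart w (kreweras π.1) := by
    rw [Finset.sum_subtype _ (fun π => Finset.mem_filter)]
    refine Finset.sum_congr rfl fun π _ => ?_
    rw [coeffPart, Finset.prod_subtype _ (fun _ => Iff.rfl)]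
    rfl
  rw [h1, h2, leftInv, if_neg hw, mul_comm, mul_inv_cancel_left₀ hc, sub_add_cancel]

end Field

/-- The set of series is a group under the boxed convolution. -/
theorem isBoxedGroup_of_eq {k : Type*} [Field k] {s : ℕ} {H : Subsemigroup (NCSeries k s)}
    (hH : H = groupG k s ∨ H = groupGPlus k s) : IsBoxedGroup H := by
  have h1 : (1 : NCSeries k s) ∈ H := by
    have : ∀ i : Fin s, (1 : NCSeries k s).coeff [i] = 1 := fun i => rfl
    rcases hH with rfl | rfl
    · exact fun i => by rw [this]; exact isUnit_one
    · exact this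
  have hunit : ∀ g ∈ H, ∀ i, IsUnit (g.coeff [i]) := by
    rcases hH with rfl | rfl
    · exact fun g hg => hg
    · exact fun g hg i => by rw [hg i]; exact isUnit_one
  have hinv : ∀ g ∈ H, ∃ f ∈ H, f * g = 1 := by
    intro g hg
    obtain ⟨f, hf⟩ := exists_mul_eq_one g (hunit g hg)
    refine ⟨f, ?_, hf⟩
    have h2 : ∀ i, f.coeff [i] * g.coeff [i] = 1 := fun i => by
      rw [← coeff_mul_singleton, hf]
      rfl
    rcases hH with rfl | rfl
    · exact fun i => IsUnit.of_mul_eq_one _ (h2 i)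
    · exact fun i => by simpa [hg i] using h2 i
  refine ⟨fun f g h => Subtype.ext (boxed_assoc _ _ _), ⟨1, h1⟩, rfl,
    fun f => ⟨Subtype.ext (boxed_one_mul _), Subtype.ext (boxed_mul_one _)⟩, fun g => ?_⟩
  obtain ⟨f, hf, hfg⟩ := hinv g g.2
  obtain ⟨e, -, hef⟩ := hinv f hf
  have h3 : e = g := by rw [← boxed_mul_one e, ← hfg, ← boxed_assoc, hef, boxed_one_mul]
  exact ⟨⟨f, hf⟩, Subtype.ext (h3 ▸ hef : (g : NCSeries k s) * f = 1), Subtype.ext hfg⟩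

end NCSeries

/-! ### Moments and free cumulants as power series. -/

section FreeProbability

open WordSeries

variable {k A : Type*} [Field k] [Ring A] [Algebra k A] {φ : A →ₗ[k] k}

/-- The moment-cumulant formula. -/
theorem apply_prod_eq_sum_NC (φ : A →ₗ[k] k) {l : List A} (hl : l ≠ []) :
    φ l.prod = ∑ π ∈ NC l.length, ∏ V ∈ π.parts, freeCumulant φ (subword l V) := by
  obtain ⟨π₀, h₀, h₁, h₂⟩ := exists_oneBlock (List.length_pos_of_ne_nil hl).ne'
  rw [sum_NC_eq_add h₀ h₁ h₂, h₀, Finset.prod_singleton, subword_univ, freeCumulant]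
  rw [Finset.sum_subtype _ (fun π => Finset.mem_filter), sub_add_eq_add_sub, eq_sub_iff_add_eq]
  congr 1
  refine Finset.sum_congr rfl fun π _ => ?_
  exact (Finset.prod_subtype π.1.parts (fun _ => Iff.rfl)
    (fun V => freeCumulant φ (subword l V))).symm

theorem subword_ne_nil {α : Type*} {w : List α} {V : Finset (Fin w.length)} (hV : V.Nonempty) :
    subword w V ≠ [] := by
  intro h
  have := congrArg List.length h
  simp [subword] at this
  exact hV.ne_empty this

/-- The moments of a family, as a series. -/
def momentSeries {α : Type*} (φ : A →ₗ[k] k) (a : α → A) : WordSeries k α :=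
  fun w => φ (w.map a).prod

/-- The free cumulants of a family, as a series. -/
noncomputable def cumulantSeries {α : Type*} (φ : A →ₗ[k] k) (a : α → A) : WordSeries k α :=
  open Classical in fun w => if w = [] then 0 else freeCumulant φ (w.map a)

theorem cumulantSeries_nil {α : Type*} (a : α → A) : cumulantSeries φ a [] = 0 := by
  simp [cumulantSeries]

theorem cumulantSeries_of_ne_nil {α : Type*} (a : α → A) {w : List α} (hw : w ≠ []) :
    cumulantSeries φ a w = freeCumulant φ (w.map a) := by
  simp [cumulantSeries, hw]

theorem pick_map {α β : Type*} (a : α → β) (w : List α) (V : Finset ℕ) :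
    pick (w.map a) V = (pick w V).map a := by
  simp only [pick, List.map_filterMap, List.getElem?_map]

theorem momentSeries_eq_sum_NC {α : Type*} (a : α → A) {w : List α} (hw : w ≠ []) :
    momentSeries φ a w =
      ∑ π ∈ NC w.length, ∏ V ∈ π.parts, cumulantSeries φ a (subword w V) := by
  have hw' : w.map a ≠ [] := by simpa using hw
  -- Partitions of the positions of `w.map a` and of `w` have different index types. Passing through
  -- `wordSum`, which is indexed by natural numbers, avoids a transport.
  have h1 := sum_NC_subword (R := k) (freeCumulant φ) (fun _ => 1) hw'
  have h2 := sum_NC_subword (R := k) (fun u => freeCumulant φ (u.map a)) (fun _ => 1) hw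
  simp only [Finset.prod_const_one, mul_one] at h1 h2
  rw [momentSeries, apply_prod_eq_sum_NC φ hw', h1]
  have h3 : wordSum (R := k) (freeCumulant φ) (freeCumulant φ) (fun _ => 1) (w.map a) =
      wordSum (R := k) (fun u => freeCumulant φ (u.map a)) (fun u => freeCumulant φ (u.map a))
        (fun _ => 1) w := by
    simp only [wordSum, pick_map, List.length_map]
  rw [h3, ← h2]
  refine Finset.sum_congr rfl fun π _ => Finset.prod_congr rfl fun V hV => ?_
  rw [cumulantSeries_of_ne_nil _ (subword_ne_nil (π.nonempty_of_mem_parts hV))]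

/-- Summing without weights on the complement is the boxed convolution with `Z`, the series with all
coefficients `1` at non-empty words. As `dl i Z = 1 + Z`, the system gives `y i = z_i (1 + Z(x))`.
Since `Z(x) = κ(y)`, the second factor is the moment series. -/
theorem momentSeries_eq {α : Type*} [Fintype α] (hφ : φ 1 = 1) (a : α → A) :
    momentSeries φ a = 1 + subst (fun i => var i * momentSeries φ a) (cumulantSeries φ a) := by
  classical
  set κ := cumulantSeries φ a with hκ
  let Z : WordSeries k α := fun w => if w = [] then 0 else 1
  obtain ⟨x, y, h, h'⟩ := exists_isBoxedSystem κ Z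
  have hZ : Z [] = 0 := rfl
  have hZc : ∀ i w, Z (i :: w) = 1 := fun i w => if_neg (List.cons_ne_nil i w)
  have hκ0 : κ [] = 0 := cumulantSeries_nil a
  have hM : momentSeries φ a = 1 + subst y κ := by
    ext w
    rcases eq_or_ne w [] with rfl | hw
    · rw [WordSeries.add_apply, subst_nil (h.right_nil var_nil), hκ0]
      simp [momentSeries, hφ]
    · rw [WordSeries.add_apply, ← h' w hw, momentSeries_eq_sum_NC a hw, ← sum_NC_subword _ _ hw]
      rw [show (1 : WordSeries k α) w = 0 by cases w; exact absurd rfl hw; rfl, zero_add]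
      refine Finset.sum_congr rfl fun π _ => ?_
      rw [Finset.prod_eq_one (s := (kreweras π).parts), mul_one]
      exact fun V hV => if_neg (subword_ne_nil ((kreweras π).nonempty_of_mem_parts hV))
  have hdl : ∀ i, dl i Z = 1 + Z := by
    intro i
    ext w
    cases w with
    | nil => rw [dl_apply, hZc, WordSeries.add_apply, hZ, one_nil, add_zero]
    | cons j w => rw [dl_apply, hZc, WordSeries.add_apply, hZc, one_cons, zero_add]
  have hy : y = fun i => var i * momentSeries φ a := funext fun i => by
    rw [h.right i, hdl, subst_add (h.left_nil var_nil), subst_one (h.left_nil var_nil),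
      ← h.subst_eq_subst var_nil hκ0 hZ, hM]
  rw [← hy]
  exact hM

theorem toWordSeries_rTransform {s : ℕ} (a : Fin s → A) :
    (rTransform φ a).toWordSeries = cumulantSeries φ a := by
  ext w
  rw [NCSeries.toWordSeries, rTransform, cumulantSeries]

/-- With the moment series fixed, the functional equation says that both cumulant series have the
same image under one injective substitution. -/
theorem cumulantSeries_eq_of_momentSeries_eq {α : Type*} [Fintype α] (hφ : φ 1 = 1) {a b : α → A}
    (h : momentSeries φ a = momentSeries φ b) : cumulantSeries φ a = cumulantSeries φ b := by
  have h1 := momentSeries_eq hφ a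
  have h2 := momentSeries_eq hφ b
  rw [← h] at h2
  have h0 : momentSeries φ a [] = 1 := by simp [momentSeries, hφ]
  refine subst_var_mul_injective h0 ?_
  exact add_left_cancel (h1.symm.trans h2)

theorem momentSeries_eq_of_cumulantSeries_eq {α : Type*} (hφ : φ 1 = 1) {a b : α → A}
    (h : cumulantSeries φ a = cumulantSeries φ b) : momentSeries φ a = momentSeries φ b := by
  ext w
  rcases eq_or_ne w [] with rfl | hw
  · simp [momentSeries, hφ]
  · rw [momentSeries_eq_sum_NC a hw, momentSeries_eq_sum_NC b hw, h]

theorem law_eq_iff {s : ℕ} (a b : Fin s → A) :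
    law φ a = law φ b ↔ momentSeries φ a = momentSeries φ b := by
  have key : ∀ (c : Fin s → A) (w : List (Fin s)),
      law φ c (w.map (FreeAlgebra.ι k)).prod = momentSeries φ c w := by
    intro c w
    rw [law, LinearMap.comp_apply, AlgHom.toLinearMap_apply, map_list_prod, List.map_map,
      momentSeries]
    congr 3
    funext i
    simp
  constructor
  · intro h
    ext w
    rw [← key, ← key, h]
  · intro h
    have hspan : Submodule.span k (Set.range fun w : List (Fin s) =>
        (w.map (FreeAlgebra.ι k)).prod) = ⊤ := by
      have h1 : (Set.range fun w : List (Fin s) => (w.map (FreeAlgebra.ι k)).prod) =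
          (Submonoid.closure (Set.range (FreeAlgebra.ι k : Fin s → FreeAlgebra k (Fin s))) :
            Set (FreeAlgebra k (Fin s))) := by
        rw [Submonoid.closure_eq_image_prod]
        ext x
        constructor
        · rintro ⟨w, rfl⟩
          refine ⟨_, fun y hy => ?_, rfl⟩
          obtain ⟨i, -, rfl⟩ := List.mem_map.1 hy
          exact ⟨i, rfl⟩
        · rintro ⟨l, hl, rfl⟩
          have h2 : l ∈ Set.range (List.map (FreeAlgebra.ι k : Fin s → FreeAlgebra k (Fin s))) := by
            rw [Set.range_list_map]
            exact hl
          obtain ⟨w, rfl⟩ := h2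
          exact ⟨w, rfl⟩
      rw [h1, ← Algebra.adjoin_eq_span, FreeAlgebra.adjoin_range_ι]
      rfl
    refine LinearMap.ext_on hspan ?_
    rintro _ ⟨w, rfl⟩
    simp only
    rw [key, key, h]

end FreeProbability

/-! ### Series in doubled letters, read along alternating words. -/

namespace WordSeries

section Doubling

variable {R α : Type*} [CommRing R]

/-- The word `a_1 b_1 a_2 b_2 ⋯` in doubled letters. -/
def dbl : List α → List (α ⊕ α)
  | [] => []
  | i :: w => Sum.inl i :: Sum.inr i :: dbl w

/-- Coefficients at the words `a_1 b_1 ⋯ a_n b_n`. -/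
def onDbl (P : WordSeries R (α ⊕ α)) : WordSeries R α := fun u => P (dbl u)

/-- Coefficients at the words `b_i a_1 b_1 ⋯ a_n b_n`. -/
def onCons (i : α) (P : WordSeries R (α ⊕ α)) : WordSeries R α := fun u => P (Sum.inr i :: dbl u)

/-- Coefficients at the words `a_1 b_1 ⋯ a_n b_n a_i`. -/
def onConcat (i : α) (P : WordSeries R (α ⊕ α)) : WordSeries R α :=
  fun u => P (dbl u ++ [Sum.inl i])

theorem cons_var_mul_apply {β : Type*} (c d : β) (Q : WordSeries R β) (w : List β) :
    (var c * Q : WordSeries R β) (d :: w) = open Classical in if d = c then Q w else 0 := by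
  split_ifs with h
  · rw [h, var_mul_cons_self]
  · rw [var_mul_cons_of_ne h]

theorem var_mul_apply_nil {β : Type*} (c : β) (Q : WordSeries R β) :
    (var c * Q : WordSeries R β) [] = 0 := by
  rw [mul_nil, var_nil, zero_mul]

/-- Cutting the word `b_i a_1 b_1 ⋯ a_n b_n` at a letter `a_j` leaves a word of the same kind on the
left and one beginning with `b_j` on the right. The alternating readings are therefore
multiplicative around a marked letter. The two variants that follow rest on the same observation. -/
theorem onCons_mul_inl (i j : α) (P Q : WordSeries R (α ⊕ α)) :
    onCons i (P * var (Sum.inl j) * Q) = onCons i P * var j * onCons j Q := by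
  rw [mul_assoc, mul_assoc]
  have x0 := var_mul_apply_nil (Sum.inl j) Q
  have x1 := cons_var_mul_apply (Sum.inl j) (Q := Q)
  have y0 := var_mul_apply_nil j (onCons j Q)
  have y1 := cons_var_mul_apply j (Q := onCons j Q)
  generalize var (Sum.inl j) * Q = X at x0 x1 ⊢
  generalize var j * onCons j Q = Y at y0 y1 ⊢
  ext u
  induction u generalizing P i with
  | nil =>
    change (P * X) [Sum.inr i] = _
    rw [mul_cons, mul_nil, mul_nil, x0, x1, y0]
    simp
  | cons i' u ih =>
    change (P * X) (Sum.inr i :: Sum.inl i' :: Sum.inr i' :: dbl u) = _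
    rw [mul_cons P, mul_cons _ X, mul_cons _ Y, x1, x1, y1, if_neg (by simp), mul_zero, zero_add]
    congr 1
    · by_cases h : i' = j
      · subst h
        simp only [if_true]
        rfl
      · simp [h]
    · exact ih i' (dl (Sum.inl i') (dl (Sum.inr i) P))

theorem onDbl_mul_inr (j : α) (P Q : WordSeries R (α ⊕ α)) :
    onDbl (P * var (Sum.inr j) * Q) = onConcat j P * var j * onDbl Q := by
  rw [mul_assoc, mul_assoc]
  have x0 := var_mul_apply_nil (Sum.inr j) Q
  have x1 := cons_var_mul_apply (Sum.inr j) (Q := Q)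
  have y0 := var_mul_apply_nil j (onDbl Q)
  have y1 := cons_var_mul_apply j (Q := onDbl Q)
  generalize var (Sum.inr j) * Q = X at x0 x1 ⊢
  generalize var j * onDbl Q = Y at y0 y1 ⊢
  ext u
  induction u generalizing P with
  | nil =>
    change (P * X) [] = _
    rw [mul_nil, mul_nil, x0, y0, mul_zero, mul_zero]
  | cons i u ih =>
    change (P * X) (Sum.inl i :: Sum.inr i :: dbl u) = _
    rw [mul_cons, mul_cons, mul_cons, x1, x1, y1, if_neg (by simp), mul_zero, zero_add]
    congr 1
    · by_cases h : i = j
      · subst h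
        simp only [if_true]
        rfl
      · simp [h]
    · exact ih (dl (Sum.inr i) (dl (Sum.inl i) P))

theorem onDbl_mul_inl (j : α) (P Q : WordSeries R (α ⊕ α)) :
    onDbl (P * var (Sum.inl j) * Q) = onDbl P * var j * onCons j Q := by
  rw [mul_assoc, mul_assoc]
  have x0 := var_mul_apply_nil (Sum.inl j) Q
  have x1 := cons_var_mul_apply (Sum.inl j) (Q := Q)
  have y0 := var_mul_apply_nil j (onCons j Q)
  have y1 := cons_var_mul_apply j (Q := onCons j Q)
  generalize var (Sum.inl j) * Q = X at x0 x1 ⊢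
  generalize var j * onCons j Q = Y at y0 y1 ⊢
  ext u
  induction u generalizing P with
  | nil =>
    change (P * X) [] = _
    rw [mul_nil, mul_nil, x0, y0, mul_zero, mul_zero]
  | cons i u ih =>
    change (P * X) (Sum.inl i :: Sum.inr i :: dbl u) = _
    rw [mul_cons P, mul_cons _ X, mul_cons _ Y, x1, x1, y1,
      if_neg (show Sum.inr i ≠ Sum.inl j by simp), mul_zero, zero_add]
    congr 1
    · by_cases h : i = j
      · subst h
        simp only [if_true]
        rfl
      · simp [h]
    · exact ih (dl (Sum.inr i) (dl (Sum.inl i) P))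

/-- The extension of a series in the first letters by `0`. -/
def extInl (f : WordSeries R α) : WordSeries R (α ⊕ α)
  | [] => f []
  | Sum.inl i :: w => extInl (dl i f) w
  | Sum.inr _ :: _ => 0

/-- The extension of a series in the second letters by `0`. -/
def extInr (f : WordSeries R α) : WordSeries R (α ⊕ α)
  | [] => f []
  | Sum.inr i :: w => extInr (dl i f) w
  | Sum.inl _ :: _ => 0

theorem dl_inl_extInl (i : α) (f : WordSeries R α) :
    dl (Sum.inl i) (extInl f) = extInl (dl i f) := by ext w; rw [dl_apply, extInl]
theorem dl_inr_extInl (i : α) (f : WordSeries R α) : dl (Sum.inr i) (extInl f) = 0 := by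
  ext w; rw [dl_apply, extInl]; rfl
theorem dl_inr_extInr (i : α) (f : WordSeries R α) :
    dl (Sum.inr i) (extInr f) = extInr (dl i f) := by ext w; rw [dl_apply, extInr]
theorem dl_inl_extInr (i : α) (f : WordSeries R α) : dl (Sum.inl i) (extInr f) = 0 := by
  ext w; rw [dl_apply, extInr]; rfl

theorem dr_inl_extInl (i : α) (f : WordSeries R α) :
    dr (Sum.inl i) (extInl f) = extInl (dr i f) := by
  ext w
  induction w generalizing f with
  | nil => simp [extInl]
  | cons c w ih =>
    cases c with
    | inl j => simpa [extInl, dl_dr] using ih (dl j f)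
    | inr j => simp [extInl]

theorem dr_inr_extInl (i : α) (f : WordSeries R α) : dr (Sum.inr i) (extInl f) = 0 := by
  ext w
  induction w generalizing f with
  | nil => simp [extInl]
  | cons c w ih =>
    cases c with
    | inl j => simpa [extInl] using ih (dl j f)
    | inr j => simp [extInl]

theorem eq_extInl {F : WordSeries R (α ⊕ α)} {f : WordSeries R α}
    (h1 : ∀ u, F (u.map Sum.inl) = f u) (h2 : ∀ w, (∃ i, Sum.inr i ∈ w) → F w = 0) :
    F = extInl f := by
  ext w
  induction w generalizing F f with
  | nil => exact h1 []
  | cons c w ih =>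
    cases c with
    | inl j =>
      exact ih (F := dl (Sum.inl j) F) (f := dl j f) (fun u => h1 (j :: u)) fun w ⟨i, hi⟩ =>
        h2 _ ⟨i, List.mem_cons_of_mem _ hi⟩
    | inr j => exact h2 _ ⟨j, by simp⟩

theorem eq_extInr {F : WordSeries R (α ⊕ α)} {f : WordSeries R α}
    (h1 : ∀ u, F (u.map Sum.inr) = f u) (h2 : ∀ w, (∃ i, Sum.inl i ∈ w) → F w = 0) :
    F = extInr f := by
  ext w
  induction w generalizing F f with
  | nil => exact h1 []
  | cons c w ih =>
    cases c with
    | inr j =>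
      exact ih (F := dl (Sum.inr j) F) (f := dl j f) (fun u => h1 (j :: u)) fun w ⟨i, hi⟩ =>
        h2 _ ⟨i, List.mem_cons_of_mem _ hi⟩
    | inl j => exact h2 _ ⟨j, by simp⟩

end Doubling

end WordSeries

/-! ### The joint moments of two free families along alternating words. -/

namespace WordSeries

section Free

variable {R α : Type*} [CommRing R] [Fintype α]

/-- Series that reproduce themselves between factors without constant term vanish. -/
theorem eq_zero_of_forall_eq_sum {ι : Type*} (d : ι → WordSeries R α)
    (h : ∀ j, ∃ (c e : α → WordSeries R α) (j' : α → ι),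
      (∀ i, c i [] = 0 ∨ e i [] = 0) ∧ d j = ∑ i, c i * d (j' i) * e i) (j : ι) : d j = 0 := by
  have key : ∀ n j, d j ∈ ord R α n := by
    intro n
    induction n with
    | zero => exact fun j => mem_ord_zero _
    | succ n ih =>
      intro j
      obtain ⟨c, e, j', h0, hj'⟩ := h j
      rw [hj']
      refine Submodule.sum_mem _ fun i _ => ?_
      rcases h0 i with h1 | h1
      · rw [add_comm n]
        exact mul_mem_ord_left (mul_mem_ord (mem_ord_one.2 h1) (ih _)) _
      · exact mul_mem_ord (mul_mem_ord_right _ (ih _)) (mem_ord_one.2 h1)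
  exact eq_of_sub_mem_ord fun n => by simpa using key n j

variable {M : WordSeries R (α ⊕ α)} {f g : WordSeries R α}

/-- The series `extInl f` involves only the letters `a_j`. Cutting the alternating word at each of
them separates the factors `M`, and each later factor is read along a word beginning with `b_j`. -/
theorem onCons_mul_subst_extInl (i : α) :
    onCons i (M * subst (fun c => var c * M) (extInl f)) =
      onCons i M * subst (fun j => var j * onCons j M) f := by
  have h0 : ∀ c, ((fun c => var c * M) c : WordSeries R (α ⊕ α)) [] = 0 :=
    fun c => var_mul_apply_nil c M
  have h1 : ∀ j, ((fun j => var j * onCons j M) j : WordSeries R α) [] = 0 :=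
    fun j => var_mul_apply_nil j _
  have hadd : ∀ i (P Q : WordSeries R (α ⊕ α)), onCons i (P + Q) = onCons i P + onCons i Q :=
    fun _ _ _ => rfl
  have hsmul : ∀ i (r : R) (P : WordSeries R (α ⊕ α)), onCons i (r • P) = r • onCons i P :=
    fun _ _ _ => rfl
  have hsum : ∀ i (F : α → WordSeries R (α ⊕ α)), onCons i (∑ j, F j) = ∑ j, onCons i (F j) :=
    fun i F => WordSeries.ext fun w => by rw [onCons, sum_apply, sum_apply]; rfl
  refine sub_eq_zero.1 (eq_zero_of_forall_eq_sum (ι := α × WordSeries R α)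
    (fun p => onCons p.1 (M * subst (fun c => var c * M) (extInl p.2)) -
      onCons p.1 M * subst (fun j => var j * onCons j M) p.2)
    (fun p => ⟨fun j => onCons p.1 M * var j, fun _ => 1, fun j => (j, dl j p.2),
      fun j => Or.inl (mul_var_nil j _), ?_⟩) (i, f))
  have e0 : extInl p.2 [] = p.2 [] := rfl
  rw [subst_eq h0, subst_eq h1, Fintype.sum_sum_type, e0]
  simp only [dl_inl_extInl, dl_inr_extInl, subst_zero h0, mul_zero, Finset.sum_const_zero,
    add_zero, mul_add, mul_smul_comm, mul_one, Finset.mul_sum, hadd, hsmul, hsum,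
    add_sub_add_left_eq_sub, mul_sub, Finset.sum_sub_distrib]
  congr 1
  · refine Finset.sum_congr rfl fun j _ => ?_
    rw [mul_assoc (var _), ← mul_assoc, onCons_mul_inl]
  · refine Finset.sum_congr rfl fun j _ => ?_
    simp only [mul_assoc]

theorem onDbl_mul_subst_extInr :
    onDbl (M * subst (fun c => var c * M) (extInr g)) =
      subst (fun j => onConcat j M * var j) g * onDbl M := by
  have h0 : ∀ c, ((fun c => var c * M) c : WordSeries R (α ⊕ α)) [] = 0 :=
    fun c => var_mul_apply_nil c M
  have h1 : ∀ j, ((fun j => onConcat j M * var j) j : WordSeries R α) [] = 0 :=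
    fun j => mul_var_nil j _
  have hadd : ∀ (P Q : WordSeries R (α ⊕ α)), onDbl (P + Q) = onDbl P + onDbl Q :=
    fun _ _ => rfl
  have hsmul : ∀ (r : R) (P : WordSeries R (α ⊕ α)), onDbl (r • P) = r • onDbl P :=
    fun _ _ => rfl
  have hsum : ∀ (F : α → WordSeries R (α ⊕ α)), onDbl (∑ j, F j) = ∑ j, onDbl (F j) :=
    fun F => WordSeries.ext fun w => by rw [onDbl, sum_apply, sum_apply]; rfl
  refine sub_eq_zero.1 (eq_zero_of_forall_eq_sum (ι := WordSeries R α)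
    (fun p => onDbl (M * subst (fun c => var c * M) (extInr p)) -
      subst (fun j => onConcat j M * var j) p * onDbl M)
    (fun p => ⟨fun j => onConcat j M * var j, fun _ => 1, fun j => dl j p,
      fun j => Or.inl (mul_var_nil j _), ?_⟩) g)
  have e0 : extInr p [] = p [] := rfl
  rw [subst_eq h0, subst_eq h1, Fintype.sum_sum_type, e0]
  simp only [dl_inr_extInr, dl_inl_extInr, subst_zero h0, mul_zero, Finset.sum_const_zero,
    zero_add, mul_add, add_mul, mul_smul_comm, smul_mul_assoc, one_mul, mul_one, Finset.mul_sum,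
    Finset.sum_mul, hadd, hsmul, hsum, add_sub_add_left_eq_sub, mul_sub, Finset.sum_sub_distrib]
  congr 1
  · refine Finset.sum_congr rfl fun j _ => ?_
    rw [mul_assoc (var _), ← mul_assoc, onDbl_mul_inr]
  · refine Finset.sum_congr rfl fun j _ => ?_
    simp only [mul_assoc]

/-- Here the letters are stripped from the right, since it is the left part, up to the last `a_j`,
that retains the shape of the expression. -/
theorem onDbl_subst_extInl_mul :
    onDbl (subst (fun c => M * var c) (extInl f) * M) =
      onDbl M * subst (fun j => var j * onCons j M) f := by
  have h0 : ∀ c, ((fun c => M * var c) c : WordSeries R (α ⊕ α)) [] = 0 :=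
    fun c => mul_var_nil c M
  have h1 : ∀ j, ((fun j => var j * onCons j M) j : WordSeries R α) [] = 0 :=
    fun j => var_mul_apply_nil j _
  have hadd : ∀ (P Q : WordSeries R (α ⊕ α)), onDbl (P + Q) = onDbl P + onDbl Q :=
    fun _ _ => rfl
  have hsmul : ∀ (r : R) (P : WordSeries R (α ⊕ α)), onDbl (r • P) = r • onDbl P :=
    fun _ _ => rfl
  have hsum : ∀ (F : α → WordSeries R (α ⊕ α)), onDbl (∑ j, F j) = ∑ j, onDbl (F j) :=
    fun F => WordSeries.ext fun w => by rw [onDbl, sum_apply, sum_apply]; rfl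
  refine sub_eq_zero.1 (eq_zero_of_forall_eq_sum (ι := WordSeries R α)
    (fun p => onDbl (subst (fun c => M * var c) (extInl p) * M) -
      onDbl M * subst (fun j => var j * onCons j M) p)
    (fun p => ⟨fun _ => 1, fun j => var j * onCons j M, fun j => dr j p,
      fun j => Or.inr (var_mul_apply_nil j _), ?_⟩) f)
  have e0 : extInl p [] = p [] := rfl
  rw [subst_eq' h0, subst_eq' h1, Fintype.sum_sum_type, e0]
  simp only [dr_inl_extInl, dr_inr_extInl, subst_zero h0, zero_mul, Finset.sum_const_zero,
    add_zero, mul_add, add_mul, mul_smul_comm, smul_mul_assoc, one_mul, mul_one, Finset.mul_sum,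
    Finset.sum_mul, hadd, hsmul, hsum, add_sub_add_left_eq_sub, sub_mul, Finset.sum_sub_distrib]
  congr 1
  · refine Finset.sum_congr rfl fun j _ => ?_
    rw [← mul_assoc (subst _ _) M, onDbl_mul_inl, mul_assoc]
  · refine Finset.sum_congr rfl fun j _ => ?_
    simp only [mul_assoc]

/-- The moments of products of free families: if `M` are the joint moments of two families whose
mixed cumulants vanish, then the moments of the products have the cumulants `f ⊠ g`. -/
theorem onDbl_eq_of_isBoxedSystem {κ : WordSeries R (α ⊕ α)} {x y : α → WordSeries R α}
    (h : IsBoxedSystem f g var x y) (hM : M = 1 + subst (fun c => var c * M) κ) (hκ : κ [] = 0)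
    (hf : ∀ i, dl (Sum.inl i) κ = extInl (dl i f)) (hg : ∀ i, dl (Sum.inr i) κ = extInr (dl i g))
    (hf' : ∀ i, dr (Sum.inl i) κ = extInl (dr i f)) (hf0 : f [] = 0) :
    onDbl M = 1 + subst (fun i => var i * onDbl M) (subst y f) := by
  have h0 : ∀ c, ((fun c => var c * M) c : WordSeries R (α ⊕ α)) [] = 0 :=
    fun c => var_mul_apply_nil c M
  have h0' : ∀ c, ((fun c => M * var c) c : WordSeries R (α ⊕ α)) [] = 0 :=
    fun c => mul_var_nil c M
  have hM' := eq_one_add_subst_mul_var hM hκ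
  have hM0 : M [] = 1 := by rw [hM, WordSeries.add_apply, subst_nil h0, hκ, one_nil, add_zero]
  -- Freeness enters through `hf`, `hg` and `hf'`: a derivative of `κ` in one kind of letter
  -- involves only letters of that kind. The moment recursions at the first and last letter thus
  -- fall under the preceding lemmas.
  have hl : ∀ c, dl c M = M * subst (fun c => var c * M) (dl c κ) := by
    intro c
    conv_lhs => rw [hM, subst_eq h0, hκ]
    simp only [mul_assoc, map_add, dl_one, zero_add, zero_smul, dl_sum_var_mul]
  have hr : ∀ c, dr c M = subst (fun c => M * var c) (dr c κ) * M := by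
    intro c
    have h1 : dr c (1 : WordSeries R (α ⊕ α)) = 0 := by ext w; cases w <;> rfl
    conv_lhs => rw [hM', subst_eq' h0', hκ]
    simp only [← mul_assoc, map_add, h1, zero_add, zero_smul, dr_sum_mul_var]
  -- The three conditions come from three moment recursions along alternating words: at the first
  -- letter `a_i`, at a first letter `b_i`, and at a last letter `a_i`.
  refine eq_one_add_subst_boxed (A := fun j => onConcat j M * var j)
    (B := fun j => var j * onCons j M) h ?_ ?_ ?_
  · have h1 : ∀ j, ((fun j => var j * onCons j M) j : WordSeries R α) [] = 0 :=
      fun j => var_mul_apply_nil j _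
    ext w
    cases w with
    | nil =>
      rw [WordSeries.add_apply, subst_nil h1, hf0, one_nil, add_zero]
      exact hM0
    | cons i u =>
      rw [WordSeries.add_apply, one_cons, zero_add, subst_eq h1, hf0, zero_smul, zero_add]
      have h2 := dl_sum_var_mul
        (fun j => onCons j M * subst (fun j => var j * onCons j M) (dl j f)) i
      simp only [← mul_assoc] at h2
      rw [← dl_apply i (onDbl M) u]
      refine Eq.trans ?_ (congrArg (fun F => F u) h2.symm)
      rw [← onCons_mul_subst_extInl, ← hf, ← hl]
      rfl
  · intro i
    rw [← onDbl_mul_subst_extInr, ← hg, ← hl]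
    rfl
  · intro i
    rw [← onDbl_subst_extInl_mul, ← hf', ← hr]
    rfl

end Free

end WordSeries

/-! ### The cumulants of products of free families. -/

section FreeProducts

open WordSeries

variable {k A : Type*} [Field k] [Ring A] [Algebra k A] {φ : A →ₗ[k] k}

/-- The `R`-transform of a product of free families is the boxed convolution. -/
theorem rTransform_mul {s : ℕ} (hφ : φ 1 = 1) (a b : Fin s → A)
    (hfree : CombinatoriallyFree φ ![Set.range a, Set.range b]) :
    rTransform φ (fun i => a i * b i) = rTransform φ a * rTransform φ b := by
  apply NCSeries.toWordSeries_injective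
  obtain ⟨x, y, h1, h2⟩ := NCSeries.exists_isBoxedSystem_mul (rTransform φ a) (rTransform φ b)
  rw [h2]
  set f := (rTransform φ a).toWordSeries with hf
  set g := (rTransform φ b).toWordSeries with hg
  rw [toWordSeries_rTransform] at hf hg ⊢
  set κ := cumulantSeries φ (Sum.elim a b) with hκ
  have hfa : ∀ u, κ (u.map Sum.inl) = f u := by
    intro u
    rcases eq_or_ne u [] with rfl | hu
    · rw [hf, List.map_nil, hκ, cumulantSeries_nil, cumulantSeries_nil]
    · rw [hf, cumulantSeries_of_ne_nil _ hu, hκ, cumulantSeries_of_ne_nil _ (by simpa using hu),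
        List.map_map]
      rfl
  have hgb : ∀ u, κ (u.map Sum.inr) = g u := by
    intro u
    rcases eq_or_ne u [] with rfl | hu
    · rw [hg, List.map_nil, hκ, cumulantSeries_nil, cumulantSeries_nil]
    · rw [hg, cumulantSeries_of_ne_nil _ hu, hκ, cumulantSeries_of_ne_nil _ (by simpa using hu),
        List.map_map]
      rfl
  have hmix : ∀ w i j, Sum.inl i ∈ w → Sum.inr j ∈ w → κ w = 0 := by
    intro w i j hi hj
    rw [hκ, cumulantSeries_of_ne_nil _ (List.ne_nil_of_mem hi)]
    let tag : Fin s ⊕ Fin s → Fin 2 × A := Sum.elim (fun i => (0, a i)) fun j => (1, b j)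
    have h3 := hfree (w.map tag) (by
      intro p hp
      obtain ⟨c, -, rfl⟩ := List.mem_map.1 hp
      cases c <;> simp [tag]) ⟨_, List.mem_map_of_mem hi, _, List.mem_map_of_mem hj, by simp [tag]⟩
    rw [List.map_map] at h3
    convert h3 using 3
    funext c
    cases c <;> rfl
  have key := onDbl_eq_of_isBoxedSystem h1 (momentSeries_eq hφ (Sum.elim a b)) (cumulantSeries_nil _)
    (fun i => eq_extInl (fun u => hfa (i :: u)) fun w ⟨j, hj⟩ =>
      hmix _ i j (by simp) (List.mem_cons_of_mem _ hj))
    (fun i => eq_extInr (fun u => hgb (i :: u)) fun w ⟨j, hj⟩ =>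
      hmix _ j i (List.mem_cons_of_mem _ hj) (by simp))
    (fun i => eq_extInl (fun u => by simpa using hfa (u ++ [i])) fun w ⟨j, hj⟩ =>
      hmix _ i j (by simp) (by simp [hj]))
    (NCSeries.toWordSeries_nil _)
  have hN : onDbl (momentSeries φ (Sum.elim a b)) = momentSeries φ fun i => a i * b i := by
    ext u
    rw [onDbl, momentSeries, momentSeries]
    congr 1
    induction u with
    | nil => rfl
    | cons i u ih => simp [dbl, ih, mul_assoc]
  rw [hN] at key
  have hN0 : momentSeries φ (fun i => a i * b i) [] = 1 := by simp [momentSeries, hφ]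
  -- The cumulants of the products and the boxed convolution satisfy the same functional equation
  -- with the same moment series, which determines them.
  exact subst_var_mul_injective hN0
    (add_left_cancel ((momentSeries_eq hφ fun i => a i * b i).symm.trans key))

end FreeProducts

/-! ### Simultaneous triangularization by stable flags. -/

section StableFlags

variable {k E ι : Type*} [Field k] [AddCommGroup E] [Module k E]

/-- A subspace that is stable under a family of operators. -/
def IsStable (T : ι → E →ₗ[k] E) (A : Submodule k E) : Prop :=
  ∀ g, ∀ h ∈ A, T g h ∈ A

/-- Between any two stable subspaces of `U` there is a stable subspace which is one dimension
larger than the smaller one. -/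
def HasStableFlags (T : ι → E →ₗ[k] E) (U : Submodule k E) : Prop :=
  ∀ A B : Submodule k E, IsStable T A → IsStable T B → A < B → B ≤ U →
    ∃ v ∈ B, v ∉ A ∧ IsStable T (A ⊔ Submodule.span k {v})

variable {T : ι → E →ₗ[k] E}

theorem IsStable.inf {A B : Submodule k E} (hA : IsStable T A) (hB : IsStable T B) :
    IsStable T (A ⊓ B) :=
  fun g h hh => ⟨hA g h hh.1, hB g h hh.2⟩

theorem IsStable.sup_span {A : Submodule k E} (hA : IsStable T A) {v : E}
    (hv : ∀ g, T g v ∈ A ⊔ Submodule.span k {v}) : IsStable T (A ⊔ Submodule.span k {v}) := by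
  intro g
  change A ⊔ Submodule.span k {v} ≤ (A ⊔ Submodule.span k {v}).comap (T g)
  refine sup_le (fun h hh => Submodule.mem_sup_left (hA g h hh)) ?_
  rw [Submodule.span_singleton_le_iff_mem]
  exact hv g

theorem HasStableFlags.bot : HasStableFlags T (⊥ : Submodule k E) := by
  intro A B _ _ hAB hB
  exact absurd (hAB.trans_le hB) not_lt_bot

theorem HasStableFlags.mono {U W : Submodule k E} (hW : HasStableFlags T W) (h : U ≤ W) :
    HasStableFlags T U :=
  fun A B hA hB hAB hBU => hW A B hA hB hAB (hBU.trans h)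

/-- If `B ⊓ U ≤ A`, then `B` exceeds `A` by one dimension, because `B` lies in `U` plus a line.
Otherwise a vector found between `A ⊓ U` and `B ⊓ U` also extends `A`. -/
theorem HasStableFlags.sup_span {U : Submodule k E} (hU : HasStableFlags T U)
    (hs : IsStable T U) (m : E) : HasStableFlags T (U ⊔ Submodule.span k {m}) := by
  intro A B hA hB hAB hBU
  by_cases hle : B ⊓ U ≤ A
  · obtain ⟨v, hvB, hvA⟩ := SetLike.exists_of_lt hAB
    refine ⟨v, hvB, hvA, ?_⟩
    have h1 : A ⊔ Submodule.span k {v} = B := by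
      refine le_antisymm (sup_le hAB.le (by rwa [Submodule.span_singleton_le_iff_mem])) ?_
      intro x hx
      obtain ⟨u, hu, z, hz, rfl⟩ := Submodule.mem_sup.1 (hBU hx)
      obtain ⟨c, rfl⟩ := Submodule.mem_span_singleton.1 hz
      obtain ⟨u', hu', z', hz', rfl⟩ := Submodule.mem_sup.1 (hBU hvB)
      obtain ⟨c', rfl⟩ := Submodule.mem_span_singleton.1 hz'
      have hc' : c' ≠ 0 := by
        rintro rfl
        rw [zero_smul, add_zero] at hvA hvB
        exact hvA (hle ⟨hvB, hu'⟩)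
      have h2 : u + c • m = (u - (c / c') • u') + (c / c') • (u' + c' • m) := by
        rw [smul_add, smul_smul, div_mul_cancel₀ c hc']
        abel
      have h3 : u - (c / c') • u' ∈ B := by
        rw [eq_sub_of_add_eq h2.symm]
        exact B.sub_mem hx (B.smul_mem _ hvB)
      rw [h2]
      exact Submodule.add_mem_sup (hle ⟨h3, U.sub_mem hu (U.smul_mem _ hu')⟩)
        (Submodule.smul_mem _ _ (Submodule.mem_span_singleton_self _))
    rwa [h1]
  · have hlt : A ⊓ U < B ⊓ U :=
      lt_of_le_not_ge (inf_le_inf_right U hAB.le) fun h => hle (h.trans inf_le_left)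
    obtain ⟨v, hvB, hvA, hv⟩ := hU _ _ (hA.inf hs) (hB.inf hs) hlt inf_le_right
    refine ⟨v, hvB.1, fun h => hvA ⟨h, hvB.2⟩, hA.sup_span fun g => ?_⟩
    exact sup_le_sup_right (inf_le_left : A ⊓ U ≤ A) (Submodule.span k {v})
      (hv g v (Submodule.mem_sup_right (Submodule.mem_span_singleton_self v)))

/-- A finite family on which the operators are triangular spans a stable subspace that has
stable flags. -/
theorem isStable_hasStableFlags_span {κ : Type*} (m : κ → E) (c : κ → ℕ) (S : Finset κ)
    (h : ∀ a ∈ S, ∀ g, T g (m a) ∈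
      Submodule.span k (m '' {x | x ∈ S ∧ c a < c x}) ⊔ Submodule.span k {m a}) :
    IsStable T (Submodule.span k (m '' S)) ∧ HasStableFlags T (Submodule.span k (m '' S)) := by
  classical
  -- The element added last has the least value of `c`, so up to a multiple of itself the operators
  -- send it into the span of the elements already present.
  induction S using Finset.induction_on_min_value c with
  | empty =>
    simp only [Finset.coe_empty, Set.image_empty, Submodule.span_empty]
    exact ⟨fun g x hx => by rw [(Submodule.mem_bot k).1 hx, map_zero]; exact zero_mem _,
      HasStableFlags.bot⟩
  | insert a s ha hmin ih =>
    obtain ⟨h1, h2⟩ := ih fun x hx g => by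
      suffices hsub : {y | y ∈ insert a s ∧ c x < c y} ⊆ {y | y ∈ s ∧ c x < c y} by
        have hle := sup_le_sup_right (Submodule.span_mono (R := k) (Set.image_mono (f := m) hsub))
          (Submodule.span k {m x})
        exact hle (h x (Finset.mem_insert_of_mem hx) g)
      rintro y ⟨hy, hxy⟩
      refine ⟨(Finset.mem_insert.1 hy).resolve_left ?_, hxy⟩
      rintro rfl
      exact absurd (hmin x hx) (not_le.2 hxy)
    rw [Finset.coe_insert, Set.image_insert_eq, Submodule.span_insert, sup_comm]
    refine ⟨h1.sup_span fun g => ?_, h2.sup_span h1 _⟩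
    suffices hsub : {y | y ∈ insert a s ∧ c a < c y} ⊆ s by
      have hle := sup_le_sup_right (Submodule.span_mono (R := k) (Set.image_mono (f := m) hsub))
        (Submodule.span k {m a})
      exact hle (h a (Finset.mem_insert_self a s) g)
    rintro y ⟨hy, hay⟩
    refine (Finset.mem_insert.1 hy).resolve_left ?_
    rintro rfl
    exact lt_irrefl _ hay

/-- A sequence of vectors none of which depends on the earlier ones is linearly independent. -/
theorem linearIndependent_of_notMem_span_Iio {b : ℕ → E}
    (h : ∀ n, b n ∉ Submodule.span k (b '' Set.Iio n)) : LinearIndependent k b := by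
  have h1 : ∀ n, LinearIndepOn k b (Set.Iio n) := by
    intro n
    induction n with
    | zero => simp
    | succ n ih =>
      rw [← Order.succ_eq_add_one, Order.Iio_succ_eq_insert]
      exact ih.insert (h n)
  rw [← linearIndepOn_univ_iff]
  have h2 : (Set.univ : Set ℕ) = ⋃ n, Set.Iio n := by
    ext x
    simp only [Set.mem_univ, Set.mem_iUnion, Set.mem_Iio, true_iff]
    exact ⟨x + 1, Nat.lt_succ_self x⟩
  rw [h2]
  exact linearIndepOn_iUnion_of_directed
    (Monotone.directed_le fun _ _ hab => Set.Iio_subset_Iio hab) h1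

/-- An increasing sequence of finite-dimensional stable subspaces with stable flags has an adapted
basis on which the operators are triangular. -/
theorem exists_triangular_basis (V : ℕ → Submodule k E) (hV : Monotone V)
    (hfd : ∀ n, FiniteDimensional k (V n)) (hst : ∀ n, IsStable T (V n))
    (hfl : ∀ n, HasStableFlags T (V n))
    (hinf : ∀ A : Submodule k E, FiniteDimensional k A → ∃ n, ¬ V n ≤ A) :
    ∃ b : ℕ → E, LinearIndependent k b ∧ Submodule.span k (Set.range b) = ⨆ n, V n ∧
      (∀ n, ∃ N, Submodule.span k (b '' Set.Iio N) = V n) ∧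
      ∀ g j, T g (b j) ∈ Submodule.span k (b '' Set.Iio (j + 1)) := by
  classical
  -- The partial flag is kept between the earlier spaces and some `V n`, which forces it to pass
  -- through every `V n`.
  let P : Submodule k E → Prop := fun A =>
    IsStable T A ∧ ∃ n, (∀ m < n, V m ≤ A) ∧ A ≤ V n
  have hstep : ∀ A : {A // P A}, ∃ v, v ∉ A.1 ∧ P (A.1 ⊔ Submodule.span k {v}) := by
    rintro ⟨A, hA, n, h1, h2⟩
    have := hfd n
    -- The next vector is taken from the first `V n` not yet contained in `A`. Such an `n` always
    -- exists, so the construction never stops and the basis is indexed by all of `ℕ`.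
    have hex := hinf A (Submodule.finiteDimensional_of_le h2)
    have h3 := Nat.find_spec hex
    have h4 : ∀ m < Nat.find hex, V m ≤ A := fun m hm => not_not.1 (Nat.find_min hex hm)
    have h5 : A ≤ V (Nat.find hex) := h2.trans (hV (not_lt.1 fun h => h3 (h1 _ h)))
    obtain ⟨v, hvV, hvA, hv⟩ := hfl _ A _ hA (hst _) (lt_of_le_not_ge h5 h3) le_rfl
    exact ⟨v, hvA, hv, Nat.find hex, fun m hm => (h4 m hm).trans le_sup_left,
      sup_le h5 (by rwa [Submodule.span_singleton_le_iff_mem])⟩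
  choose v hvn hvP using hstep
  let A : ℕ → {A // P A} := fun n => Nat.rec
    ⟨⊥, fun g x hx => by rw [(Submodule.mem_bot k).1 hx, map_zero]; exact zero_mem _,
      0, fun m hm => absurd hm (Nat.not_lt_zero m), bot_le⟩
    (fun _ B => ⟨B.1 ⊔ Submodule.span k {v B}, hvP B⟩) n
  let b : ℕ → E := fun n => v (A n)
  have hspan : ∀ n, Submodule.span k (b '' Set.Iio n) = (A n).1 := by
    intro n
    induction n with
    | zero => simp [A]
    | succ n ih =>
      rw [← Order.succ_eq_add_one, Order.Iio_succ_eq_insert,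
        Set.image_insert_eq, Submodule.span_insert, ih, sup_comm]
      rfl
  have hli : LinearIndependent k b := by
    refine linearIndependent_of_notMem_span_Iio fun n => ?_
    rw [hspan]
    exact hvn (A n)
  have hmem : ∀ j, b j ∈ (A (j + 1)).1 := by
    intro j
    rw [← hspan (j + 1)]
    exact Submodule.subset_span ⟨j, Nat.lt_succ_self j, rfl⟩
  have hflag : ∀ n, ∃ N, Submodule.span k (b '' Set.Iio N) = V n := by
    intro n
    have := hfd n
    -- The step of the flag whose dimension is that of `V n` is comparable with `V n` by the
    -- sandwich condition, hence equal to it.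
    refine ⟨Module.finrank k (V n), ?_⟩
    set N := Module.finrank k (V n) with hN
    have h1 : Module.finrank k (A N).1 = N := by
      have h2 := finrank_span_eq_card (hli.comp (fun i : Fin N => (i : ℕ)) Fin.val_injective)
      rw [Set.range_comp, Fin.range_val, hspan, Fintype.card_fin] at h2
      exact h2
    rw [hspan]
    obtain ⟨-, n', h2, h3⟩ := (A N).2
    rcases lt_or_ge n n' with h | h
    · have := hfd n'
      have := Submodule.finiteDimensional_of_le h3
      exact (Submodule.eq_of_le_of_finrank_eq (h2 n h) h1.symm).symm
    · exact Submodule.eq_of_le_of_finrank_eq (h3.trans (hV h)) h1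
  refine ⟨b, hli, le_antisymm ?_ ?_, hflag, fun g j => ?_⟩
  · rw [Submodule.span_le]
    rintro _ ⟨j, rfl⟩
    obtain ⟨-, n, -, h⟩ := (A (j + 1)).2
    exact Submodule.mem_iSup_of_mem n (h (hmem j))
  · refine iSup_le fun n => ?_
    obtain ⟨N, h⟩ := hflag n
    rw [← h]
    exact Submodule.span_mono (Set.image_subset_range _ _)
  · rw [hspan]
    exact (A (j + 1)).2.1 g _ (hmem j)

theorem LinearIndependent.eq_of_sum_fin_eq {b : ℕ → E} (hb : LinearIndependent k b) {N : ℕ}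
    {x y : Fin N → k} (h : ∑ i, x i • b i = ∑ i, y i • b i) : x = y := by
  have h1 := Fintype.linearIndependent_iff.1 (hb.comp (fun i : Fin N => (i : ℕ)) Fin.val_injective)
    (x - y) (by simpa [sub_smul, sub_eq_zero] using h)
  exact funext fun i => sub_eq_zero.1 (h1 i)

theorem matrix_eq_mul_of_comp {b : ℕ → E} (hb : LinearIndependent k b) {N : ℕ} (S S' : E →ₗ[k] E)
    {P Q R : Matrix (Fin N) (Fin N) k} (hP : ∀ j : Fin N, S (b j) = ∑ i, P i j • b i)
    (hQ : ∀ j : Fin N, S' (b j) = ∑ i, Q i j • b i)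
    (hR : ∀ j : Fin N, S (S' (b j)) = ∑ i, R i j • b i) : R = P * Q := by
  have h : ∀ j, (fun i => R i j) = fun i => (P * Q) i j := by
    intro j
    apply hb.eq_of_sum_fin_eq
    rw [← hR, hQ, map_sum]
    simp only [map_smul, hP, Finset.smul_sum, smul_smul, Matrix.mul_apply, Finset.sum_smul]
    rw [Finset.sum_comm]
    simp only [mul_comm]
  ext i j
  exact congrFun (h j) i

end StableFlags

/-! ### Monomials in the coordinate functions under right translation. -/

namespace NCSeries

variable {k : Type*} [Field k] {s : ℕ}

/-- The product of the coordinate functions indexed by a multiset of words. -/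
def monomial (H : Subsemigroup (NCSeries k s)) (L : Multiset (List (Fin s))) (x : H) : k :=
  (L.map fun u => (x : NCSeries k s).coeff u).prod

/-- The span of the monomials of weight `n` with at least `d` factors. -/
def monomialSpan (H : Subsemigroup (NCSeries k s)) (n d : ℕ) : Submodule k (H → k) :=
  Submodule.span k (monomial H ''
    {L | (∀ u ∈ L, u ≠ []) ∧ (L.map List.length).sum = n ∧ d ≤ Multiset.card L})

variable {H : Subsemigroup (NCSeries k s)}

theorem monomial_singleton (u : List (Fin s)) :
    monomial H {u} = fun x : H => (x : NCSeries k s).coeff u := by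
  funext x
  simp [monomial]

theorem monomial_add (L L' : Multiset (List (Fin s))) :
    monomial H (L + L') = monomial H L * monomial H L' := by
  funext x
  simp [monomial]

theorem monomial_cons (u : List (Fin s)) (L : Multiset (List (Fin s))) :
    monomial H (u ::ₘ L) = monomial H {u} * monomial H L := by
  rw [← Multiset.singleton_add, monomial_add]

theorem monomial_mem_monomialSpan {L : Multiset (List (Fin s))} (hL : ∀ u ∈ L, u ≠ []) {d : ℕ}
    (hd : d ≤ Multiset.card L) : monomial H L ∈ monomialSpan H (L.map List.length).sum d :=
  Submodule.subset_span ⟨L, ⟨hL, rfl, hd⟩, rfl⟩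

theorem mul_mem_monomialSpan {n n' d d' : ℕ} {p q : H → k} (hp : p ∈ monomialSpan H n d)
    (hq : q ∈ monomialSpan H n' d') : p * q ∈ monomialSpan H (n + n') (d + d') := by
  have h : monomialSpan H n d * monomialSpan H n' d' ≤ monomialSpan H (n + n') (d + d') := by
    rw [monomialSpan, monomialSpan, Submodule.span_mul_span, Submodule.span_le]
    rintro _ ⟨_, ⟨L, ⟨h1, h2, h3⟩, rfl⟩, _, ⟨L', ⟨h1', h2', h3'⟩, rfl⟩, rfl⟩
    refine Submodule.subset_span ⟨L + L', ⟨fun u hu => ?_, ?_, ?_⟩, monomial_add L L'⟩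
    · exact (Multiset.mem_add.1 hu).elim (h1 u) (h1' u)
    · rw [Multiset.map_add, Multiset.sum_add, h2, h2']
    · rw [Multiset.card_add]
      exact add_le_add h3 h3'
  exact h (Submodule.mul_mem_mul hp hq)

theorem monomialSpan_anti {n d d' : ℕ} (h : d ≤ d') : monomialSpan H n d' ≤ monomialSpan H n d :=
  Submodule.span_mono (Set.image_mono fun _ hL => ⟨hL.1, hL.2.1, h.trans hL.2.2⟩)

theorem rightTranslate_mul_apply (g : H) (p q : H → k) :
    rightTranslate H g (p * q) = rightTranslate H g p * rightTranslate H g q :=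
  rfl

theorem coeffPart_mem_monomialSpan (u : List (Fin s))
    (π : Finpartition (Finset.univ : Finset (Fin u.length))) :
    (fun x : H => (x : NCSeries k s).coeffPart u π) ∈
      monomialSpan H u.length π.parts.card := by
  have h1 : (fun x : H => (x : NCSeries k s).coeffPart u π) =
      monomial H (π.parts.val.map (subword u)) := by
    funext x
    rw [monomial, Multiset.map_map]
    rfl
  have h2 : ((π.parts.val.map (subword u)).map List.length).sum = u.length := by
    rw [Multiset.map_map]
    calc _ = ∑ V ∈ π.parts, V.card := by
          refine Finset.sum_congr rfl fun V _ => ?_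
          simp [subword]
      _ = u.length := by rw [π.sum_card_parts, Finset.card_univ, Fintype.card_fin]
  rw [h1]
  refine Submodule.subset_span ⟨_, ⟨?_, h2, by simp⟩, rfl⟩
  intro v hv
  obtain ⟨V, hV, rfl⟩ := Multiset.mem_map.1 hv
  exact subword_ne_nil (π.nonempty_of_mem_parts hV)

/-- In the convolution with `g`, the one-block partition gives a multiple of the coordinate itself.
A partition with several blocks gives a product with one factor per block and the same total length.
-/
theorem rightTranslate_coeff {u : List (Fin s)} (hu : u ≠ []) (g : H) :
    ∃ c : k, rightTranslate H g (monomial H {u}) - c • monomial H {u} ∈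
      monomialSpan H u.length 2 := by
  refine ⟨(u.map fun i => (g : NCSeries k s).coeff [i]).prod, ?_⟩
  have h : rightTranslate H g (monomial H {u}) -
      (u.map fun i => (g : NCSeries k s).coeff [i]).prod • monomial H {u} =
      ∑ π ∈ (NC u.length).filter (1 < ·.parts.card),
        (g : NCSeries k s).coeffPart u (kreweras π) •
          fun x : H => (x : NCSeries k s).coeffPart u π := by
    rw [monomial_singleton, sub_eq_iff_eq_add]
    funext x
    have := coeff_mul_eq_add (x : NCSeries k s) g hu
    simp only [Pi.add_apply, Pi.smul_apply, Finset.sum_apply, smul_eq_mul]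
    change ((x : NCSeries k s) * g).coeff u = _
    rw [this, add_comm, mul_comm]
    simp only [mul_comm]
  rw [h]
  refine Submodule.sum_mem _ fun π hπ => Submodule.smul_mem _ _ ?_
  exact monomialSpan_anti (Finset.mem_filter.1 hπ).2 (coeffPart_mem_monomialSpan u π)

/-- Right translations are triangular on monomials with respect to the number of factors. -/
theorem rightTranslate_monomial {L : Multiset (List (Fin s))} (hL : ∀ u ∈ L, u ≠ []) (g : H) :
    ∃ c : k, rightTranslate H g (monomial H L) - c • monomial H L ∈
      monomialSpan H (L.map List.length).sum (Multiset.card L + 1) := by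
  induction L using Multiset.induction_on with
  | empty =>
    refine ⟨1, ?_⟩
    have : rightTranslate H g (monomial H 0) - (1 : k) • monomial H 0 = 0 := by
      rw [one_smul, sub_eq_zero]
      rfl
    rw [this]
    exact zero_mem _
  | cons u L ih =>
    obtain ⟨c, hc⟩ := ih fun v hv => hL v (Multiset.mem_cons_of_mem hv)
    obtain ⟨c', hc'⟩ := rightTranslate_coeff (hL u (Multiset.mem_cons_self u L)) g
    refine ⟨c' * c, ?_⟩
    have hu : monomial H {u} ∈ monomialSpan H u.length 1 := by
      have := monomial_mem_monomialSpan (H := H) (L := {u}) (d := 1)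
        (by simpa using hL u (Multiset.mem_cons_self u L)) (by simp)
      simpa using this
    have hm := monomial_mem_monomialSpan (H := H) (L := L)
      (fun v hv => hL v (Multiset.mem_cons_of_mem hv)) le_rfl
    rw [monomial_cons, rightTranslate_mul_apply, Multiset.map_cons, Multiset.sum_cons,
      Multiset.card_cons]
    set p := rightTranslate H g (monomial H {u}) with hp
    set q := rightTranslate H g (monomial H L) with hq
    -- Right translation is multiplicative on functions. Each of the three remainder products gains
    -- at least one factor.
    have h : p * q - (c' * c) • (monomial H {u} * monomial H L) =
        c' • (monomial H {u} * (q - c • monomial H L)) +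
        (c • ((p - c' • monomial H {u}) * monomial H L) +
          (p - c' • monomial H {u}) * (q - c • monomial H L)) := by
      funext x
      simp only [Pi.sub_apply, Pi.mul_apply, Pi.add_apply, Pi.smul_apply, smul_eq_mul]
      ring
    rw [h]
    refine add_mem (Submodule.smul_mem _ _ ?_) (add_mem (Submodule.smul_mem _ _ ?_) ?_)
    · exact monomialSpan_anti (by omega) (mul_mem_monomialSpan hu hc)
    · exact monomialSpan_anti (by omega) (mul_mem_monomialSpan hc' hm)
    · exact monomialSpan_anti (by omega) (mul_mem_monomialSpan hc' hc)

/-- The multisets of non-empty words of total length at most `n`. -/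
theorem finite_multiset_words (s n : ℕ) :
    {L : Multiset (List (Fin s)) | (∀ u ∈ L, u ≠ []) ∧ (L.map List.length).sum ≤ n}.Finite := by
  let F := (List.finite_length_le (Fin s) n).toFinset
  -- Each of the finitely many words of length at most `n` occurs at most `n` times, since non-empty
  -- words have length at least `1`.
  refine (Set.finite_Iic (n • F.val)).subset ?_
  rintro L ⟨h1, h2⟩
  have hcard : Multiset.card L ≤ (L.map List.length).sum := by
    have := Multiset.card_nsmul_le_sum (s := L.map List.length) (a := 1) (by
      intro x hx
      obtain ⟨u, hu, rfl⟩ := Multiset.mem_map.1 hx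
      exact List.length_pos_of_ne_nil (h1 u hu))
    simpa using this
  rw [Set.mem_Iic, Multiset.le_iff_count]
  intro u
  by_cases hu : u ∈ L
  · have hF : u ∈ F.val := by
      have : u.length ≤ (L.map List.length).sum :=
        Multiset.single_le_sum (fun _ _ => Nat.zero_le _) _ (Multiset.mem_map_of_mem _ hu)
      simpa [F] using this.trans h2
    rw [Multiset.count_nsmul, Multiset.count_eq_one_of_mem F.nodup hF, mul_one]
    exact ((Multiset.count_le_card u L).trans hcard).trans h2
  · rw [Multiset.count_eq_zero_of_notMem hu]
    exact Nat.zero_le _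

/-- The coordinate functions of degree at most `n` lie in a finite-dimensional stable space with
stable flags. -/
theorem exists_hasStableFlags (H : Subsemigroup (NCSeries k s)) (n : ℕ) :
    ∃ U : Submodule k (H → k), FiniteDimensional k U ∧ coordinateRep H n ≤ U ∧
      HasStableFlags (rightTranslate H) U := by
  let S := (finite_multiset_words s n).toFinset
  have hS : ∀ L, L ∈ S ↔ (∀ u ∈ L, u ≠ []) ∧ (L.map List.length).sum ≤ n := fun L => by simp [S]
  obtain ⟨h1, h2⟩ := isStable_hasStableFlags_span (T := rightTranslate H) (monomial H)
    Multiset.card S fun L hL g => by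
      obtain ⟨c, hc⟩ := rightTranslate_monomial ((hS L).1 hL).1 g
      rw [← sub_add_cancel (rightTranslate H g (monomial H L)) (c • monomial H L)]
      refine Submodule.add_mem_sup (Submodule.span_mono (Set.image_mono ?_) hc)
        (Submodule.smul_mem _ _ (Submodule.mem_span_singleton_self _))
      rintro L' ⟨h1, h2, h3⟩
      exact ⟨(hS L').2 ⟨h1, h2 ▸ ((hS L).1 hL).2⟩, h3⟩
  refine ⟨Submodule.span k (monomial H '' S),
    FiniteDimensional.span_of_finite k (S.finite_toSet.image _), sInf_le ⟨fun w hw hwn => ?_, h1⟩, h2⟩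
  rw [← monomial_singleton]
  refine Submodule.subset_span ⟨{w}, (hS _).2 ⟨?_, by simpa using hwn⟩, rfl⟩
  simpa using List.ne_nil_of_length_pos hw

theorem isStable_coordinateRep (H : Subsemigroup (NCSeries k s)) (n : ℕ) :
    IsStable (rightTranslate H) (coordinateRep H n) := by
  intro g h hh
  rw [coordinateRep, Submodule.mem_sInf] at hh ⊢
  exact fun V hV => hV.2 g h (hh V hV)

theorem coeff_mem_coordinateRep {n : ℕ} {w : List (Fin s)} (h1 : 1 ≤ w.length)
    (h2 : w.length ≤ n) : (fun f : H => (f : NCSeries k s).coeff w) ∈ coordinateRep H n := by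
  rw [coordinateRep, Submodule.mem_sInf]
  exact fun V hV => hV.1 w h1 h2

theorem coordinateRep_mono (H : Subsemigroup (NCSeries k s)) : Monotone (coordinateRep H) := by
  intro m n hmn
  exact sInf_le_sInf fun V hV => ⟨fun w h1 h2 => hV.1 w h1 (h2.trans hmn), hV.2⟩

/-- The series `z_1 + ⋯ + z_s + z_w`, when `|w| ≥ 2`. -/
def oneAddMonomial (k : Type*) [Field k] {s : ℕ} (w : List (Fin s)) : NCSeries k s :=
  ⟨fun u => if u.length = 1 then 1 else if u = w ∧ u ≠ [] then 1 else 0, by simp⟩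

theorem oneAddMonomial_mem (hH : H = groupG k s ∨ H = groupGPlus k s) (w : List (Fin s)) :
    oneAddMonomial k w ∈ H := by
  have h : ∀ i : Fin s, (oneAddMonomial k w).coeff [i] = 1 := fun i => rfl
  rcases hH with rfl | rfl
  · exact fun i => by rw [h]; exact isUnit_one
  · exact h

/-- Evaluation at `z_1 + ⋯ + z_s + z_w`, with `w` one of the words in question, isolates the
coefficient of that word. The lengths start at `2` because linear coefficients are constant on
`groupGPlus`. -/
theorem linearIndependent_coeff_replicate (hH : H = groupG k s ∨ H = groupGPlus k s) (i : Fin s) :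
    LinearIndependent k fun (m : ℕ) (f : H) =>
      (f : NCSeries k s).coeff (List.replicate (m + 2) i) := by
  rw [linearIndependent_iff']
  intro t c hc j hj
  have h := congrFun hc ⟨_, oneAddMonomial_mem hH (List.replicate (j + 2) i)⟩
  have h1 : ∀ m, (oneAddMonomial k (List.replicate (j + 2) i)).coeff (List.replicate (m + 2) i) =
      if m = j then 1 else 0 := by
    intro m
    change (if (List.replicate (m + 2) i).length = 1 then (1 : k) else
      if List.replicate (m + 2) i = List.replicate (j + 2) i ∧ List.replicate (m + 2) i ≠ []
      then 1 else 0) = _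
    simp
  simpa [h1, hj] using h

/-- The union of the coordinate representations is infinite-dimensional, as a basis indexed by `ℕ`
requires. This needs at least one letter. -/
theorem exists_not_coordinateRep_le (hs : 1 ≤ s) (hH : H = groupG k s ∨ H = groupGPlus k s)
    (A : Submodule k (H → k)) (hA : FiniteDimensional k A) : ∃ n, ¬ coordinateRep H n ≤ A := by
  by_contra! h
  have h1 := linearIndependent_coeff_replicate hH (⟨0, hs⟩ : Fin s)
  have h2 : ∀ m : ℕ, (fun f : H => (f : NCSeries k s).coeff (List.replicate (m + 2) ⟨0, hs⟩)) ∈ A :=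
    fun m => h (m + 2) (coeff_mem_coordinateRep (by simp) (by simp))
  have h3 : LinearIndependent k fun m : ℕ => (⟨_, h2 m⟩ : A) :=
    LinearIndependent.of_comp A.subtype h1
  exact not_finite_iff_infinite.2 inferInstance h3.finite

end NCSeries

/-! ### Existence and faithfulness of the minimal representation. -/

section MinimalRep

open NCSeries

variable {k : Type*} [Field k] {s : ℕ} {H : Subsemigroup (NCSeries k s)}

theorem rightTranslate_rightTranslate (f g : H) (h : H → k) :
    rightTranslate H f (rightTranslate H g h) = rightTranslate H (f * g) h := by
  funext x
  exact congrArg h (Subtype.ext (boxed_assoc (x : NCSeries k s) f g))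

theorem exists_isMinimalRep (hs : 1 ≤ s) (hH : H = groupG k s ∨ H = groupGPlus k s) :
    ∃ ρ : H → borelLimit k, IsMinimalRep H ρ := by
  choose U hU hVU hfl using exists_hasStableFlags H
  obtain ⟨b, hb, hspan, hflag, htri⟩ := exists_triangular_basis (coordinateRep H)
    (coordinateRep_mono H) (fun n => Submodule.finiteDimensional_of_le (hVU n))
    (isStable_coordinateRep H) (fun n => (hfl n).mono (hVU n)) (exists_not_coordinateRep_le hs hH)
  -- One coefficient sequence, vanishing beyond `j`, serves every size `N > j`. Hence the matrices
  -- are upper triangular and are corners of one another.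
  have hc : ∀ (g : H) (j : ℕ), ∃ c : ℕ → k, (∀ i, j < i → c i = 0) ∧
      ∀ N, j < N → rightTranslate H g (b j) = ∑ i : Fin N, c i • b i := by
    intro g j
    obtain ⟨c, hc, h⟩ := (Finsupp.mem_span_image_iff_linearCombination k).1 (htri g j)
    have h0 : ∀ i, j < i → c i = 0 := by
      intro i hi
      by_contra h1
      have := hc (Finsupp.mem_support_iff.2 h1)
      exact absurd (Set.mem_Iio.1 this) (by omega)
    refine ⟨c, h0, fun N hN => ?_⟩
    rw [← h, Fin.sum_univ_eq_sum_range (fun i => c i • b i), Finsupp.linearCombination_apply]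
    refine Finsupp.sum_of_support_subset _ (fun i hi => ?_) _ (by simp)
    rw [Finset.mem_range]
    by_contra h1
    exact Finsupp.mem_support_iff.1 hi (h0 i (by omega))
  choose c hc0 hc using hc
  let M : H → (N : ℕ) → Matrix (Fin N) (Fin N) k := fun g N i j => c g j i
  have hM : ∀ g N (j : Fin N), rightTranslate H g (b j) = ∑ i, M g N i j • b i :=
    fun g N j => hc g j N j.2
  have hmul : ∀ f g N, M (f * g) N = M f N * M g N := by
    intro f g N
    refine matrix_eq_mul_of_comp hb (rightTranslate H f) (rightTranslate H g) (hM f N) (hM g N) ?_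
    intro j
    rw [rightTranslate_rightTranslate]
    exact hM (f * g) N j
  obtain ⟨-, e, -, he, hinv⟩ := isBoxedGroup_of_eq hH
  have hone : ∀ N, M e N = 1 := by
    intro N
    have h : ∀ h : H → k, rightTranslate H e h = h := fun h => funext fun x => by
      change h (x * e) = h x
      rw [(he x).2]
    ext i j
    refine congrFun (hb.eq_of_sum_fin_eq (x := fun i => M e N i j)
      (y := fun i => (1 : Matrix (Fin N) (Fin N) k) i j) ?_) i
    rw [← hM, h]
    simp [Matrix.one_apply]
  choose inv hinv using hinv
  let G : H → (N : ℕ) → borelGroup k N := fun g N =>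
    ⟨⟨M g N, M (inv g) N, by rw [← hmul, (hinv g).1, hone], by rw [← hmul, (hinv g).2, hone]⟩,
      fun i j hij => hc0 g j i hij⟩
  exact ⟨fun g => ⟨G g, fun N i j => rfl⟩, b, hb, hspan, hflag, fun g N j => hM g N j⟩

/-- Every minimal representation is an injective homomorphism. -/
theorem IsMinimalRep.isFaithfulRep (hH : H = groupG k s ∨ H = groupGPlus k s)
    {ρ : H → borelLimit k} (hρ : IsMinimalRep H ρ) : IsFaithfulRep H ρ := by
  obtain ⟨b, hb, hspan, -, hact⟩ := hρ
  obtain ⟨-, e, -, he, -⟩ := isBoxedGroup_of_eq hH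
  refine ⟨fun f g => ?_, fun f g hfg => ?_⟩
  · refine Subtype.ext (funext fun N => Subtype.ext (Units.ext ?_))
    refine matrix_eq_mul_of_comp hb (rightTranslate H f) (rightTranslate H g) (hact f N)
      (hact g N) fun j => ?_
    rw [rightTranslate_rightTranslate]
    exact hact (f * g) N j
  · have h1 : ∀ j, rightTranslate H f (b j) = rightTranslate H g (b j) := by
      intro j
      have h2 := hact f (j + 1) (Fin.last j)
      have h3 := hact g (j + 1) (Fin.last j)
      rw [hfg] at h2
      exact h2.trans h3.symm
    have h2 : ∀ h ∈ ⨆ n, coordinateRep H n, rightTranslate H f h = rightTranslate H g h := by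
      rw [← hspan]
      intro h hh
      exact LinearMap.eqOn_span (s := Set.range b) (by rintro _ ⟨j, rfl⟩; exact h1 j) hh
    refine Subtype.ext (toWordSeries_injective ?_)
    ext w
    rcases eq_or_ne w [] with rfl | hw
    · rw [toWordSeries_nil, toWordSeries_nil]
    -- Evaluating the translate of `X_w` at the neutral element returns the coefficient `X_w` of the
    -- group element itself.
    have h3 := congrFun (h2 _ (Submodule.mem_iSup_of_mem w.length (coeff_mem_coordinateRep
      (List.length_pos_of_ne_nil hw) le_rfl))) e
    change (((e * f : H)) : NCSeries k s).coeff w = ((e * g : H) : NCSeries k s).coeff w at h3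
    rwa [(he f).1, (he g).1] at h3

end MinimalRep

theorem mainTheorem5 {k : Type*} [Field k] (s : ℕ) (hs : 1 ≤ s)
    (H : Subsemigroup (NCSeries k s)) (hH : H = groupG k s ∨ H = groupGPlus k s) :
    IsBoxedGroup H ∧
    (∃ ρ : H → borelLimit k, IsMinimalRep H ρ) ∧
    (∀ ρ : H → borelLimit k, IsMinimalRep H ρ → IsFaithfulRep H ρ) ∧
    ∀ ρ : H → borelLimit k, IsFaithfulRep H ρ →
      ∀ {A : Type*} [Ring A] [Algebra k A] (φ : A →ₗ[k] k), φ 1 = 1 →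
        (∀ (a a' : Fin s → A) (ha : rTransform φ a ∈ H) (ha' : rTransform φ a' ∈ H),
          sTransform ρ φ a ha = sTransform ρ φ a' ha' ↔ law φ a = law φ a') ∧
        ∀ (a b : Fin s → A) (ha : rTransform φ a ∈ H) (hb : rTransform φ b ∈ H),
          CombinatoriallyFree φ ![Set.range a, Set.range b] →
          ∃ hab : rTransform φ (fun i => a i * b i) ∈ H,
            sTransform ρ φ (fun i => a i * b i) hab =
              sTransform ρ φ a ha * sTransform ρ φ b hb := by
  have hG := NCSeries.isBoxedGroup_of_eq hH
  refine ⟨hG, exists_isMinimalRep hs hH, fun ρ hρ => hρ.isFaithfulRep hH, ?_⟩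
  intro ρ hρ A _ _ φ hφ
  refine ⟨fun a a' ha ha' => ?_, fun a b ha hb hfree => ?_⟩
  · rw [sTransform, sTransform, hρ.2.eq_iff, Subtype.mk_eq_mk, law_eq_iff,
      ← NCSeries.toWordSeries_injective.eq_iff, toWordSeries_rTransform, toWordSeries_rTransform]
    exact ⟨momentSeries_eq_of_cumulantSeries_eq hφ, cumulantSeries_eq_of_momentSeries_eq hφ⟩
  · have h := rTransform_mul hφ a b hfree
    refine ⟨h ▸ H.mul_mem ha hb, ?_⟩
    rw [sTransform, sTransform, sTransform, ← hρ.1]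
    exact congrArg ρ (Subtype.ext h)
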